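/- **Setting.** Let $n\ge 0$, $m\ge 1$, $f:\mathbb R^n\to\mathbb R$, $a=(a_1,\dots,a_m):\mathbb R^n\to\mathbb R^m$, $x^{(0)}\in\mathbb R^n$, $\varepsilon_{\rm opt},\varepsilon_{\rm inf}>0$. Write $\log^+z=\max\{\log z,1\}$, $v(x)=\max_i\max\{-a_i(x),0\}$, $t^{(0)}=\varepsilon_{\rm opt}/2+v(x^{(0)})$, $$\tilde{\mathcal X}^{P1}=\{x: a(x)\ge-(\varepsilon_{\rm opt}/2+t^{(0)})\mathbf 1\},\qquad \tilde{\mathcal X}^{P2}=\{x:a(x)\ge-\varepsilon_{\rm opt}\mathbf 1\}.$$ A function $w$ has $L$-Lipschitz $p$th derivatives on $S$ if for all $x\in S$, $\|v\|_2\le1$ the function $g(\theta)=w(x+\theta v)$ is $p+1$ times differentiable with $|g^{(p+1)}(\theta)|\le L$ at each $\theta$ with $x+\theta v\in S$. **Trust-IPM** with data $(f,a,\mu,\tau_l,L_1,\sigma)$ and a start $x$. Let $\psi_\mu=f-\mu\sum_i\log a_i$, $\mathcal L(x,y)=f(x)-y^Ta(x)$, $\eta_s=\frac1{40}(\tau_l^2\mu/L_1)^{1/4}$,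 $\eta_x=\eta_s/2$, $\tau_c=(\tau_l^2\mu/L_1)^{1/2}$. Each iteration sets $y_i=\mu/a_i(x)$, $r=\eta_x\sqrt{\mu/(L_1(1+\|y\|_1))}$, takes any minimizer $d_x$ of $\frac12u^T\nabla^2\psi_\mu(x)u+\nabla\psi_\mu(x)^Tu$ over $\|u\|_2\le r$ (one trust-region solve), and with $S=\mathrm{diag}(a(x))$, $d_s=\nabla a(x)d_x$, $d_y=-\mu S^{-2}d_s$, $\alpha=\min\{\eta_s/\|S^{-1}d_s\|_2,1\}$ sets $x^+=x+\alpha d_x$, $y^+=y+\alpha d_y$. It returns $(x^+,y^+)$ if $$a(x^+),y^+>0,\quad |y^+_ia_i(x^+)-\mu|\le\tfrac{\tau_c\mu}2\ \forall i,\quad \|\nabla_x\mathcal L(x^+,y^+)\|_2\le\tau_l\mu\sqrt{\|y^+\|_1+1},\quad \nabla^2\psi_\mu(x^+)\succeq-\sigma\sqrt{\tau_l}\,(1+\|y^+\|_1)I,$$ and otherwise continues from $x^+$. **Two-phase IPM.** *Phase one.* If $t^{(0)}\le\varepsilon_{\rm opt}/2$, put $x^{P1}=x^{(0)}$. Otherwise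 run Trust-IPM from $(x^{(0)},t^{(0)})$ on $\min t$ subject to $a(x)+t\mathbf 1\ge0$, $t\ge0$, $\varepsilon_{\rm opt}/2+t^{(0)}-t\ge0$, with $\mu=\varepsilon_{\rm inf}\varepsilon_{\rm opt}/12$, $\tau_l=\min\{1/\varepsilon_{\rm opt},\sqrt{L_1/(2\varepsilon_{\rm opt}\varepsilon_{\rm inf})}\}$, to get $x^{P1},t^{P1}$ and the dual variables $y^{P1}$ of $a(x)+t\mathbf 1\ge 0$; if $\min_ia_i(x^{P1})<-\varepsilon_{\rm opt}/2$, return INF and $(x^{P1},t^{P1},y^{P1}/\|y^{P1}\|_1)$. *Phase two.* Run Trust-IPM from $x^{P1}$ on $\min f$ subject to $a(x)+\varepsilon_{\rm opt}\mathbf 1\ge0$, with $\mu=\varepsilon_{\rm opt}/4$, $\tau_l=\sqrt{\varepsilon_{\rm inf}/(2(L_0+1))}$, to get $(x,y)$. If $\|y\|_1>3\varepsilon_{\rm opt}^2/\varepsilon_{\rm inf}^2+3L_0/\varepsilon_{\rm inf}$, return INF and $(x,\varepsilon_{\rm opt},y/\|y\|_1)$; otherwise return KKT and $(x,y)$. **Assumptions.**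 Each $a_i$ is continuous; the $a_i$ on $\tilde{\mathcal X}^{P1}$, and $f$ on $\tilde{\mathcal X}^{P2}$, have $L_1$-Lipschitz first and $L_2$-Lipschitz second derivatives ($L_2>0$); $f$ is $L_0$-Lipschitz; $$c\ge\sup_{x\in\tilde{\mathcal X}^{P1}}\max_ia_i(x),\qquad \Delta_f\ge\sup_{\tilde{\mathcal X}^{P2}}f-\inf_{\tilde{\mathcal X}^{P2}}f,\qquad \Delta_a\ge v(x^{(0)}),$$ $c,\Delta_a,\Delta_f,L_1,L_0\ge1$; $0<\varepsilon_{\rm opt}\le\frac1{m\log^+(c/\varepsilon_{\rm opt})}$, $0<\varepsilon_{\rm inf}\le\min\{1,L_0/m\}$, $\varepsilon_{\rm opt}\le\sqrt{\varepsilon_{\rm inf}}$; and the barrier parameters are small enough that $$L_2^2\,\varepsilon_{\rm opt}\le4L_1^3,\qquad 40\,(L_1^3\varepsilon_{\rm opt})^{1/4}\le\sigma .$$ **Claim.** There is a universal constant $C$ such that, under these assumptions, every execution of the two-phase IPM (whatever minimizers are chosen) returns after at most $$C\left(\Delta_a\left(\frac{L_1^{3/4}}{\varepsilon_{\rm inf}^{7/4}\varepsilon_{\rm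 opt}^{1/4}}+\frac1{\varepsilon_{\rm inf}\varepsilon_{\rm opt}}\right)+\frac{\Delta_f}{\varepsilon_{\rm opt}}\left(\frac{L_1L_0}{\varepsilon_{\rm opt}\varepsilon_{\rm inf}}\right)^{3/4}\right)$$ trust-region subproblem solves. If it returns KKT and $(x,y)$, then $$a(x)\ge-\varepsilon_{\rm opt}\mathbf 1,\quad\|\nabla_x\mathcal L(x,y)\|_2\le\varepsilon_{\rm opt},\quad y\ge0,\quad a_i(x)y_i\le\varepsilon_{\rm opt}\ \forall i .$$ If it returns INF and $(x,t,y)$, then $$\min_ia_i(x)<-\tfrac{\varepsilon_{\rm opt}}2,\quad a(x)+t\mathbf 1\ge0,\quad\|\nabla a(x)^Ty\|_2\le\varepsilon_{\rm inf},\quad\|y\|_1=1,\quad y\ge0,\quad(a_i(x)+t)y_i\le\varepsilon_{\rm inf}\varepsilon_{\rm opt}\ \forall i .$$ -/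

import Mathlib

noncomputable section

namespace TwoPhaseIPM

/-! ### Lipschitz derivatives along lines -/

/-- A univariate function has `L`-Lipschitz `p`th derivatives on `T`: at every point of `T` it is
`p + 1` times differentiable and its derivative of order `p + 1` is bounded by `L`. -/
def HasLipschitzDerivOnLine (p : ℕ) (L : ℝ) (g : ℝ → ℝ) (T : Set ℝ) : Prop :=
  ∀ θ ∈ T, (∀ k ≤ p, DifferentiableAt ℝ (iteratedDeriv k g) θ) ∧
    |iteratedDeriv (p + 1) g θ| ≤ L

/-- A multivariate function has `L`-Lipschitz `p`th derivatives on `S`: the univariate condition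
holds for its restriction to every line through a point of `S`, with direction in the unit ball. -/
def HasLipschitzDerivOn {E : Type*} [NormedAddCommGroup E] [NormedSpace ℝ E]
    (p : ℕ) (L : ℝ) (w : E → ℝ) (S : Set E) : Prop :=
  ∀ x ∈ S, ∀ v : E, ‖v‖ ≤ 1 →
    HasLipschitzDerivOnLine p L (fun θ : ℝ => w (x + θ • v)) {θ : ℝ | x + θ • v ∈ S}

/-- `log⁺ z = max {log z, 1}`. -/
def logPlus (z : ℝ) : ℝ := max (Real.log z) 1

/-! ### The trust region interior point method with fixed `μ` -/

section TrustIPM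

variable {E : Type*} [NormedAddCommGroup E] [InnerProductSpace ℝ E] [CompleteSpace E]
variable {ι : Type*} [Fintype ι]

/-- The `ℓ₁` norm of a vector of dual variables. -/
def norm1 (y : ι → ℝ) : ℝ := ∑ i, |y i|

/-- The log barrier `ψ_μ(x) = f(x) - μ ∑ log aᵢ(x)`. -/
def barrier (f : E → ℝ) (a : ι → E → ℝ) (μ : ℝ) (x : E) : ℝ :=
  f x - μ * ∑ i, Real.log (a i x)

/-- The Lagrangian `f(x) - yᵀ a(x)`. -/
def lagrangian (f : E → ℝ) (a : ι → E → ℝ) (y : ι → ℝ) (x : E) : ℝ :=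
  f x - ∑ i, y i * a i x

/-- The quadratic form `uᵀ ∇²w(x) u`. -/
def hessForm (w : E → ℝ) (x u : E) : ℝ := fderiv ℝ (fderiv ℝ w) x u u

/-- The quadratic model `½ uᵀ ∇²w(x) u + ∇w(x)ᵀ u`. -/
def model (w : E → ℝ) (x u : E) : ℝ :=
  1 / 2 * hessForm w x u + inner ℝ (gradient w x) u

/-- `d` is a solution of the trust region subproblem of radius `r` for `w` at `x`. -/
def IsTrustRegionSolution (w : E → ℝ) (x : E) (r : ℝ) (d : E) : Prop :=
  ‖d‖ ≤ r ∧ ∀ u : E, ‖u‖ ≤ r → model w x d ≤ model w x u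

/-- `(x, y)` is a `(μ, τl, τc)`-approximate first-order Fritz John point. -/
def IsFritzJohn1 (f : E → ℝ) (a : ι → E → ℝ) (μ τl τc : ℝ) (x : E) (y : ι → ℝ) : Prop :=
  (∀ i, 0 < a i x) ∧ (∀ i, 0 < y i) ∧
  (∀ i, |y i * a i x - μ| ≤ τc * μ / 2) ∧
  ‖gradient (lagrangian f a y) x‖ ≤ τl * μ * Real.sqrt (norm1 y + 1)

/-- The second-order condition `∇²ψ_μ(x) ⪰ -σ √τl (1 + ‖y‖₁) I`. -/
def IsFritzJohn2 (f : E → ℝ) (a : ι → E → ℝ) (μ τl σ : ℝ) (x : E) (y : ι → ℝ) : Prop :=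
  ∀ u : E, -(σ * Real.sqrt τl * (1 + norm1 y)) * ‖u‖ ^ 2 ≤ hessForm (barrier f a μ) x u

/-- The Euclidean norm of `S⁻¹ d_s`, where `S = diag(a(x))` and `d_s = ∇a(x) d`. -/
def scaledSlackNorm (a : ι → E → ℝ) (x d : E) : ℝ :=
  Real.sqrt (∑ i, (fderiv ℝ (a i) x d / a i x) ^ 2)

/-- The step size `min {ηs / ‖S⁻¹ d_s‖₂, 1}`, which is `1` if `S⁻¹ d_s = 0`. -/
def stepSize (ηs : ℝ) (a : ι → E → ℝ) (x d : E) : ℝ :=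
  if scaledSlackNorm a x d ≤ ηs then 1 else ηs / scaledSlackNorm a x d

/-- One pass through the loop of the trust region IPM: from the iterate `x` it may produce
`(x', y')`. It solves one trust region subproblem, and any of its solutions may be chosen. -/
def IpmIteration (f : E → ℝ) (a : ι → E → ℝ) (μ L₁ ηs ηx : ℝ)
    (x x' : E) (y' : ι → ℝ) : Prop :=
  ∃ d : E,
    IsTrustRegionSolution (barrier f a μ) x
      (ηx * Real.sqrt (μ / (L₁ * (1 + norm1 (fun i => μ / a i x))))) d ∧
    x' = x + stepSize ηs a x d • d ∧
    y' = fun i => μ / a i x + stepSize ηs a x d * (-(μ * fderiv ℝ (a i) x d / a i x ^ 2))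

/-- The termination test of the trust region IPM, with `τc = (τl² μ / L₁)^{1/2}`. -/
def IpmStop (f : E → ℝ) (a : ι → E → ℝ) (μ τl L₁ σ : ℝ) (x' : E) (y' : ι → ℝ) : Prop :=
  IsFritzJohn1 f a μ τl (Real.sqrt (τl ^ 2 * μ / L₁)) x' y' ∧ IsFritzJohn2 f a μ τl σ x' y'

end TrustIPM

/-- `ηs = (1/40) (τl² μ / L₁)^{1/4}`. -/
def etaS (μ τl L₁ : ℝ) : ℝ := 1 / 40 * (τl ^ 2 * μ / L₁) ^ (1 / 4 : ℝ)

/-- `ηx = ηs / 2`. -/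
def etaX (μ τl L₁ : ℝ) : ℝ := etaS μ τl L₁ / 2

/-! ### The two-phase method -/

/-- The data of a call of the two-phase IPM. The number `σ` is the factor in the second-order part
of the termination test of the trust region IPM. No property of the data is assumed here. -/
structure Input (n m : ℕ) where
  f : EuclideanSpace ℝ (Fin n) → ℝ
  a : Fin m → EuclideanSpace ℝ (Fin n) → ℝ
  εopt : ℝ
  εinf : ℝ
  L₀ : ℝ
  L₁ : ℝ
  σ : ℝ
  x₀ : EuclideanSpace ℝ (Fin n)

/-- What the method returns: the status together with the point `(x, y)` or `(x, t, y)`. -/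
inductive Outcome (n m : ℕ) where
  | kkt (x : EuclideanSpace ℝ (Fin n)) (y : Fin m → ℝ)
  | inf (x : EuclideanSpace ℝ (Fin n)) (t : ℝ) (y : Fin m → ℝ)

/-- The points `(x, t)` of the phase-one problem, with the Euclidean norm. -/
abbrev Point1 (n : ℕ) := WithLp 2 (EuclideanSpace ℝ (Fin n) × ℝ)

/-- The states of the two-phase method: the current iterate of phase one, the current iterate of
phase two, or the returned result. -/
inductive State (n m : ℕ) where
  | phaseOne (z : Point1 n)
  | phaseTwo (x : EuclideanSpace ℝ (Fin n))
  | done (o : Outcome n m)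

namespace Input

variable {n m : ℕ} (D : Input n m)

/-- The maximal constraint violation `maxᵢ max {-aᵢ(x), 0}`. -/
def violation (x : EuclideanSpace ℝ (Fin n)) : ℝ := ⨆ i, max (-(D.a i x)) 0

/-- `t₀ = εopt / 2 + maxᵢ max {-aᵢ(x₀), 0}`. -/
def t₀ : ℝ := D.εopt / 2 + D.violation D.x₀

/-- The relaxed feasible set of phase one. -/
def X1 : Set (EuclideanSpace ℝ (Fin n)) := {x | ∀ i, -(D.εopt / 2 + D.t₀) ≤ D.a i x}

/-- The relaxed feasible set of phase two. -/
def X2 : Set (EuclideanSpace ℝ (Fin n)) := {x | ∀ i, -D.εopt ≤ D.a i x}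

/-- The phase-one objective `t`. -/
def f1 (z : Point1 n) : ℝ := z.snd

/-- The phase-one constraints `aᵢ(x) + t`, `t` and `εopt / 2 + t₀ - t`. -/
def a1 : Fin m ⊕ Fin 2 → Point1 n → ℝ
  | .inl i, z => D.a i z.fst + z.snd
  | .inr 0, z => z.snd
  | .inr 1, z => D.εopt / 2 + D.t₀ - z.snd

/-- The phase-two constraints `aᵢ(x) + εopt`. -/
def a2 (i : Fin m) (x : EuclideanSpace ℝ (Fin n)) : ℝ := D.a i x + D.εopt

def μ1 : ℝ := D.εinf * D.εopt / 12
def τ1 : ℝ := min (1 / D.εopt) (Real.sqrt (D.L₁ / (2 * D.εopt * D.εinf)))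
def μ2 : ℝ := D.εopt / 4
def τ2 : ℝ := Real.sqrt (D.εinf / (2 * (D.L₀ + 1)))

/-- One iteration of the trust region IPM in phase one. -/
def Iter1 : Point1 n → Point1 n → (Fin m ⊕ Fin 2 → ℝ) → Prop :=
  IpmIteration f1 D.a1 D.μ1 D.L₁ (etaS D.μ1 D.τ1 D.L₁) (etaX D.μ1 D.τ1 D.L₁)

/-- The termination test of the trust region IPM in phase one. -/
def Stop1 : Point1 n → (Fin m ⊕ Fin 2 → ℝ) → Prop :=
  IpmStop f1 D.a1 D.μ1 D.τ1 D.L₁ D.σ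

/-- One iteration of the trust region IPM in phase two. -/
def Iter2 : EuclideanSpace ℝ (Fin n) → EuclideanSpace ℝ (Fin n) → (Fin m → ℝ) → Prop :=
  IpmIteration D.f D.a2 D.μ2 D.L₁ (etaS D.μ2 D.τ2 D.L₁) (etaX D.μ2 D.τ2 D.L₁)

/-- The termination test of the trust region IPM in phase two. -/
def Stop2 : EuclideanSpace ℝ (Fin n) → (Fin m → ℝ) → Prop :=
  IpmStop D.f D.a2 D.μ2 D.τ2 D.L₁ D.σ

/-- The method declares infeasibility after phase two if `‖y‖₁` exceeds this number. -/
def dualThreshold : ℝ := 3 * D.εopt ^ 2 / D.εinf ^ 2 + 3 * D.L₀ / D.εinf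

open Classical in
/-- The state in which the method starts: phase one is skipped if `t₀ ≤ εopt / 2`. -/
def init : State n m :=
  if D.t₀ ≤ D.εopt / 2 then .phaseTwo D.x₀ else .phaseOne (WithLp.toLp 2 (D.x₀, D.t₀))

/-- The transitions of the two-phase method. Each is one iteration of the trust region IPM together
with the bookkeeping up to the next iteration, and so solves exactly one trust region subproblem. -/
inductive Step : State n m → State n m → Prop
  | one_continue (z z' : Point1 n) (y' : Fin m ⊕ Fin 2 → ℝ) :
      D.Iter1 z z' y' → ¬ D.Stop1 z' y' → Step (.phaseOne z) (.phaseOne z')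
  | one_infeasible (z z' : Point1 n) (y' : Fin m ⊕ Fin 2 → ℝ) :
      D.Iter1 z z' y' → D.Stop1 z' y' → (∃ i, D.a i z'.fst < -D.εopt / 2) →
      Step (.phaseOne z)
        (.done (.inf z'.fst z'.snd (fun i => y' (.inl i) / norm1 (fun j => y' (.inl j)))))
  | one_feasible (z z' : Point1 n) (y' : Fin m ⊕ Fin 2 → ℝ) :
      D.Iter1 z z' y' → D.Stop1 z' y' → ¬ (∃ i, D.a i z'.fst < -D.εopt / 2) →
      Step (.phaseOne z) (.phaseTwo z'.fst)
  | two_continue (x x' : EuclideanSpace ℝ (Fin n)) (y' : Fin m → ℝ) :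
      D.Iter2 x x' y' → ¬ D.Stop2 x' y' → Step (.phaseTwo x) (.phaseTwo x')
  | two_infeasible (x x' : EuclideanSpace ℝ (Fin n)) (y' : Fin m → ℝ) :
      D.Iter2 x x' y' → D.Stop2 x' y' → D.dualThreshold < norm1 y' →
      Step (.phaseTwo x) (.done (.inf x' D.εopt (fun i => y' i / norm1 y')))
  | two_kkt (x x' : EuclideanSpace ℝ (Fin n)) (y' : Fin m → ℝ) :
      D.Iter2 x x' y' → D.Stop2 x' y' → ¬ (D.dualThreshold < norm1 y') →
      Step (.phaseTwo x) (.done (.kkt x' y'))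

/-- `D.Run k s`: some execution of the method is in state `s` after exactly `k` trust region
subproblem solves. -/
inductive Run : ℕ → State n m → Prop
  | start : Run 0 D.init
  | step (k : ℕ) (s s' : State n m) : Run k s → D.Step s s' → Run (k + 1) s'

/-- The approximate (unscaled) KKT conditions. -/
def IsKKT (x : EuclideanSpace ℝ (Fin n)) (y : Fin m → ℝ) : Prop :=
  DifferentiableAt ℝ D.f x ∧ (∀ i, DifferentiableAt ℝ (D.a i) x) ∧
  (∀ i, -D.εopt ≤ D.a i x) ∧
  ‖gradient (lagrangian D.f D.a y) x‖ ≤ D.εopt ∧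
  (∀ i, 0 ≤ y i) ∧
  (∀ i, D.a i x * y i ≤ D.εopt)

/-- The approximate certificate of local infeasibility for the infinity norm of the constraint
violation. -/
def IsInfeasCert (x : EuclideanSpace ℝ (Fin n)) (t : ℝ) (y : Fin m → ℝ) : Prop :=
  (∀ i, DifferentiableAt ℝ (D.a i) x) ∧
  (∃ i, D.a i x < -D.εopt / 2) ∧
  (∀ i, 0 ≤ D.a i x + t) ∧
  ‖∑ i, y i • gradient (D.a i) x‖ ≤ D.εinf ∧
  norm1 y = 1 ∧
  (∀ i, 0 ≤ y i) ∧
  (∀ i, (D.a i x + t) * y i ≤ D.εinf * D.εopt)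

/-- The returned point satisfies the conditions that its status announces. -/
def IsCorrect : Outcome n m → Prop
  | .kkt x y => D.IsKKT x y
  | .inf x t y => D.IsInfeasCert x t y

end Input

end TwoPhaseIPM

end

/-! Each phase is a trust region method on a log barrier `ψ` with fixed `μ`, and `ψ` itself is the
potential that counts iterations. Write `η` for `ηs` and `N = 1 + ∑ μ / aᵢ(x)`. The radius rule
amounts to `L N r² = η² μ / 4`, which makes the relative second order errors of all slacks sum to at
most `η² / 8`. Hence a step inside the trust region with `‖S⁻¹ d_s‖ ≤ η` stays strictly feasible
(`segment_feasible`), and the quadratic model bounds the change of `ψ` from above up to `5 μ η³`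
(`barrier_add_le`).

One iteration falls into one of three cases (`stop_or_decrease`). If the full step is taken and its
model value is at most `-6 μ η³`, then `ψ` drops by `μ η³`. If the step is shortened, the curvature
of the logarithms along `d` forces the same model decrease (`model_smul_le`). Otherwise the full
step has model value above `-6 μ η³`; optimality of `d` then makes the residual `∇ψ + ∇²ψ d` and the
negative curvature of `ψ` at `x` small (`abs_residual_le`, `hess_ge`). Because `y⁺` is the
linearization of `μ / a` at the new point, both bounds pass to `∇ₓL(x⁺, y⁺)` and `∇²ψ(x⁺)`, and the
termination test succeeds (`ipmStop_of_small`).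

The potential can fall by at most `4 Δa` in phase one and `2 Δf` in phase two, since `m log⁺(c /
εopt) εopt ≤ 1` keeps the logarithmic terms bounded. Dividing by `μ η³` gives the iteration count;
the two entries of the minimum defining `τl` in phase one produce the two summands of its bound.

Correctness is read off the termination test. In phase two `‖y‖₁` decides: below the threshold the
scaled stationarity bound is an absolute one, above it division by `‖y‖₁` makes `∇f` negligible. In
phase one the derivative in `t` shows that the multipliers of `a(x) + t ≥ 0` have sum at least
`1/2`, so normalizing them is harmless.

Regularity is assumed only along lines, so Fréchet differentiability up to second order has to be
derived before any of this. -/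

namespace TwoPhaseIPM

open Set Filter Topology

/-! ### Taylor expansions in one variable and along lines -/

section Lines

/-- Fundamental estimate: a function vanishing at `0` whose derivative is at most `C tᵏ` is at most
`C tᵏ⁺¹ / (k + 1)`. -/
theorem abs_le_pow_of_abs_deriv_le {g g' : ℝ → ℝ} {T C : ℝ} {k : ℕ} (h0 : g 0 = 0)
    (hg : ∀ t ∈ Icc 0 T, HasDerivAt g (g' t) t) (hb : ∀ t ∈ Icc 0 T, |g' t| ≤ C * t ^ k) :
    ∀ t ∈ Icc 0 T, |g t| ≤ C * t ^ (k + 1) / (k + 1) := by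
  have hk : (k : ℝ) + 1 ≠ 0 := by positivity
  have := image_norm_le_of_norm_deriv_right_le_deriv_boundary (f := g) (f' := g') (a := 0) (b := T)
    (B := fun t => C * t ^ (k + 1) / (k + 1)) (B' := fun t => C * t ^ k)
    (fun t ht => (hg t ht).continuousAt.continuousWithinAt)
    (fun t ht => (hg t (Ico_subset_Icc_self ht)).hasDerivWithinAt)
    (by simp [h0])
    (fun t => by
      have := ((hasDerivAt_pow (k + 1) t).const_mul C).div_const ((k : ℝ) + 1)
      refine this.congr_deriv ?_
      push_cast
      rw [div_eq_iff hk]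
      ring)
    (fun t ht => hb t (Ico_subset_Icc_self ht))
  exact fun t ht => this ht

theorem taylor_one_of_abs_deriv_two_le {g : ℝ → ℝ} {T L : ℝ} (hT : 0 ≤ T)
    (h1 : ∀ t ∈ Icc 0 T, DifferentiableAt ℝ g t)
    (h2 : ∀ t ∈ Icc 0 T, DifferentiableAt ℝ (deriv g) t)
    (hb : ∀ t ∈ Icc 0 T, |deriv (deriv g) t| ≤ L) :
    |g T - g 0 - T * deriv g 0| ≤ L * T ^ 2 / 2 := by
  have hA := abs_le_pow_of_abs_deriv_le (g := fun t => deriv g t - deriv g 0) (k := 0) (C := L)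
    (T := T) (by simp) (fun t ht => (h2 t ht).hasDerivAt.sub_const _) (by simpa using hb)
  have hB := abs_le_pow_of_abs_deriv_le (g := fun t => g t - g 0 - t * deriv g 0)
    (g' := fun t => deriv g t - deriv g 0) (k := 1) (C := L) (T := T) (by simp)
    (fun t ht => by
      simpa using ((h1 t ht).hasDerivAt.sub_const (g 0)).fun_sub
        ((hasDerivAt_id' t).mul_const (deriv g 0)))
    (by simpa using hA)
  have := hB T ⟨hT, le_rfl⟩
  norm_num at this
  exact this

theorem taylor_two_of_abs_deriv_three_le {g : ℝ → ℝ} {T L : ℝ} (hT : 0 ≤ T)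
    (h1 : ∀ t ∈ Icc 0 T, DifferentiableAt ℝ g t)
    (h2 : ∀ t ∈ Icc 0 T, DifferentiableAt ℝ (deriv g) t)
    (h3 : ∀ t ∈ Icc 0 T, DifferentiableAt ℝ (deriv (deriv g)) t)
    (hb : ∀ t ∈ Icc 0 T, |deriv (deriv (deriv g)) t| ≤ L) :
    |g T - g 0 - T * deriv g 0 - T ^ 2 / 2 * deriv (deriv g) 0| ≤ L * T ^ 3 / 6 := by
  have hA := abs_le_pow_of_abs_deriv_le (g := fun t => deriv (deriv g) t - deriv (deriv g) 0)
    (k := 0) (C := L) (T := T) (by simp) (fun t ht => (h3 t ht).hasDerivAt.sub_const _)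
    (by simpa using hb)
  have hB := abs_le_pow_of_abs_deriv_le
    (g := fun t => deriv g t - deriv g 0 - t * deriv (deriv g) 0)
    (g' := fun t => deriv (deriv g) t - deriv (deriv g) 0) (k := 1) (C := L) (T := T) (by simp)
    (fun t ht => by
      simpa using ((h2 t ht).hasDerivAt.sub_const (deriv g 0)).fun_sub
        ((hasDerivAt_id' t).mul_const (deriv (deriv g) 0)))
    (by simpa using hA)
  have hC := abs_le_pow_of_abs_deriv_le
    (g := fun t => g t - g 0 - t * deriv g 0 - t ^ 2 / 2 * deriv (deriv g) 0)
    (g' := fun t => deriv g t - deriv g 0 - t * deriv (deriv g) 0) (k := 2) (C := L / 2) (T := T)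
    (by simp)
    (fun t ht => by
      have := (((h1 t ht).hasDerivAt.sub_const (g 0)).fun_sub
        ((hasDerivAt_id' t).mul_const (deriv g 0))).fun_sub
        (((hasDerivAt_pow 2 t).div_const 2).mul_const (deriv (deriv g) 0))
      refine this.congr_deriv ?_
      norm_num)
    (fun t ht => by
      have := hB t ht
      norm_num at this
      linarith)
  have := hC T ⟨hT, le_rfl⟩
  norm_num at this
  rw [show L * T ^ 3 / 6 = L / 2 * T ^ 3 / 3 by ring]
  exact this

variable {E : Type*} [NormedAddCommGroup E] [NormedSpace ℝ E]

/-- The first derivative of `θ ↦ w (y + θ v)` at `0`. -/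
noncomputable def lineD1 (w : E → ℝ) (y v : E) : ℝ := deriv (fun θ : ℝ => w (y + θ • v)) 0

/-- The second derivative of `θ ↦ w (y + θ v)` at `0`. -/
noncomputable def lineD2 (w : E → ℝ) (y v : E) : ℝ :=
  deriv (deriv (fun θ : ℝ => w (y + θ • v))) 0

theorem lineD1_smul (w : E → ℝ) (y v : E) (c : ℝ) : lineD1 w y (c • v) = c * lineD1 w y v := by
  have : (fun θ : ℝ => w (y + θ • c • v)) = fun θ => (fun θ : ℝ => w (y + θ • v)) (c * θ) := by
    funext θ; simp only [smul_smul, mul_comm]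
  rw [lineD1, this, deriv_comp_mul_left c (fun θ : ℝ => w (y + θ • v))]
  simp [lineD1]

theorem lineD2_smul (w : E → ℝ) (y v : E) (c : ℝ) : lineD2 w y (c • v) = c ^ 2 * lineD2 w y v := by
  have : (fun θ : ℝ => w (y + θ • c • v)) = fun θ => (fun θ : ℝ => w (y + θ • v)) (c * θ) := by
    funext θ; simp only [smul_smul, mul_comm]
  have h1 : deriv (fun θ : ℝ => w (y + θ • c • v)) =
      fun θ => c * deriv (fun θ : ℝ => w (y + θ • v)) (c * θ) := by
    funext θ; rw [this, deriv_comp_mul_left c (fun θ : ℝ => w (y + θ • v))]; simp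
  rw [lineD2, h1, deriv_const_mul_field, deriv_comp_mul_left c (deriv fun θ : ℝ => w (y + θ • v))]
  simp [lineD2]; ring

theorem lineD1_neg (w : E → ℝ) (y v : E) : lineD1 w y (-v) = -lineD1 w y v := by
  simpa using lineD1_smul w y v (-1)

theorem lineD2_neg (w : E → ℝ) (y v : E) : lineD2 w y (-v) = lineD2 w y v := by
  simpa using lineD2_smul w y v (-1)

theorem HasLipschitzDerivOn.mono {p : ℕ} {L : ℝ} {w : E → ℝ} {S T : Set E}
    (h : HasLipschitzDerivOn p L w S) (hT : T ⊆ S) : HasLipschitzDerivOn p L w T :=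
  fun x hx v hv θ hθ => h x (hT hx) v hv θ (hT hθ)

/-- The norm of `u` is only bounded by `1`, so that `v = 0` is covered, also in the trivial space.
-/
theorem exists_unit_direction (v : E) : ∃ u : E, ‖u‖ ≤ 1 ∧ v = ‖v‖ • u := by
  by_cases hv : v = 0
  · exact ⟨0, by simp, by simp [hv]⟩
  · refine ⟨‖v‖⁻¹ • v, ?_, ?_⟩
    · rw [norm_smul, norm_inv, norm_norm, inv_mul_cancel₀ (norm_ne_zero_iff.2 hv)]
    · rw [smul_smul, mul_inv_cancel₀ (norm_ne_zero_iff.2 hv), one_smul]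

theorem segment_of_unit_direction {S : Set E} {y v u : E} (hu : v = ‖v‖ • u)
    (hs : ∀ θ ∈ Icc (0 : ℝ) 1, y + θ • v ∈ S) (hy : y ∈ S) :
    ∀ θ ∈ Icc 0 ‖v‖, y + θ • u ∈ S := by
  intro θ hθ
  rcases eq_or_ne ‖v‖ 0 with h | h
  · have : θ = 0 := le_antisymm (h ▸ hθ.2) hθ.1
    simpa [this] using hy
  · have hp : 0 < ‖v‖ := lt_of_le_of_ne (norm_nonneg v) h.symm
    have := hs (θ / ‖v‖) ⟨by have := hθ.1; positivity, (div_le_one hp).2 hθ.2⟩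
    rw [hu, norm_smul, norm_norm, smul_smul] at this
    have hu1 : ‖v‖ = ‖v‖ * ‖u‖ := by
      conv_lhs => rw [hu, norm_smul, norm_norm]
    rw [← hu1, div_mul_cancel₀ _ h] at this
    exact this

/-- The regularity hypothesis admits only directions in the unit ball, so the one-variable estimate
is applied on `[0, ‖v‖]` along the normalized direction and rescaled by homogeneity of `lineD1`. -/
theorem HasLipschitzDerivOn.taylor_one {L : ℝ} {w : E → ℝ} {S : Set E}
    (h : HasLipschitzDerivOn 1 L w S) {y v : E} (hs : ∀ θ ∈ Icc (0 : ℝ) 1, y + θ • v ∈ S) :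
    |w (y + v) - w y - lineD1 w y v| ≤ L / 2 * ‖v‖ ^ 2 := by
  obtain ⟨u, hu1, hu⟩ := exists_unit_direction v
  have hy : y ∈ S := by simpa using hs 0 (by simp)
  have key := h y hy u hu1
  have hT := segment_of_unit_direction hu hs hy
  have := taylor_one_of_abs_deriv_two_le (g := fun θ : ℝ => w (y + θ • u)) (T := ‖v‖) (L := L)
    (norm_nonneg v)
    (fun t ht => by simpa using (key t (hT t ht)).1 0 (by norm_num))
    (fun t ht => by simpa [iteratedDeriv_one] using (key t (hT t ht)).1 1 (by norm_num))
    (fun t ht => by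
      simpa [iteratedDeriv_succ, iteratedDeriv_zero] using (key t (hT t ht)).2)
  have e1 : lineD1 w y v = ‖v‖ * lineD1 w y u := by
    conv_lhs => rw [hu]
    exact lineD1_smul ..
  simp only [← hu, zero_smul, add_zero] at this
  rw [e1, lineD1]
  linarith

theorem HasLipschitzDerivOn.taylor_two {L : ℝ} {w : E → ℝ} {S : Set E}
    (h : HasLipschitzDerivOn 2 L w S) {y v : E} (hs : ∀ θ ∈ Icc (0 : ℝ) 1, y + θ • v ∈ S) :
    |w (y + v) - w y - lineD1 w y v - 1 / 2 * lineD2 w y v| ≤ L / 6 * ‖v‖ ^ 3 := by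
  obtain ⟨u, hu1, hu⟩ := exists_unit_direction v
  have hy : y ∈ S := by simpa using hs 0 (by simp)
  have key := h y hy u hu1
  have hT := segment_of_unit_direction hu hs hy
  have := taylor_two_of_abs_deriv_three_le (g := fun θ : ℝ => w (y + θ • u)) (T := ‖v‖) (L := L)
    (norm_nonneg v)
    (fun t ht => by simpa using (key t (hT t ht)).1 0 (by norm_num))
    (fun t ht => by simpa [iteratedDeriv_one] using (key t (hT t ht)).1 1 (by norm_num))
    (fun t ht => by
      simpa [iteratedDeriv_succ, iteratedDeriv_zero] using (key t (hT t ht)).1 2 (by norm_num))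
    (fun t ht => by
      simpa [iteratedDeriv_succ, iteratedDeriv_zero] using (key t (hT t ht)).2)
  have e1 : lineD1 w y v = ‖v‖ * lineD1 w y u := by
    conv_lhs => rw [hu]
    exact lineD1_smul ..
  have e2 : lineD2 w y v = ‖v‖ ^ 2 * lineD2 w y u := by
    conv_lhs => rw [hu]
    exact lineD2_smul ..
  simp only [← hu, zero_smul, add_zero] at this
  rw [e1, e2, lineD1, lineD2]
  have e3 : 1 / 2 * (‖v‖ ^ 2 * deriv (deriv fun θ : ℝ => w (y + θ • u)) 0) =
    ‖v‖ ^ 2 / 2 * (deriv (deriv fun θ : ℝ => w (y + θ • u)) 0) := by ring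
  rw [e3]
  linarith

theorem HasLipschitzDerivOn.abs_lineD2_le {L : ℝ} {w : E → ℝ} {S : Set E}
    (h : HasLipschitzDerivOn 1 L w S) {y : E} (hy : y ∈ S) (v : E) :
    |lineD2 w y v| ≤ L * ‖v‖ ^ 2 := by
  obtain ⟨u, hu1, hu⟩ := exists_unit_direction v
  have key := (h y hy u hu1 0 (by simpa using hy)).2
  have e2 : lineD2 w y v = ‖v‖ ^ 2 * lineD2 w y u := by
    conv_lhs => rw [hu]
    exact lineD2_smul ..
  have : |lineD2 w y u| ≤ L := by simpa [iteratedDeriv_succ, iteratedDeriv_zero, lineD2] using key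
  rw [e2, abs_mul, abs_of_nonneg (by positivity), mul_comm]
  gcongr

/-- A number that is `O(t)` as `t → 0⁺` vanishes. -/
theorem eq_zero_of_abs_mul_le_sq {b C δ : ℝ} (hδ : 0 < δ)
    (h : ∀ t, 0 < t → t < δ → |t * b| ≤ C * t ^ 2) : b = 0 := by
  have h1 : ∀ᶠ t in 𝓝[>] (0 : ℝ), |b| ≤ C * t := by
    filter_upwards [Ioo_mem_nhdsGT hδ] with t ht
    have := h t ht.1 ht.2
    rw [abs_mul, abs_of_pos ht.1, sq, ← mul_assoc, mul_comm t, mul_le_mul_iff_left₀ ht.1] at this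
    exact this
  have h2 : Tendsto (fun t : ℝ => C * t) (𝓝[>] 0) (𝓝 0) := by
    have : Tendsto (fun t : ℝ => C * t) (𝓝 0) (𝓝 (C * 0)) :=
      (continuous_const.mul continuous_id).tendsto 0
    simpa using this.mono_left nhdsWithin_le_nhds
  exact abs_nonpos_iff.1 (ge_of_tendsto h2 h1)

theorem hasFDerivAt_of_norm_sub_le_sq {F : Type*} [NormedAddCommGroup F] [NormedSpace ℝ F]
    {f : E → F} {f' : E →L[ℝ] F} {x : E} {C δ : ℝ} (hδ : 0 < δ)
    (h : ∀ v, ‖v‖ < δ → ‖f (x + v) - f x - f' v‖ ≤ C * ‖v‖ ^ 2) : HasFDerivAt f f' x := by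
  rw [hasFDerivAt_iff_isLittleO_nhds_zero]
  refine Asymptotics.IsBigO.trans_isLittleO (g := fun v : E => ‖v‖ ^ 2) ?_
    (Asymptotics.isLittleO_norm_pow_id one_lt_two)
  refine Asymptotics.IsBigO.of_bound C ?_
  filter_upwards [Metric.ball_mem_nhds (0 : E) hδ] with v hv
  simpa using h v (by simpa using hv)

end Lines

/-! ### From regularity along lines to Fréchet derivatives -/

section Frechet

variable {E : Type*} [NormedAddCommGroup E] [InnerProductSpace ℝ E]

/-- The points `x + 2tu` and `x + 2tv` are reached from `x` directly, and from their midpoint `x +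
t(u + v)` along opposite directions. In the sum of the last two expansions the first order terms
cancel. Comparison leaves `t` times the defect of additivity bounded by a multiple of `t²`. -/
theorem lineD1_add {w : E → ℝ} {x : E} {R L : ℝ} (hR : 0 < R)
    (h : HasLipschitzDerivOn 1 L w (Metric.ball x R)) (u v : E) :
    lineD1 w x (u + v) = lineD1 w x u + lineD1 w x v := by
  have hT : ∀ y ∈ Metric.ball x R, ∀ v, y + v ∈ Metric.ball x R →
      |w (y + v) - w y - lineD1 w y v| ≤ L / 2 * ‖v‖ ^ 2 := fun y hy v hv =>
    h.taylor_one fun θ hθ => (convex_ball x R).add_smul_mem hy hv hθ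
  have hx : x ∈ Metric.ball x R := Metric.mem_ball_self hR
  set K := ‖u‖ + ‖v‖ + 1 with hK
  have hKp : 0 < K := by positivity
  have hu : ‖u‖ ≤ K := by have := norm_nonneg v; linarith
  have hv : ‖v‖ ≤ K := by have := norm_nonneg u; linarith
  suffices lineD1 w x (u + v) - lineD1 w x u - lineD1 w x v = 0 by linarith
  refine eq_zero_of_abs_mul_le_sq (δ := R / (2 * K))
    (C := L / 2 * (‖u - v‖ ^ 2 + ‖u + v‖ ^ 2 + 2 * ‖u‖ ^ 2 + 2 * ‖v‖ ^ 2)) (by positivity) ?_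
  intro t ht htδ
  have htK : t * (2 * K) < R := by rwa [lt_div_iff₀ (by positivity)] at htδ
  have mem : ∀ p : E, ‖p‖ ≤ 2 * K → x + t • p ∈ Metric.ball x R := by
    intro p hp
    rw [mem_ball_iff_norm, add_sub_cancel_left, norm_smul, Real.norm_of_nonneg ht.le]
    exact (mul_le_mul_of_nonneg_left hp ht.le).trans_lt htK
  have n2 : ∀ p : E, ‖p‖ ≤ K → ‖(2 : ℝ) • p‖ ≤ 2 * K := fun p hp => by
    rw [norm_smul, Real.norm_ofNat]; gcongr
  have m1 := mem _ (n2 u hu)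
  have m2 := mem _ (n2 v hv)
  have m3 := mem (u + v) ((norm_add_le u v).trans (by linarith))
  have a1 := hT x hx _ m1
  have a2 := hT x hx _ m2
  have a3 := hT x hx _ m3
  have e1 : x + t • (u + v) + t • (u - v) = x + t • (2 : ℝ) • u := by module
  have e2 : x + t • (u + v) + -(t • (u - v)) = x + t • (2 : ℝ) • v := by module
  have a4 := hT _ m3 (t • (u - v)) (by rw [e1]; exact m1)
  have a5 := hT _ m3 (-(t • (u - v))) (by rw [e2]; exact m2)
  rw [e1] at a4
  rw [e2, lineD1_neg, norm_neg] at a5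
  simp only [lineD1_smul, norm_smul, mul_pow, Real.norm_ofNat, Real.norm_of_nonneg ht.le]
    at a1 a2 a3 a4 a5
  rw [abs_le] at *
  constructor <;> linarith

theorem hasFDerivAt_of_hasLipschitzDerivOn_one [FiniteDimensional ℝ E] {w : E → ℝ} {U : Set E}
    {L : ℝ} (hU : IsOpen U) (h : HasLipschitzDerivOn 1 L w U) {x : E} (hx : x ∈ U) :
    DifferentiableAt ℝ w x ∧ ∀ v, fderiv ℝ w x v = lineD1 w x v := by
  obtain ⟨R, hR, hRU⟩ := Metric.isOpen_iff.1 hU x hx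
  have hB := h.mono hRU
  let ℓ : E →ₗ[ℝ] ℝ :=
    { toFun := lineD1 w x
      map_add' := lineD1_add hR hB
      map_smul' := fun c v => by simpa using lineD1_smul w x v c }
  have : HasFDerivAt w (LinearMap.toContinuousLinearMap ℓ) x := by
    refine hasFDerivAt_of_norm_sub_le_sq (C := L / 2) hR fun v hv => ?_
    exact hB.taylor_one fun θ hθ => (convex_ball x R).add_smul_mem (Metric.mem_ball_self hR)
      (by simpa using hv) hθ
  exact ⟨this.differentiableAt, fun v => by rw [this.fderiv]; rfl⟩

/-- Comparison of the second order expansions of `w` at `x` and at `x + h`. -/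
theorem abs_lineD1_sub_le {w : E → ℝ} {x : E} {R L : ℝ}
    (hw : HasLipschitzDerivOn 2 L w (Metric.ball x R)) (hL : 0 ≤ L) {h v : E} {s : ℝ}
    (hs : 2 * s < R) (hh : ‖h‖ ≤ s) (hv : ‖v‖ ≤ s) :
    |lineD1 w (x + h) v - lineD1 w x v - (lineD2 w x (h + v) - lineD2 w x (h - v)) / 4
      - (lineD1 w x (h + v) - lineD1 w x (h - v) - 2 * lineD1 w x v) / 2| ≤
        3 / 2 * L * s ^ 3 ∧
    |lineD2 w (x + h) v - (lineD2 w x (h + v) + lineD2 w x (h - v) - 2 * lineD2 w x h) / 2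
      - (lineD1 w x (h + v) + lineD1 w x (h - v) - 2 * lineD1 w x h)| ≤
        4 * L * s ^ 3 := by
  have hR : 0 < R := by have := norm_nonneg h; linarith
  have hT : ∀ y ∈ Metric.ball x R, ∀ v, y + v ∈ Metric.ball x R →
      |w (y + v) - w y - lineD1 w y v - 1 / 2 * lineD2 w y v| ≤ L / 6 * ‖v‖ ^ 3 :=
    fun y hy v hv => hw.taylor_two fun θ hθ => (convex_ball x R).add_smul_mem hy hv hθ
  have hx : x ∈ Metric.ball x R := Metric.mem_ball_self hR
  have mem : ∀ p : E, ‖p‖ ≤ 2 * s → x + p ∈ Metric.ball x R := by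
    intro p hp
    rw [mem_ball_iff_norm, add_sub_cancel_left]
    linarith
  have np : ‖h + v‖ ≤ 2 * s := (norm_add_le h v).trans (by linarith)
  have nm : ‖h - v‖ ≤ 2 * s := (norm_sub_le h v).trans (by linarith)
  have mh := mem h (by have := norm_nonneg h; linarith)
  have a1 := hT x hx _ (mem _ np)
  have a2 := hT x hx _ (mem _ nm)
  have a3 := hT x hx _ mh
  have e1 : x + h + v = x + (h + v) := by module
  have e2 : x + h + -v = x + (h - v) := by module
  have a4 := hT _ mh v (by rw [e1]; exact mem _ np)
  have a5 := hT _ mh (-v) (by rw [e2]; exact mem _ nm)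
  rw [e1] at a4
  rw [e2, lineD1_neg, lineD2_neg, norm_neg] at a5
  have c1 : L / 6 * ‖h + v‖ ^ 3 ≤ 8 * (L / 6 * s ^ 3) := by
    have := mul_le_mul_of_nonneg_left (pow_le_pow_left₀ (norm_nonneg _) np 3)
      (by positivity : 0 ≤ L / 6)
    rw [mul_pow] at this
    linarith
  have c2 : L / 6 * ‖h - v‖ ^ 3 ≤ 8 * (L / 6 * s ^ 3) := by
    have := mul_le_mul_of_nonneg_left (pow_le_pow_left₀ (norm_nonneg _) nm 3)
      (by positivity : 0 ≤ L / 6)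
    rw [mul_pow] at this
    linarith
  have c3 : L / 6 * ‖h‖ ^ 3 ≤ L / 6 * s ^ 3 := by gcongr
  have c4 : L / 6 * ‖v‖ ^ 3 ≤ L / 6 * s ^ 3 := by gcongr
  have hpos : 0 ≤ L * s ^ 3 := by have := (norm_nonneg h).trans hh; positivity
  rw [abs_le] at a1 a2 a3 a4 a5
  -- The difference of the two expansions at `x + h` isolates the first derivative there, their sum
  -- the second. The errors add up to `(8 + 8 + 1 + 1) / 12 = 3/2` and to `20/6 ≤ 4`.
  constructor <;> rw [abs_le] <;> constructor <;> linarith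

/-- Linearity of the Fréchet derivative at `x` removes the first order terms from
`abs_lineD1_sub_le`, leaving pure second order comparisons with a cubic error. -/
theorem exists_ball_abs_second_order_sub_le [FiniteDimensional ℝ E] {w : E → ℝ} {U : Set E}
    {L L' : ℝ} (hU : IsOpen U) (hw1 : HasLipschitzDerivOn 1 L w U)
    (hw2 : HasLipschitzDerivOn 2 L' w U) (hL' : 0 ≤ L') {x : E} (hx : x ∈ U) :
    ∃ R > 0, Metric.ball x R ⊆ U ∧ ∀ h v : E, ∀ s, 2 * s < R → ‖h‖ ≤ s → ‖v‖ ≤ s →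
      |fderiv ℝ w (x + h) v - fderiv ℝ w x v - (lineD2 w x (h + v) - lineD2 w x (h - v)) / 4| ≤
        3 / 2 * L' * s ^ 3 ∧
      |lineD2 w (x + h) v - (lineD2 w x (h + v) + lineD2 w x (h - v) - 2 * lineD2 w x h) / 2| ≤
        4 * L' * s ^ 3 := by
  obtain ⟨R, hR, hRU⟩ := Metric.isOpen_iff.1 hU x hx
  refine ⟨R, hR, hRU, fun h v s hs hh hv => ?_⟩
  have hD := fun y hy => (hasFDerivAt_of_hasLipschitzDerivOn_one hU hw1 (x := y) hy).2
  have hxh : x + h ∈ U := hRU (by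
    rw [mem_ball_iff_norm, add_sub_cancel_left]
    have := norm_nonneg h
    linarith)
  have key := abs_lineD1_sub_le (hw2.mono hRU) hL' hs hh hv
  simp only [← hD x hx, ← hD (x + h) hxh, map_add, map_sub] at key
  constructor
  · convert key.1 using 2; ring
  · convert key.2 using 2; ring

/-- The candidate for the Hessian is the polarization `q` of `lineD2`. It is symmetric because
`lineD2` is even, and linear in its second argument because it is the derivative of `t ↦ fderiv ℝ w
(x + t • h) v`, which is linear in `v` for every `t`. The error bound is then uniform over unit
vectors `v`. -/
theorem hasFDerivAt_fderiv_of_hasLipschitzDerivOn [FiniteDimensional ℝ E] {w : E → ℝ} {U : Set E}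
    {L L' : ℝ} (hU : IsOpen U) (hw1 : HasLipschitzDerivOn 1 L w U)
    (hw2 : HasLipschitzDerivOn 2 L' w U) (hL' : 0 ≤ L') {x : E} (hx : x ∈ U) :
    DifferentiableAt ℝ (fderiv ℝ w) x ∧ ∀ v, hessForm w x v = lineD2 w x v := by
  obtain ⟨R, hR, hRU, key⟩ := exists_ball_abs_second_order_sub_le hU hw1 hw2 hL' hx
  set q : E → E → ℝ := fun h v => (lineD2 w x (h + v) - lineD2 w x (h - v)) / 4 with hq
  have hder : ∀ h v : E, HasDerivAt (fun t : ℝ => fderiv ℝ w (x + t • h) v) (q h v) 0 := by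
    intro h v
    set K := ‖h‖ + ‖v‖ + 1 with hK
    have hKp : 0 < K := by positivity
    have : HasFDerivAt (fun t : ℝ => fderiv ℝ w (x + t • h) v)
        (ContinuousLinearMap.toSpanSingleton ℝ (q h v)) 0 := by
      refine hasFDerivAt_of_norm_sub_le_sq (δ := R / (2 * K)) (C := 3 / 2 * L' * K ^ 3)
        (by positivity) fun t ht => ?_
      rw [lt_div_iff₀ (by positivity)] at ht
      rcases eq_or_ne t 0 with rfl | ht0
      · simp
      have htp : 0 < ‖t‖ := norm_pos_iff.2 ht0
      have k1 := (key (t • h) (t • v) (‖t‖ * K) (by linarith)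
        (by rw [norm_smul]; gcongr; have := norm_nonneg v; linarith)
        (by rw [norm_smul]; gcongr; have := norm_nonneg h; linarith)).1
      rw [← smul_add, ← smul_sub, lineD2_smul, lineD2_smul, map_smul, map_smul] at k1
      have e : t • fderiv ℝ w (x + t • h) v - t • fderiv ℝ w x v -
          (t ^ 2 * lineD2 w x (h + v) - t ^ 2 * lineD2 w x (h - v)) / 4 =
          t * (fderiv ℝ w (x + t • h) v - fderiv ℝ w x v - t * q h v) := by
        simp only [hq, smul_eq_mul]; ring
      rw [e, abs_mul, ← Real.norm_eq_abs t] at k1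
      have : ‖t‖ * |fderiv ℝ w (x + t • h) v - fderiv ℝ w x v - t * q h v| ≤
          ‖t‖ * (3 / 2 * L' * K ^ 3 * ‖t‖ ^ 2) := k1.trans (le_of_eq (by ring))
      simpa using le_of_mul_le_mul_left this htp
    simpa using this.hasDerivAt
  have hsymm : ∀ h v, q h v = q v h := by
    intro h v
    simp only [hq]
    rw [← neg_sub v h, lineD2_neg, add_comm v h]
  have hadd : ∀ h v v', q h (v + v') = q h v + q h v' := fun h v v' => by
    have := (hder h (v + v'))
    simp only [map_add] at this
    exact this.unique ((hder h v).add (hder h v'))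
  have hsmul : ∀ (c : ℝ) h v, q h (c • v) = c * q h v := fun c h v => by
    have := (hder h (c • v))
    simp only [map_smul, smul_eq_mul] at this
    exact this.unique ((hder h v).const_mul c)
  let B : E →ₗ[ℝ] E →ₗ[ℝ] ℝ := LinearMap.mk₂ ℝ q
    (fun h h' v => by rw [hsymm, hadd, hsymm v, hsymm v])
    (fun c h v => by rw [hsymm, hsmul, hsymm v]; rfl) hadd hsmul
  have hB : HasFDerivAt (fderiv ℝ w) B.toContinuousBilinearMap x := by
    refine hasFDerivAt_of_norm_sub_le_sq (δ := R / 2) (C := 3 / 2 * L') (by positivity)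
      fun h hh => ?_
    rcases eq_or_ne h 0 with rfl | h0
    · simp
    have hp : 0 < ‖h‖ := norm_pos_iff.2 h0
    refine ContinuousLinearMap.opNorm_le_of_unit_norm (by positivity) fun v hv => ?_
    have k1 := (key h (‖h‖ • v) ‖h‖ (by linarith) le_rfl (by simp [norm_smul, hv])).1
    change |_ - _ - q h (‖h‖ • v)| ≤ _ at k1
    rw [map_smul, map_smul, hsmul, smul_eq_mul, smul_eq_mul, ← mul_sub, ← mul_sub, abs_mul,
      abs_norm] at k1
    have : ‖h‖ * |fderiv ℝ w (x + h) v - fderiv ℝ w x v - q h v| ≤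
        ‖h‖ * (3 / 2 * L' * ‖h‖ ^ 2) := k1.trans (le_of_eq (by ring))
    exact le_of_mul_le_mul_left this hp
  refine ⟨hB.differentiableAt, fun v => ?_⟩
  rw [hessForm, hB.fderiv]
  change q v v = _
  simp only [hq]
  rw [← two_smul ℝ v, sub_self, lineD2_smul, ← zero_smul ℝ v, lineD2_smul]
  ring

/-- Second order regularity on an open set: the Hessian is bounded by `L` and is `M`-Lipschitz along
segments, both as a quadratic form. -/
structure IsRegularOn (w : E → ℝ) (U : Set E) (L M : ℝ) : Prop where
  isOpen : IsOpen U
  differentiableAt : ∀ x ∈ U, DifferentiableAt ℝ w x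
  differentiableAt_fderiv : ∀ x ∈ U, DifferentiableAt ℝ (fderiv ℝ w) x
  abs_hess_le : ∀ x ∈ U, ∀ u, |fderiv ℝ (fderiv ℝ w) x u u| ≤ L * ‖u‖ ^ 2
  abs_hess_sub_le : ∀ x d, (∀ θ ∈ Icc (0 : ℝ) 1, x + θ • d ∈ U) → ∀ u,
    |fderiv ℝ (fderiv ℝ w) (x + d) u u - fderiv ℝ (fderiv ℝ w) x u u| ≤ M * ‖d‖ * ‖u‖ ^ 2

/-- A function of a real variable that is locally `C`-Lipschitz at every point of `[0, 1]` changes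
by at most `C` over the interval. -/
theorem abs_sub_le_of_locally_lipschitz {k : ℝ → ℝ} {C : ℝ}
    (h : ∀ θ ∈ Icc (0 : ℝ) 1, ∃ δ > 0, ∀ θ', |θ' - θ| < δ → |k θ' - k θ| ≤ C * |θ' - θ|) :
    |k 1 - k 0| ≤ C := by
  have hcont : ContinuousOn k (Icc 0 1) := by
    intro θ hθ
    obtain ⟨δ, hδ, H⟩ := h θ hθ
    refine ContinuousAt.continuousWithinAt ?_
    rw [ContinuousAt, tendsto_iff_norm_sub_tendsto_zero]
    have h2 : Tendsto (fun t : ℝ => C * |t - θ|) (𝓝 θ) (𝓝 0) := by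
      have : Continuous fun t : ℝ => C * |t - θ| := by fun_prop
      simpa using this.tendsto θ
    refine squeeze_zero' (Eventually.of_forall fun _ => norm_nonneg _) ?_ h2
    filter_upwards [Metric.ball_mem_nhds θ hδ] with t ht
    exact H t (by simpa [Real.dist_eq] using ht)
  have main : ∀ g : ℝ → ℝ, ContinuousOn g (Icc 0 1) → (∀ θ ∈ Icc (0 : ℝ) 1, ∃ δ > 0, ∀ θ',
      |θ' - θ| < δ → |g θ' - g θ| ≤ C * |θ' - θ|) → g 1 - g 0 ≤ C := by
    intro g hg hl
    -- No derivative of `g` is available; the local Lipschitz bound controls the right slopes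
    -- instead.
    have := image_le_of_liminf_slope_right_le_deriv_boundary (f := g) (a := 0) (b := 1) hg
      (B := fun t => g 0 + C * t) (B' := fun _ => C) (by simp) (by fun_prop)
      (fun t _ => by
        simpa using (((hasDerivAt_id' t).const_mul C).const_add (g 0)).hasDerivWithinAt)
      (fun t ht r hr => by
        obtain ⟨δ, hδ, H⟩ := hl t (Ico_subset_Icc_self ht)
        refine Eventually.frequently ?_
        filter_upwards [Ioo_mem_nhdsGT (lt_add_of_pos_right t hδ)] with z hz
        have hzt : 0 < z - t := by linarith [hz.1]
        have := H z (by rw [abs_of_pos hzt]; linarith [hz.2])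
        rw [abs_of_pos hzt] at this
        rw [slope_def_field, div_lt_iff₀ hzt]
        have := (le_abs_self _).trans this
        nlinarith)
    have := this (right_mem_Icc.2 zero_le_one)
    simp only [mul_one] at this
    linarith
  rw [abs_le]
  have h1 := main k hcont h
  have h2 := main (fun t => -k t) hcont.neg (fun θ hθ => by
    obtain ⟨δ, hδ, H⟩ := h θ hθ
    refine ⟨δ, hδ, fun θ' hθ' => ?_⟩
    rw [← abs_neg]
    simpa [add_comm, sub_eq_add_neg] using H θ' hθ')
  constructor <;> linarith

/-- The even part of the second order comparison shows that the Hessian form is locally Lipschitz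
with constant `4 L'`; `abs_sub_le_of_locally_lipschitz` extends this to whole segments. -/
theorem isRegularOn_of_hasLipschitzDerivOn [FiniteDimensional ℝ E] {w : E → ℝ} {U : Set E}
    {L L' : ℝ} (hU : IsOpen U) (hw1 : HasLipschitzDerivOn 1 L w U)
    (hw2 : HasLipschitzDerivOn 2 L' w U) (hL' : 0 ≤ L') : IsRegularOn w U L (4 * L') := by
  have hH := fun x hx => (hasFDerivAt_fderiv_of_hasLipschitzDerivOn hU hw1 hw2 hL' (x := x) hx)
  refine ⟨hU, fun x hx => (hasFDerivAt_of_hasLipschitzDerivOn_one hU hw1 hx).1,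
    fun x hx => (hH x hx).1, fun x hx u => ?_, fun x d hd u => ?_⟩
  · exact ((congrArg abs ((hH x hx).2 u)).trans_le (hw1.abs_lineD2_le hx u))
  have hloc : ∀ y ∈ U, ∃ δ > 0, ∀ h, ‖h‖ < δ → ∀ u,
      |hessForm w (y + h) u - hessForm w y u| ≤ 4 * L' * ‖h‖ * ‖u‖ ^ 2 := by
    intro y hy
    obtain ⟨R, hR, hRU, key⟩ := exists_ball_abs_second_order_sub_le hU hw1 hw2 hL' hy
    refine ⟨R / 2, by positivity, fun h hh u => ?_⟩
    rcases eq_or_ne h 0 with rfl | h0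
    · simp
    rcases eq_or_ne u 0 with rfl | u0
    · simp [hessForm]
    have hp : 0 < ‖h‖ := norm_pos_iff.2 h0
    have up : 0 < ‖u‖ := norm_pos_iff.2 u0
    have hyh : y + h ∈ U := hRU (by rw [mem_ball_iff_norm, add_sub_cancel_left]; linarith)
    -- The scaling gives `c • u` the norm of `h`, so that the cubic error `‖h‖³` equals `c² ‖h‖
    -- ‖u‖²`.
    set c := ‖h‖ / ‖u‖ with hc
    have hcp : 0 < c := by positivity
    have k2 := (key h (c • u) ‖h‖ (by linarith) le_rfl (by
      rw [norm_smul, Real.norm_of_nonneg hcp.le, hc, div_mul_cancel₀ _ up.ne'])).2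
    simp only [← (hH y hy).2, ← (hH _ hyh).2] at k2
    have e : (hessForm w y (h + c • u) + hessForm w y (h - c • u) - 2 * hessForm w y h) / 2 =
        c ^ 2 * hessForm w y u := by
      simp only [hessForm, map_add, map_sub, map_smul, _root_.add_apply,
        _root_.sub_apply, _root_.smul_apply, smul_eq_mul]
      ring
    have e' : hessForm w (y + h) (c • u) = c ^ 2 * hessForm w (y + h) u := by
      simp only [hessForm, map_smul, _root_.smul_apply, smul_eq_mul]
      ring
    rw [e, e', ← mul_sub, abs_mul, abs_of_nonneg (sq_nonneg c)] at k2
    have : c ^ 2 * |hessForm w (y + h) u - hessForm w y u| ≤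
        c ^ 2 * (4 * L' * ‖h‖ * ‖u‖ ^ 2) := by
      refine k2.trans (le_of_eq ?_)
      rw [hc]
      field_simp
    exact le_of_mul_le_mul_left this (by positivity)
  have := abs_sub_le_of_locally_lipschitz (k := fun θ => hessForm w (x + θ • d) u)
    (C := 4 * L' * ‖d‖ * ‖u‖ ^ 2) (fun θ hθ => by
      obtain ⟨δ, hδ, H⟩ := hloc _ (hd θ hθ)
      refine ⟨δ / (‖d‖ + 1), by positivity, fun θ' hθ' => ?_⟩
      rw [lt_div_iff₀ (by positivity)] at hθ'
      have k := H ((θ' - θ) • d) (by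
        rw [norm_smul, Real.norm_eq_abs]
        exact (mul_le_mul_of_nonneg_left (by linarith) (abs_nonneg _)).trans_lt hθ') u
      have e : x + θ • d + (θ' - θ) • d = x + θ' • d := by module
      rw [e, norm_smul, Real.norm_eq_abs] at k
      exact k.trans (le_of_eq (by ring)))
  simpa [hessForm] using this

end Frechet

/-! ### Consequences and stability of second order regularity -/

section Regular

variable {E : Type*} [NormedAddCommGroup E] [InnerProductSpace ℝ E]

/-- Polarization after scaling both vectors to the common norm `‖u‖ ‖v‖`; the parallelogram law then
gives the bound without loss of a constant. -/
theorem abs_bilin_le_of_abs_quad_le {B : E →L[ℝ] E →L[ℝ] ℝ} {K : ℝ}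
    (hsymm : ∀ u v, B u v = B v u) (hB : ∀ u, |B u u| ≤ K * ‖u‖ ^ 2) (u v : E) :
    |B u v| ≤ K * ‖u‖ * ‖v‖ := by
  rcases eq_or_ne u 0 with rfl | hu
  · simp
  rcases eq_or_ne v 0 with rfl | hv
  · simp
  have hup : 0 < ‖u‖ := norm_pos_iff.2 hu
  have hvp : 0 < ‖v‖ := norm_pos_iff.2 hv
  have h1 := hB (‖v‖ • u + ‖u‖ • v)
  have h2 := hB (‖v‖ • u - ‖u‖ • v)
  have hpar := parallelogram_law_with_norm ℝ (‖v‖ • u) (‖u‖ • v)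
  simp only [norm_smul, norm_norm] at hpar
  have hK : K * (‖‖v‖ • u + ‖u‖ • v‖ ^ 2 + ‖‖v‖ • u - ‖u‖ • v‖ ^ 2) =
      K * (4 * (‖u‖ * ‖v‖) ^ 2) := by
    congr 1
    nlinarith [hpar]
  simp only [map_add, map_sub, map_smul, _root_.add_apply, _root_.sub_apply, _root_.smul_apply,
    smul_eq_mul, hsymm v u] at h1 h2
  have hm : 0 < ‖u‖ * ‖v‖ := by positivity
  rw [abs_le] at h1 h2
  have : ‖u‖ * ‖v‖ * |B u v| ≤ ‖u‖ * ‖v‖ * (K * ‖u‖ * ‖v‖) := by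
    rw [← abs_of_pos hm, ← abs_mul, abs_of_pos hm, abs_le]
    constructor <;> linarith
  exact le_of_mul_le_mul_left this hm

namespace IsRegularOn

variable {w : E → ℝ} {U : Set E} {L M : ℝ} (hw : IsRegularOn w U L M)
include hw

theorem hess_symm {x : E} (hx : x ∈ U) (u v : E) :
    fderiv ℝ (fderiv ℝ w) x u v = fderiv ℝ (fderiv ℝ w) x v u :=
  second_derivative_symmetric_of_eventually
    (by filter_upwards [hw.isOpen.mem_nhds hx] with y hy
        exact (hw.differentiableAt y hy).hasFDerivAt)
    (hw.differentiableAt_fderiv x hx).hasFDerivAt u v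

theorem abs_hess_bilin_le {x : E} (hx : x ∈ U) (u v : E) :
    |fderiv ℝ (fderiv ℝ w) x u v| ≤ L * ‖u‖ * ‖v‖ :=
  abs_bilin_le_of_abs_quad_le (hw.hess_symm hx) (hw.abs_hess_le x hx) u v

variable {x d : E} (hd : ∀ θ ∈ Icc (0 : ℝ) 1, x + θ • d ∈ U)
include hd

theorem abs_hess_sub_bilin_le (u v : E) {t : ℝ} (ht : t ∈ Icc (0 : ℝ) 1) :
    |fderiv ℝ (fderiv ℝ w) (x + t • d) u v - fderiv ℝ (fderiv ℝ w) x u v| ≤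
      M * ‖d‖ * ‖u‖ * ‖v‖ * t := by
  have hx : x ∈ U := by simpa using hd 0 (by simp)
  have := abs_bilin_le_of_abs_quad_le
    (B := fderiv ℝ (fderiv ℝ w) (x + t • d) - fderiv ℝ (fderiv ℝ w) x) (K := M * ‖t • d‖)
    (fun u v => by
      simp only [_root_.sub_apply, hw.hess_symm hx u v, hw.hess_symm (hd t ht) u v])
    (fun u => hw.abs_hess_sub_le x (t • d) (fun θ hθ => by
      rw [smul_smul]
      exact hd _ ⟨mul_nonneg hθ.1 ht.1, mul_le_one₀ hθ.2 ht.1 ht.2⟩) u) u v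
  rw [norm_smul, Real.norm_of_nonneg ht.1] at this
  exact this.trans (le_of_eq (by ring))

theorem hasDerivAt_line {t : ℝ} (ht : t ∈ Icc (0 : ℝ) 1) :
    HasDerivAt (fun t : ℝ => w (x + t • d)) (fderiv ℝ w (x + t • d) d) t := by
  have h1 : HasDerivAt (fun t : ℝ => x + t • d) d t := by
    simpa using ((hasDerivAt_id' t).smul_const d).const_add x
  exact (hw.differentiableAt _ (hd t ht)).hasFDerivAt.comp_hasDerivAt t h1

theorem hasDerivAt_fderiv_line (u : E) {t : ℝ} (ht : t ∈ Icc (0 : ℝ) 1) :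
    HasDerivAt (fun t : ℝ => fderiv ℝ w (x + t • d) u)
      (fderiv ℝ (fderiv ℝ w) (x + t • d) d u) t := by
  have h1 : HasDerivAt (fun t : ℝ => x + t • d) d t := by
    simpa using ((hasDerivAt_id' t).smul_const d).const_add x
  have h2 := (hw.differentiableAt_fderiv _ (hd t ht)).hasFDerivAt.comp_hasDerivAt t h1
  simpa using h2.clm_apply (hasDerivAt_const t u)

theorem abs_fderiv_sub_le (u : E) :
    |fderiv ℝ w (x + d) u - fderiv ℝ w x u| ≤ L * ‖d‖ * ‖u‖ := by
  have := abs_le_pow_of_abs_deriv_le (g := fun t : ℝ => fderiv ℝ w (x + t • d) u - fderiv ℝ w x u)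
    (T := 1) (k := 0) (C := L * ‖d‖ * ‖u‖) (by simp)
    (fun t ht => (hw.hasDerivAt_fderiv_line hd u ht).sub_const _)
    (fun t ht => by simpa using hw.abs_hess_bilin_le (hd t ht) d u) 1 (by simp)
  simpa using this

theorem abs_taylor_one_le : |w (x + d) - w x - fderiv ℝ w x d| ≤ L / 2 * ‖d‖ ^ 2 := by
  have hA := abs_le_pow_of_abs_deriv_le
    (g := fun t : ℝ => fderiv ℝ w (x + t • d) d - fderiv ℝ w x d)
    (T := 1) (k := 0) (C := L * ‖d‖ * ‖d‖) (by simp)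
    (fun t ht => (hw.hasDerivAt_fderiv_line hd d ht).sub_const _)
    (fun t ht => by simpa using hw.abs_hess_bilin_le (hd t ht) d d)
  have := abs_le_pow_of_abs_deriv_le
    (g := fun t : ℝ => w (x + t • d) - w x - t * fderiv ℝ w x d)
    (g' := fun t : ℝ => fderiv ℝ w (x + t • d) d - fderiv ℝ w x d)
    (T := 1) (k := 1) (C := L * ‖d‖ * ‖d‖) (by simp)
    (fun t ht => by
      simpa using ((hw.hasDerivAt_line hd ht).sub_const (w x)).fun_sub
        ((hasDerivAt_id' t).mul_const (fderiv ℝ w x d)))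
    (by simpa using hA) 1 (by simp)
  norm_num at this
  exact this.trans (le_of_eq (by ring))

theorem abs_fderiv_taylor_le (u : E) :
    |fderiv ℝ w (x + d) u - fderiv ℝ w x u - fderiv ℝ (fderiv ℝ w) x d u| ≤
      M / 2 * ‖d‖ ^ 2 * ‖u‖ := by
  have := abs_le_pow_of_abs_deriv_le
    (g := fun t : ℝ => fderiv ℝ w (x + t • d) u - fderiv ℝ w x u -
      t * fderiv ℝ (fderiv ℝ w) x d u)
    (g' := fun t : ℝ => fderiv ℝ (fderiv ℝ w) (x + t • d) d u - fderiv ℝ (fderiv ℝ w) x d u)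
    (T := 1) (k := 1) (C := M * ‖d‖ * ‖d‖ * ‖u‖) (by simp)
    (fun t ht => by
      simpa using ((hw.hasDerivAt_fderiv_line hd u ht).sub_const (fderiv ℝ w x u)).fun_sub
        ((hasDerivAt_id' t).mul_const (fderiv ℝ (fderiv ℝ w) x d u)))
    (fun t ht => by simpa using hw.abs_hess_sub_bilin_le hd d u ht) 1 (by simp)
  norm_num at this
  exact this.trans (le_of_eq (by ring))

theorem abs_taylor_two_le :
    |w (x + d) - w x - fderiv ℝ w x d - 1 / 2 * fderiv ℝ (fderiv ℝ w) x d d| ≤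
      M / 6 * ‖d‖ ^ 3 := by
  have hA := abs_le_pow_of_abs_deriv_le
    (g := fun t : ℝ => fderiv ℝ w (x + t • d) d - fderiv ℝ w x d -
      t * fderiv ℝ (fderiv ℝ w) x d d)
    (g' := fun t : ℝ => fderiv ℝ (fderiv ℝ w) (x + t • d) d d - fderiv ℝ (fderiv ℝ w) x d d)
    (T := 1) (k := 1) (C := M * ‖d‖ * ‖d‖ * ‖d‖) (by simp)
    (fun t ht => by
      simpa using ((hw.hasDerivAt_fderiv_line hd d ht).sub_const (fderiv ℝ w x d)).fun_sub
        ((hasDerivAt_id' t).mul_const (fderiv ℝ (fderiv ℝ w) x d d)))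
    (fun t ht => by simpa using hw.abs_hess_sub_bilin_le hd d d ht)
  have := abs_le_pow_of_abs_deriv_le
    (g := fun t : ℝ => w (x + t • d) - w x - t * fderiv ℝ w x d -
      t ^ 2 / 2 * fderiv ℝ (fderiv ℝ w) x d d)
    (g' := fun t : ℝ => fderiv ℝ w (x + t • d) d - fderiv ℝ w x d -
      t * fderiv ℝ (fderiv ℝ w) x d d)
    (T := 1) (k := 2) (C := M * ‖d‖ * ‖d‖ * ‖d‖ / 2) (by simp)
    (fun t ht => by
      have := (((hw.hasDerivAt_line hd ht).sub_const (w x)).fun_sub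
        ((hasDerivAt_id' t).mul_const (fderiv ℝ w x d))).fun_sub
        (((hasDerivAt_pow 2 t).div_const 2).mul_const (fderiv ℝ (fderiv ℝ w) x d d))
      refine this.congr_deriv ?_
      norm_num)
    (fun t ht => by
      have := hA t ht
      norm_num at this
      linarith) 1 (by simp)
  norm_num at this
  norm_num
  exact this.trans (le_of_eq (by ring))

end IsRegularOn

variable {F : Type*} [NormedAddCommGroup F] [InnerProductSpace ℝ F]

theorem IsRegularOn.hasFDerivAt_comp_add {w : E → ℝ} {U : Set E} {L M : ℝ}
    (hw : IsRegularOn w U L M) (P : F →L[ℝ] E) (ℓ : F →L[ℝ] ℝ) (c : ℝ) {z : F} (hz : P z ∈ U) :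
    HasFDerivAt (fun z => w (P z) + ℓ z + c) ((fderiv ℝ w (P z)).comp P + ℓ) z :=
  (((hw.differentiableAt _ hz).hasFDerivAt.comp z P.hasFDerivAt).add ℓ.hasFDerivAt).add_const c

/-- Covers the relaxed constraints of both phases: `P` is the projection `(x, t) ↦ x` or the
identity, and since it does not increase norms the constants `L` and `M` survive. -/
theorem IsRegularOn.comp_add {w : E → ℝ} {U : Set E} {L M : ℝ} (hw : IsRegularOn w U L M)
    (hL : 0 ≤ L) (hM : 0 ≤ M) (P : F →L[ℝ] E) (hP : ∀ z, ‖P z‖ ≤ ‖z‖) (ℓ : F →L[ℝ] ℝ) (c : ℝ)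
    {V : Set F} (hV : IsOpen V) (hVU : ∀ z ∈ V, P z ∈ U) :
    IsRegularOn (fun z => w (P z) + ℓ z + c) V L M := by
  have h2 : ∀ z ∈ V, ∃ B : F →L[ℝ] F →L[ℝ] ℝ,
      HasFDerivAt (fderiv ℝ (fun z => w (P z) + ℓ z + c)) B z ∧
      ∀ u v, B u v = fderiv ℝ (fderiv ℝ w) (P z) (P u) (P v) := by
    intro z hz
    have h := (((hw.differentiableAt_fderiv _ (hVU z hz)).hasFDerivAt.comp z
      P.hasFDerivAt).clm_comp (hasFDerivAt_const P z)).add_const ℓ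
    refine ⟨_, h.congr_of_eventuallyEq ?_, fun u v => by simp⟩
    filter_upwards [hV.mem_nhds hz] with y hy
    exact (hw.hasFDerivAt_comp_add P ℓ c (hVU y hy)).fderiv
  have h3 : ∀ z ∈ V, ∀ u v, fderiv ℝ (fderiv ℝ (fun z => w (P z) + ℓ z + c)) z u v =
      fderiv ℝ (fderiv ℝ w) (P z) (P u) (P v) := by
    intro z hz u v
    obtain ⟨B, hB, hB'⟩ := h2 z hz
    rw [hB.fderiv, hB']
  refine ⟨hV, fun z hz => (hw.hasFDerivAt_comp_add P ℓ c (hVU z hz)).differentiableAt,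
    fun z hz => (h2 z hz).choose_spec.1.differentiableAt, fun z hz u => ?_, fun z d hd u => ?_⟩
  · rw [h3 z hz]
    refine (hw.abs_hess_le _ (hVU z hz) _).trans ?_
    have := hP u
    gcongr
  · have hz : z ∈ V := by simpa using hd 0 (by simp)
    have hzd : z + d ∈ V := by simpa using hd 1 (by simp)
    rw [h3 z hz, h3 _ hzd, map_add]
    refine (hw.abs_hess_sub_le _ _ (fun θ hθ => ?_) _).trans ?_
    · simpa using hVU _ (hd θ hθ)
    · have := hP u
      have := hP d
      gcongr

theorem isRegularOn_zero {U : Set E} (hU : IsOpen U) {L M : ℝ} (hL : 0 ≤ L) (hM : 0 ≤ M) :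
    IsRegularOn (fun _ : E => (0 : ℝ)) U L M := by
  have : fderiv ℝ (fun _ : E => (0 : ℝ)) = fun _ => 0 := by ext; simp
  refine ⟨hU, fun x _ => by fun_prop, fun x _ => ?_, fun x _ u => ?_, fun x d _ u => ?_⟩
  · rw [this]; fun_prop
  · rw [this]; simp; positivity
  · rw [this]; simp; positivity

end Regular

/-! ### Derivatives of the Lagrangian and of the barrier function -/

section Barrier

variable {E : Type*} [NormedAddCommGroup E] [InnerProductSpace ℝ E]
variable {ι : Type*} [Fintype ι]

theorem hasFDerivAt_lagrangian {f : E → ℝ} {a : ι → E → ℝ} {x : E} (y : ι → ℝ)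
    (hf : DifferentiableAt ℝ f x) (ha : ∀ i, DifferentiableAt ℝ (a i) x) :
    HasFDerivAt (lagrangian f a y) (fderiv ℝ f x - ∑ i, y i • fderiv ℝ (a i) x) x :=
  hf.hasFDerivAt.fun_sub (HasFDerivAt.fun_sum fun i _ => (ha i).hasFDerivAt.const_mul (y i))

theorem hasFDerivAt_barrier {f : E → ℝ} {a : ι → E → ℝ} (μ : ℝ) {x : E}
    (hf : DifferentiableAt ℝ f x) (ha : ∀ i, DifferentiableAt ℝ (a i) x) (hx : ∀ i, 0 < a i x) :
    HasFDerivAt (barrier f a μ)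
      (fderiv ℝ f x - μ • ∑ i, (a i x)⁻¹ • fderiv ℝ (a i) x) x :=
  hf.hasFDerivAt.fun_sub ((HasFDerivAt.fun_sum fun i _ =>
    (ha i).hasFDerivAt.log (hx i).ne').const_mul μ)

theorem fderiv_barrier_apply {f : E → ℝ} {a : ι → E → ℝ} (μ : ℝ) {x : E}
    (hf : DifferentiableAt ℝ f x) (ha : ∀ i, DifferentiableAt ℝ (a i) x) (hx : ∀ i, 0 < a i x)
    (u : E) : fderiv ℝ (barrier f a μ) x u =
      fderiv ℝ f x u - μ * ∑ i, fderiv ℝ (a i) x u / a i x := by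
  rw [(hasFDerivAt_barrier μ hf ha hx).fderiv]
  simp [div_eq_inv_mul]

theorem fderiv_fderiv_barrier_apply {f : E → ℝ} {a : ι → E → ℝ} (μ : ℝ) {U : Set E} {L M : ℝ}
    (hf : IsRegularOn f U L M) (ha : ∀ i, IsRegularOn (a i) U L M)
    (hU : ∀ x ∈ U, ∀ i, 0 < a i x) {x : E} (hx : x ∈ U) (u v : E) :
    fderiv ℝ (fderiv ℝ (barrier f a μ)) x u v =
      fderiv ℝ (fderiv ℝ f) x u v - μ * ∑ i, (fderiv ℝ (fderiv ℝ (a i)) x u v / a i x -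
        fderiv ℝ (a i) x u * fderiv ℝ (a i) x v / a i x ^ 2) := by
  have h : HasFDerivAt (fderiv ℝ (barrier f a μ)) (fderiv ℝ (fderiv ℝ f) x -
      μ • ∑ i, ((a i x)⁻¹ • fderiv ℝ (fderiv ℝ (a i)) x +
        (-(a i x ^ 2)⁻¹ • fderiv ℝ (a i) x).smulRight (fderiv ℝ (a i) x))) x := by
    have h1 := (hf.differentiableAt_fderiv x hx).hasFDerivAt.fun_sub
      ((HasFDerivAt.fun_sum (u := Finset.univ) fun i _ =>
        (((hasDerivAt_inv (hU x hx i).ne').comp_hasFDerivAt x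
          ((ha i).differentiableAt x hx).hasFDerivAt).fun_smul
          ((ha i).differentiableAt_fderiv x hx).hasFDerivAt)).const_smul μ)
    refine h1.congr_of_eventuallyEq ?_
    filter_upwards [hf.isOpen.mem_nhds hx] with y hy
    exact (hasFDerivAt_barrier μ (hf.differentiableAt y hy)
      (fun i => (ha i).differentiableAt y hy) (hU y hy)).fderiv
  rw [h.fderiv]
  simp only [_root_.sub_apply, _root_.smul_apply, _root_.sum_apply, _root_.add_apply,
    ContinuousLinearMap.smulRight_apply, smul_eq_mul]
  congr 2
  refine Finset.sum_congr rfl fun i _ => ?_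
  have := (hU x hx i).ne'
  field_simp
  ring

variable [CompleteSpace E]

theorem inner_gradient (w : E → ℝ) (x u : E) : inner ℝ (gradient w x) u = fderiv ℝ w x u := by
  simp [gradient]

theorem norm_gradient_le {w : E → ℝ} {x : E} {K : ℝ} (hK : 0 ≤ K)
    (h : ∀ u, fderiv ℝ w x u ≤ K * ‖u‖) : ‖gradient w x‖ ≤ K := by
  have := h (gradient w x)
  rw [← inner_gradient, real_inner_self_eq_norm_sq] at this
  by_contra! hc
  nlinarith

theorem abs_fderiv_le_norm_gradient (w : E → ℝ) (x u : E) :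
    |fderiv ℝ w x u| ≤ ‖gradient w x‖ * ‖u‖ := by
  rw [← inner_gradient]
  exact abs_real_inner_le_norm _ _

end Barrier

/-! ### Optimality conditions of the trust region subproblem -/

section TrustRegion

variable {E : Type*} [NormedAddCommGroup E] [InnerProductSpace ℝ E] [CompleteSpace E]

theorem model_eq (w : E → ℝ) (x u : E) :
    model w x u = 1 / 2 * fderiv ℝ (fderiv ℝ w) x u u + fderiv ℝ w x u := by
  rw [model, hessForm, inner_gradient]

theorem exists_isTrustRegionSolution [FiniteDimensional ℝ E] (w : E → ℝ) (x : E) {r : ℝ}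
    (hr : 0 ≤ r) : ∃ d, IsTrustRegionSolution w x r d := by
  have hc : ContinuousOn (model w x) (Metric.closedBall 0 r) := by
    have : model w x = fun u => 1 / 2 * fderiv ℝ (fderiv ℝ w) x u u + fderiv ℝ w x u :=
      funext fun u => model_eq w x u
    rw [this]
    fun_prop
  obtain ⟨d, hd, hmin⟩ := (isCompact_closedBall (0 : E) r).exists_isMinOn
    ⟨0, by simpa using hr⟩ hc
  exact ⟨d, by simpa using hd, fun u hu => hmin (by simpa using hu)⟩

theorem nonneg_of_forall_mul_add_sq {A B : ℝ}
    (h : ∀ t, 0 < t → t ≤ 1 → 0 ≤ t * A + t ^ 2 * B) : 0 ≤ A := by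
  have h2 : Tendsto (fun t : ℝ => A + t * B) (𝓝[>] 0) (𝓝 A) := by
    have : Continuous fun t : ℝ => A + t * B := by fun_prop
    simpa using (this.tendsto 0).mono_left nhdsWithin_le_nhds
  refine ge_of_tendsto h2 ?_
  filter_upwards [Ioo_mem_nhdsGT (zero_lt_one' ℝ)] with t ht
  have := h t ht.1 ht.2.le
  have e : t * A + t ^ 2 * B = t * (A + t * B) := by ring
  rw [e] at this
  exact nonneg_of_mul_nonneg_right this ht.1

namespace IsTrustRegionSolution

variable {w : E → ℝ} {x d : E} {r : ℝ} (hd : IsTrustRegionSolution w x r d)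
include hd

theorem model_nonpos (hr : 0 ≤ r) : model w x d ≤ 0 := by
  simpa [model_eq] using hd.2 0 (by simpa using hr)

/-- Comparison of `d` with the two boundary points `±(r / ‖u‖) u`: averaging cancels the linear term
of the model. -/
theorem hess_ge (hr : 0 < r) (u : E) :
    -(2 * -model w x d / r ^ 2) * ‖u‖ ^ 2 ≤ fderiv ℝ (fderiv ℝ w) x u u := by
  rcases eq_or_ne u 0 with rfl | hu
  · simp
  have hup : 0 < ‖u‖ := norm_pos_iff.2 hu
  set c := r / ‖u‖ with hc
  have hcp : 0 < c := by positivity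
  have hn : ‖c • u‖ ≤ r := by
    rw [norm_smul, Real.norm_of_nonneg hcp.le, hc, div_mul_cancel₀ _ hup.ne']
  have h1 := hd.2 (c • u) hn
  have h2 := hd.2 (-(c • u)) (by rwa [norm_neg])
  rw [model_eq w x (c • u)] at h1
  rw [model_eq w x (-(c • u))] at h2
  simp only [map_neg, map_smul, _root_.neg_apply, _root_.smul_apply, smul_eq_mul] at h1 h2
  have h3 : 2 * model w x d ≤ c ^ 2 * fderiv ℝ (fderiv ℝ w) x u u := by linarith
  have h4 : -(2 * -model w x d / r ^ 2) * ‖u‖ ^ 2 = 2 * model w x d / c ^ 2 := by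
    rw [hc]; field_simp
  rw [h4, div_le_iff₀ (by positivity)]
  linarith

/-- The variational inequality of a minimizer over a convex set, obtained by moving from `d` towards
`v`. It replaces a Lagrange multiplier for the norm constraint. -/
theorem first_order (hsymm : ∀ u v, fderiv ℝ (fderiv ℝ w) x u v = fderiv ℝ (fderiv ℝ w) x v u)
    {v : E} (hv : ‖v‖ ≤ r) :
    fderiv ℝ w x d + fderiv ℝ (fderiv ℝ w) x d d ≤
      fderiv ℝ w x v + fderiv ℝ (fderiv ℝ w) x d v := by
  suffices 0 ≤ fderiv ℝ w x (v - d) + fderiv ℝ (fderiv ℝ w) x d (v - d) by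
    simp only [map_sub] at this
    linarith
  refine nonneg_of_forall_mul_add_sq
    (B := 1 / 2 * fderiv ℝ (fderiv ℝ w) x (v - d) (v - d)) fun t ht ht1 => ?_
  have hmem : ‖d + t • (v - d)‖ ≤ r := by
    have := (convex_closedBall (0 : E) r).add_smul_sub_mem (x := d) (y := v)
      (by simpa using hd.1) (by simpa using hv) ⟨ht.le, ht1⟩
    simpa using this
  have := hd.2 _ hmem
  rw [model_eq, model_eq] at this
  simp only [map_add, map_smul, _root_.add_apply, _root_.smul_apply, smul_eq_mul,
    hsymm (v - d) d] at this
  linarith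

theorem slope_nonpos (hsymm : ∀ u v, fderiv ℝ (fderiv ℝ w) x u v = fderiv ℝ (fderiv ℝ w) x v u)
    (hr : 0 ≤ r) : fderiv ℝ w x d + fderiv ℝ (fderiv ℝ w) x d d ≤ 0 := by
  simpa using hd.first_order hsymm (v := 0) (by simpa using hr)

/-- The variational inequality at the boundary points `±(r / ‖u‖) u` bounds the residual by the
slope at `d`, which is controlled by the model value. -/
theorem abs_residual_le
    (hsymm : ∀ u v, fderiv ℝ (fderiv ℝ w) x u v = fderiv ℝ (fderiv ℝ w) x v u)
    (hr : 0 < r) (u : E) :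
    |fderiv ℝ w x u + fderiv ℝ (fderiv ℝ w) x d u| ≤ 2 * -model w x d / r * ‖u‖ := by
  rcases eq_or_ne u 0 with rfl | hu
  · simp
  have hup : 0 < ‖u‖ := norm_pos_iff.2 hu
  set c := r / ‖u‖ with hc
  have hcp : 0 < c := by positivity
  have hn : ‖c • u‖ ≤ r := by
    rw [norm_smul, Real.norm_of_nonneg hcp.le, hc, div_mul_cancel₀ _ hup.ne']
  have h1 := hd.first_order hsymm hn
  have h2 := hd.first_order hsymm (v := -(c • u)) (by rwa [norm_neg])
  simp only [map_neg, map_smul, smul_eq_mul] at h1 h2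
  have hm := hd.model_nonpos hr.le
  -- The slope is the model value plus half the curvature at `d`, and `hess_ge` with `‖d‖ ≤ r`
  -- bounds that half below by the model value again.
  have h3 : 2 * model w x d ≤ fderiv ℝ w x d + fderiv ℝ (fderiv ℝ w) x d d := by
    have hh := hd.hess_ge hr d
    have hdr : ‖d‖ ^ 2 ≤ r ^ 2 := by have := hd.1; gcongr
    have : 2 * model w x d ≤ -(2 * -model w x d / r ^ 2) * ‖d‖ ^ 2 := by
      rw [show -(2 * -model w x d / r ^ 2) * ‖d‖ ^ 2 = 2 * model w x d * ‖d‖ ^ 2 / r ^ 2 by ring,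
        le_div_iff₀ (by positivity)]
      nlinarith
    have e := model_eq w x d
    linarith
  have h4 : 2 * -model w x d / r * ‖u‖ = 2 * -model w x d / c := by
    rw [hc]; field_simp
  rw [h4, le_div_iff₀ hcp]
  have h5 : |fderiv ℝ w x u + fderiv ℝ (fderiv ℝ w) x d u| * c =
      |c * fderiv ℝ w x u + c * fderiv ℝ (fderiv ℝ w) x d u| := by
    rw [← mul_add, abs_mul, abs_of_pos hcp, mul_comm]
  rw [h5, abs_le]
  constructor <;> linarith

end IsTrustRegionSolution

end TrustRegion

/-! ### Strict feasibility of small steps -/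

section Step

variable {E : Type*} [NormedAddCommGroup E] [InnerProductSpace ℝ E]
variable {ι : Type*} [Fintype ι]

/-- The situation of one iteration from the strictly feasible point `x`: the data are regular on the
strictly feasible set and the radius `r` is small compared with the slacks. -/
structure IsStepSetting (f : E → ℝ) (a : ι → E → ℝ) (μ L M η r : ℝ) (x : E) : Prop where
  regular_obj : IsRegularOn f {x | ∀ i, 0 < a i x} L M
  regular_con : ∀ i, IsRegularOn (a i) {x | ∀ i, 0 < a i x} L M
  continuous_con : ∀ i, Continuous (a i)
  mu_pos : 0 < μ
  lip_pos : 0 < L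
  lip_nonneg : 0 ≤ M
  eta_pos : 0 < η
  eta_le : η ≤ 1 / 80
  radius_pos : 0 < r
  radius_sq : L * (1 + ∑ i, μ / a i x) * r ^ 2 = η ^ 2 * μ / 4
  lip_radius : M * r ≤ 2 * L * η
  feasible : ∀ i, 0 < a i x

/-- A displacement within the trust region that changes the slacks by a small relative amount. -/
structure IsSmallStep (a : ι → E → ℝ) (η r : ℝ) (x u : E) : Prop where
  norm_le : ‖u‖ ≤ r
  sum_sq_le : ∑ i, (fderiv ℝ (a i) x u / a i x) ^ 2 ≤ η ^ 2

namespace IsStepSetting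

variable {f : E → ℝ} {a : ι → E → ℝ} {μ L M η r : ℝ} {x : E}
  (h : IsStepSetting f a μ L M η r x)
include h

theorem dual_pos (i : ι) : 0 < μ / a i x := div_pos h.mu_pos (h.feasible i)

theorem sum_dual_nonneg : 0 ≤ ∑ i, μ / a i x := Finset.sum_nonneg fun i _ => (h.dual_pos i).le

/-- This is the purpose of the radius rule: after division by `2μ`, the bound on `L r² ∑ μ / aᵢ`
controls the sum of the relative slack errors, not only each of them. -/
theorem sum_slack_error_le : ∑ i, L * r ^ 2 / (2 * a i x) ≤ η ^ 2 / 8 := by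
  have hμ := h.mu_pos
  have e : ∑ i, L * r ^ 2 / (2 * a i x) = L * (∑ i, μ / a i x) * r ^ 2 / (2 * μ) := by
    rw [Finset.mul_sum, Finset.sum_mul, Finset.sum_div]
    refine Finset.sum_congr rfl fun i _ => ?_
    have := (h.feasible i).ne'
    field_simp
  rw [e, div_le_iff₀ (by positivity)]
  have h1 := h.radius_sq
  have : 0 ≤ L * r ^ 2 := by have := h.lip_pos; positivity
  linarith

theorem slack_error_nonneg (i : ι) : 0 ≤ L * r ^ 2 / (2 * a i x) := by
  have := h.feasible i
  have := h.lip_pos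
  positivity

theorem slack_error_le (i : ι) : L * r ^ 2 / (2 * a i x) ≤ η ^ 2 / 8 :=
  (Finset.single_le_sum (f := fun i => L * r ^ 2 / (2 * a i x))
    (fun i _ => h.slack_error_nonneg i) (Finset.mem_univ i)).trans h.sum_slack_error_le

variable {u : E} (hu : IsSmallStep a η r x u)
include hu

omit h in
theorem _root_.TwoPhaseIPM.IsSmallStep.abs_scaled_le (hη : 0 ≤ η) (i : ι) :
    |fderiv ℝ (a i) x u / a i x| ≤ η := by
  refine abs_le_of_sq_le_sq ?_ hη
  exact (Finset.single_le_sum (f := fun i => (fderiv ℝ (a i) x u / a i x) ^ 2)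
    (fun i _ => sq_nonneg _) (Finset.mem_univ i)).trans hu.sum_sq_le

theorem abs_slack_sub_le {θ : ℝ} (hθ : θ ∈ Icc (0 : ℝ) 1)
    (hs : ∀ t ∈ Icc (0 : ℝ) θ, x + t • u ∈ {x | ∀ i, 0 < a i x}) (i : ι) :
    |a i (x + θ • u) - a i x - θ * fderiv ℝ (a i) x u| ≤ L * r ^ 2 / (2 * a i x) * a i x := by
  have := (h.regular_con i).abs_taylor_one_le (x := x) (d := θ • u) (fun t ht => by
    rw [smul_smul]
    exact hs _ ⟨mul_nonneg ht.1 hθ.1, mul_le_of_le_one_left hθ.1 ht.2⟩)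
  rw [map_smul, smul_eq_mul] at this
  refine this.trans ?_
  have ha := (h.feasible i).ne'
  have e : L * r ^ 2 / (2 * a i x) * a i x = L / 2 * r ^ 2 := by field_simp
  rw [e]
  have hL := h.lip_pos
  have : ‖θ • u‖ ≤ r := by
    rw [norm_smul, Real.norm_of_nonneg hθ.1]
    exact (mul_le_of_le_one_left (norm_nonneg u) hθ.2).trans hu.norm_le
  gcongr

/-- Conditional on feasibility up to `θ`; the gap between `3/4` here and `1/2` in `segment_feasible`
closes the continuation argument. -/
theorem slack_ge_of_segment {θ : ℝ} (hθ : θ ∈ Icc (0 : ℝ) 1)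
    (hs : ∀ t ∈ Icc (0 : ℝ) θ, x + t • u ∈ {x | ∀ i, 0 < a i x}) (i : ι) :
    3 / 4 * a i x ≤ a i (x + θ • u) := by
  have h1 := h.abs_slack_sub_le hu hθ hs i
  have h2 := hu.abs_scaled_le h.eta_pos.le i
  have h3 := h.slack_error_le i
  have ha := h.feasible i
  have hη := h.eta_pos
  have hη' := h.eta_le
  rw [abs_div, abs_of_pos ha, div_le_iff₀ ha] at h2
  have h4 : L * r ^ 2 / (2 * a i x) * a i x ≤ η ^ 2 / 8 * a i x := by gcongr
  have h5 : |θ * fderiv ℝ (a i) x u| ≤ η * a i x := by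
    rw [abs_mul, abs_of_nonneg hθ.1]
    exact (mul_le_of_le_one_left (abs_nonneg _) hθ.2).trans h2
  have h6 : η * a i x ≤ 1 / 80 * a i x := by gcongr
  have h7 : η ^ 2 / 8 * a i x ≤ (1 / 80) ^ 2 / 8 * a i x := by gcongr
  rw [abs_le] at h1 h5
  linarith

/-- The Taylor bounds hold only where the slacks are positive, so feasibility is obtained by
continuation. At the least `θ` at which some slack has fallen to half its value, the earlier points
still give three quarters, contradicting continuity. -/
theorem segment_feasible : ∀ θ ∈ Icc (0 : ℝ) 1, x + θ • u ∈ {x | ∀ i, 0 < a i x} := by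
  set T : Set ℝ := Icc 0 1 ∩ ⋃ i, {θ : ℝ | a i (x + θ • u) ≤ a i x / 2} with hTdef
  have hcont : ∀ i, Continuous fun θ : ℝ => a i (x + θ • u) := fun i =>
    (h.continuous_con i).comp (by fun_prop)
  by_contra! hcon
  obtain ⟨θ₁, hθ₁, hbad⟩ := hcon
  have hTne : T.Nonempty := by
    simp only [mem_ofPred_eq, not_forall, not_lt] at hbad
    obtain ⟨i, hi⟩ := hbad
    exact ⟨θ₁, hθ₁, mem_iUnion.2 ⟨i, hi.trans (half_pos (h.feasible i)).le⟩⟩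
  have hTc : IsCompact T := isCompact_Icc.inter_right
    (isClosed_iUnion_of_finite fun i => isClosed_le (hcont i) continuous_const)
  obtain ⟨θ, hθT, hleast⟩ := hTc.exists_isLeast hTne
  obtain ⟨hθ, hθi⟩ := hθT
  obtain ⟨i, hi⟩ := mem_iUnion.1 hθi
  have hi : a i (x + θ • u) ≤ a i x / 2 := hi
  have hlt : ∀ t ∈ Ico 0 θ, 3 / 4 * a i x ≤ a i (x + t • u) := by
    intro t ht
    refine h.slack_ge_of_segment hu ⟨ht.1, ht.2.le.trans hθ.2⟩ (fun s hs j => ?_) i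
    by_contra! hneg
    have : s ∈ T := ⟨⟨hs.1, hs.2.trans (ht.2.le.trans hθ.2)⟩,
      mem_iUnion.2 ⟨j, hneg.trans (half_pos (h.feasible j)).le⟩⟩
    exact absurd (hleast this) (not_le.2 (hs.2.trans_lt ht.2))
  have hpos : 0 < θ := by
    rcases hθ.1.eq_or_lt with h0 | h0
    · rw [← h0] at hi
      have := h.feasible i
      simp only [zero_smul, add_zero] at hi
      linarith
    · exact h0
  have hlim : 3 / 4 * a i x ≤ a i (x + θ • u) := by
    refine ge_of_tendsto (((hcont i).tendsto θ).mono_left (nhdsWithin_le_nhds (s := Iio θ))) ?_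
    filter_upwards [Ioo_mem_nhdsLT hpos] with t ht
    exact hlt t (Ioo_subset_Ico_self ht)
  have := h.feasible i
  linarith

theorem feasible_add : ∀ i, 0 < a i (x + u) := by
  simpa using h.segment_feasible hu 1 (by simp)

/-- The relative change of a slack is the scaled linear change up to a small error. -/
theorem abs_ratio_sub_le (i : ι) :
    |a i (x + u) / a i x - 1 - fderiv ℝ (a i) x u / a i x| ≤ L * r ^ 2 / (2 * a i x) := by
  have h1 := h.abs_slack_sub_le hu (θ := 1) (by simp) (h.segment_feasible hu) i
  have ha := h.feasible i
  have e : a i (x + u) / a i x - 1 - fderiv ℝ (a i) x u / a i x =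
    (a i (x + u) - a i x - fderiv ℝ (a i) x u) / a i x := by field_simp
  rw [e, abs_div, abs_of_pos ha, div_le_iff₀ ha]
  simpa using h1

theorem abs_ratio_sub_one_le (i : ι) : |a i (x + u) / a i x - 1| ≤ 101 / 100 * η := by
  have h1 := h.abs_ratio_sub_le hu i
  have h2 := hu.abs_scaled_le h.eta_pos.le i
  have h3 := h.slack_error_le i
  have hη := h.eta_pos
  have hη' := h.eta_le
  rw [abs_le] at *
  constructor <;> nlinarith

end IsStepSetting

end Step

/-! ### Accuracy of the model and decrease of the barrier function -/

section Step

variable {E : Type*} [NormedAddCommGroup E] [InnerProductSpace ℝ E]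
variable {ι : Type*} [Fintype ι]

theorem neg_log_one_add_le {z : ℝ} (hz : |z| ≤ 1 / 2) :
    -Real.log (1 + z) ≤ -z + z ^ 2 / 2 + 2 * |z| ^ 3 := by
  have h := Real.abs_log_sub_add_sum_range_le (x := -z) (by rw [abs_neg]; linarith) 2
  rw [abs_neg, sub_neg_eq_add] at h
  norm_num [Finset.sum_range_succ] at h
  have h2 : |z| ^ 3 / (1 - |z|) ≤ 2 * |z| ^ 3 := by
    rw [div_le_iff₀ (by linarith)]
    have : 0 ≤ |z| ^ 3 := by positivity
    nlinarith
  have := (abs_le.1 (h.trans h2)).1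
  linarith

namespace IsStepSetting

variable {f : E → ℝ} {a : ι → E → ℝ} {μ L M η r : ℝ} {x : E}
  (h : IsStepSetting f a μ L M η r x)
include h

theorem fderiv_barrier (u : E) : fderiv ℝ (barrier f a μ) x u =
    fderiv ℝ f x u - μ * ∑ i, fderiv ℝ (a i) x u / a i x :=
  fderiv_barrier_apply μ (h.regular_obj.differentiableAt x h.feasible)
    (fun i => (h.regular_con i).differentiableAt x h.feasible) h.feasible u

theorem hess_barrier (u v : E) : fderiv ℝ (fderiv ℝ (barrier f a μ)) x u v =
    fderiv ℝ (fderiv ℝ f) x u v - μ * ∑ i, (fderiv ℝ (fderiv ℝ (a i)) x u v / a i x -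
      fderiv ℝ (a i) x u * fderiv ℝ (a i) x v / a i x ^ 2) :=
  fderiv_fderiv_barrier_apply μ h.regular_obj h.regular_con (fun _ hx => hx) h.feasible u v

theorem hess_barrier_symm (u v : E) : fderiv ℝ (fderiv ℝ (barrier f a μ)) x u v =
    fderiv ℝ (fderiv ℝ (barrier f a μ)) x v u := by
  rw [h.hess_barrier, h.hess_barrier, h.regular_obj.hess_symm h.feasible u v]
  congr 2
  refine Finset.sum_congr rfl fun i _ => ?_
  rw [(h.regular_con i).hess_symm h.feasible u v, mul_comm (fderiv ℝ (a i) x u)]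

/-- The third order error allowance in terms of the radius. -/
theorem lip_mul_radius_cube_le : M * (1 + ∑ i, μ / a i x) * r ^ 3 ≤ η ^ 3 * μ / 2 := by
  have hN := h.sum_dual_nonneg
  have hr := h.radius_pos
  calc M * (1 + ∑ i, μ / a i x) * r ^ 3 = (M * r) * ((1 + ∑ i, μ / a i x) * r ^ 2) := by ring
    _ ≤ (2 * L * η) * ((1 + ∑ i, μ / a i x) * r ^ 2) :=
      mul_le_mul_of_nonneg_right h.lip_radius (by positivity)
    _ = 2 * η * (L * (1 + ∑ i, μ / a i x) * r ^ 2) := by ring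
    _ = η ^ 3 * μ / 2 := by rw [h.radius_sq]; ring

/-- Up to third order in `η`, the model predicts the change of the barrier function. -/
theorem barrier_add_le [CompleteSpace E] {u : E} (hu : IsSmallStep a η r x u) :
    barrier f a μ (x + u) ≤ barrier f a μ x + model (barrier f a μ) x u + 5 * μ * η ^ 3 := by
  have hη := h.eta_pos
  have hη' := h.eta_le
  have hμ := h.mu_pos
  have hM := h.lip_nonneg
  set s : ι → ℝ := fun i => fderiv ℝ (a i) x u / a i x with hs
  set H : ι → ℝ := fun i => fderiv ℝ (fderiv ℝ (a i)) x u u / a i x with hH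
  set e : ι → ℝ := fun i => L * r ^ 2 / (2 * a i x) with he
  have hr3 : ‖u‖ ^ 3 ≤ r ^ 3 := by have := hu.norm_le; gcongr
  have hf := h.regular_obj.abs_taylor_two_le (h.segment_feasible hu)
  have hf' : M / 6 * ‖u‖ ^ 3 ≤ M / 6 * r ^ 3 := by gcongr
  -- Every error is kept proportional to `e i`, `s i ^ 2` or `μ / a i x`: the sums of these over `i`
  -- are controlled independently of the number of constraints.
  have hterm : ∀ i, -(μ * Real.log (a i (x + u))) ≤ -(μ * Real.log (a i x)) - μ * s i -
      μ / 2 * (H i - s i ^ 2) + M / 6 * r ^ 3 * (μ / a i x) +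
      (7 / 2 * μ * η * e i + 41 / 10 * μ * η * s i ^ 2) := by
    intro i
    have ha := h.feasible i
    have ha' := h.feasible_add hu i
    set z := a i (x + u) / a i x - 1 with hz
    have hzs : |z - s i| ≤ e i := h.abs_ratio_sub_le hu i
    have hz1 : |z| ≤ 101 / 100 * η := h.abs_ratio_sub_one_le hu i
    have hsη : |s i| ≤ η := hu.abs_scaled_le hη.le i
    have heη : e i ≤ η ^ 2 / 8 := h.slack_error_le i
    have he0 : 0 ≤ e i := h.slack_error_nonneg i
    have hlog : Real.log (a i (x + u)) = Real.log (a i x) + Real.log (1 + z) := by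
      rw [← Real.log_mul ha.ne' (by rw [hz]; have := div_pos ha' ha; linarith)]
      congr 1
      rw [hz]; field_simp; ring
    have hl := neg_log_one_add_le (z := z) (by linarith)
    have hquad : -z ≤ -s i - 1 / 2 * H i + M / 6 * r ^ 3 / a i x := by
      have ht := (h.regular_con i).abs_taylor_two_le (h.segment_feasible hu)
      have ht' := (abs_le.1 (ht.trans hf')).1
      have e1 : -s i - 1 / 2 * H i + M / 6 * r ^ 3 / a i x - -z =
          (M / 6 * r ^ 3 + (a i (x + u) - a i x - fderiv ℝ (a i) x u -
            1 / 2 * fderiv ℝ (fderiv ℝ (a i)) x u u)) / a i x := by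
        simp only [hz, hs, hH]; field_simp; ring
      have : 0 ≤ -s i - 1 / 2 * H i + M / 6 * r ^ 3 / a i x - -z := by
        rw [e1]; exact div_nonneg (by linarith) ha.le
      linarith
    have hes : |z - s i| ^ 2 ≤ η ^ 2 / 8 * e i := by
      have := abs_nonneg (z - s i)
      nlinarith
    have hsq : z ^ 2 ≤ s i ^ 2 + 3 * η * e i := by
      have h1 : z ^ 2 = s i ^ 2 + 2 * (s i * (z - s i)) + |z - s i| ^ 2 := by rw [sq_abs]; ring
      have h2 : s i * (z - s i) ≤ η * e i := by
        refine (le_abs_self _).trans ?_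
        rw [abs_mul]
        gcongr
      have h3 : η ^ 2 / 8 * e i ≤ η * e i := by gcongr; nlinarith
      linarith
    have hcube : |z| ^ 3 ≤ 202 / 100 * η * s i ^ 2 + η * e i := by
      have h1 : z ^ 2 ≤ 2 * s i ^ 2 + 2 * |z - s i| ^ 2 := by
        rw [sq_abs]; nlinarith [sq_nonneg (s i - (z - s i))]
      have h2 : η ^ 2 / 8 * e i ≤ 1 / 8 * e i := by gcongr; nlinarith
      have h3 : z ^ 2 ≤ 2 * s i ^ 2 + 1 / 4 * e i := by linarith
      calc |z| ^ 3 = |z| * z ^ 2 := by rw [← sq_abs z]; ring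
        _ ≤ 101 / 100 * η * (2 * s i ^ 2 + 1 / 4 * e i) := by gcongr
        _ = 202 / 100 * η * s i ^ 2 + 101 / 400 * (η * e i) := by ring
        _ ≤ 202 / 100 * η * s i ^ 2 + η * e i := by nlinarith [mul_nonneg hη.le he0]
    have hmain : -Real.log (1 + z) ≤ -s i - 1 / 2 * (H i - s i ^ 2) + M / 6 * r ^ 3 / a i x +
        (7 / 2 * η * e i + 41 / 10 * η * s i ^ 2) := by
      have : 0 ≤ η * s i ^ 2 := by positivity
      linarith
    have := mul_le_mul_of_nonneg_left hmain hμ.le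
    rw [hlog]
    have e2 : M / 6 * r ^ 3 * (μ / a i x) = μ * (M / 6 * r ^ 3 / a i x) := by ring
    rw [e2]
    linarith
  have hsum := Finset.sum_le_sum fun i (_ : i ∈ Finset.univ) => hterm i
  simp only [Finset.sum_add_distrib, Finset.sum_sub_distrib, Finset.sum_neg_distrib,
    ← Finset.mul_sum] at hsum
  have he8 : ∑ i, e i ≤ η ^ 2 / 8 := h.sum_slack_error_le
  have hs2 : ∑ i, s i ^ 2 ≤ η ^ 2 := hu.sum_sq_le
  have hcube := h.lip_mul_radius_cube_le
  have c1 : 7 / 2 * μ * η * ∑ i, e i ≤ 7 / 2 * μ * η * (η ^ 2 / 8) := by gcongr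
  have c2 : 41 / 10 * μ * η * ∑ i, s i ^ 2 ≤ 41 / 10 * μ * η * η ^ 2 := by gcongr
  have hs' : ∀ i, fderiv ℝ (a i) x u * fderiv ℝ (a i) x u / a i x ^ 2 = s i ^ 2 := fun i => by
    simp only [hs]; ring
  have hmodel : model (barrier f a μ) x u = 1 / 2 * fderiv ℝ (fderiv ℝ f) x u u +
      fderiv ℝ f x u - μ / 2 * (∑ i, H i - ∑ i, s i ^ 2) - μ * ∑ i, s i := by
    rw [model_eq, h.fderiv_barrier, h.hess_barrier]
    simp only [hs', Finset.sum_sub_distrib]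
    ring
  rw [hmodel, barrier, barrier]
  have hf'' := (abs_le.1 (hf.trans hf')).2
  have : 0 ≤ μ * η ^ 3 := by positivity
  linarith

/-- If the scaled slack change is too long, then the shortened step makes progress. -/
theorem model_smul_le [CompleteSpace E] {d : E} {κ : ℝ}
    (hd : IsTrustRegionSolution (barrier f a μ) x r d)
    (hκ : κ ^ 2 = ∑ i, (fderiv ℝ (a i) x d / a i x) ^ 2) (hηκ : η < κ) :
    model (barrier f a μ) x ((η / κ) • d) ≤ -(6 * μ * η ^ 3) := by
  have hη := h.eta_pos
  have hη' := h.eta_le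
  have hμ := h.mu_pos
  have hL := h.lip_pos
  have hκp : 0 < κ := hη.trans hηκ
  set α := η / κ with hα
  have hα0 : 0 < α := by positivity
  have hα1 : α ≤ 1 := (div_le_one hκp).2 hηκ.le
  set q := fderiv ℝ (fderiv ℝ (barrier f a μ)) x d d with hq
  have hslope := hd.slope_nonpos h.hess_barrier_symm h.radius_pos.le
  have hm : model (barrier f a μ) x (α • d) =
      α * fderiv ℝ (barrier f a μ) x d + 1 / 2 * α ^ 2 * q := by
    rw [model_eq]
    simp only [map_smul, _root_.smul_apply, smul_eq_mul]
    ring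
  have hd2 : ‖d‖ ^ 2 ≤ r ^ 2 := by have := hd.1; gcongr
  -- The rank-one terms of the logarithms contribute exactly `μ κ²`; the radius rule bounds the
  -- remaining curvature along `d`.
  have hqlow : μ * κ ^ 2 - η ^ 2 * μ / 4 ≤ q := by
    have h1 := (abs_le.1 (h.regular_obj.abs_hess_le x h.feasible d)).1
    have h2 : ∀ i, fderiv ℝ (fderiv ℝ (a i)) x d d / a i x ≤ L * ‖d‖ ^ 2 / a i x := fun i => by
      have := h.feasible i
      gcongr
      exact (abs_le.1 ((h.regular_con i).abs_hess_le x h.feasible d)).2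
    have h3 := Finset.sum_le_sum fun i (_ : i ∈ Finset.univ) => h2 i
    have h4 : μ * ∑ i, L * ‖d‖ ^ 2 / a i x = L * ‖d‖ ^ 2 * ∑ i, μ / a i x := by
      rw [Finset.mul_sum, Finset.mul_sum]
      exact Finset.sum_congr rfl fun i _ => by ring
    have h5 : ∀ i, fderiv ℝ (a i) x d * fderiv ℝ (a i) x d / a i x ^ 2 =
      (fderiv ℝ (a i) x d / a i x) ^ 2 := fun i => by ring
    rw [hq, h.hess_barrier]
    simp only [h5, Finset.sum_sub_distrib, ← hκ]
    have h6 := mul_le_mul_of_nonneg_left h3 hμ.le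
    rw [h4] at h6
    have h7 : L * (1 + ∑ i, μ / a i x) * ‖d‖ ^ 2 ≤ L * (1 + ∑ i, μ / a i x) * r ^ 2 := by
      have := h.sum_dual_nonneg
      gcongr
    rw [h.radius_sq] at h7
    linarith
  have hq34 : 3 / 4 * μ * κ ^ 2 ≤ q := by
    have : μ * η ^ 2 ≤ μ * κ ^ 2 := by gcongr
    linarith
  have hq0 : 0 ≤ q := by have : 0 ≤ 3 / 4 * μ * κ ^ 2 := by positivity
                         linarith
  -- With slope at most `-q`, the model at `α • d` is at most `-α q / 2 ≤ -(3/8) μ η²`, and `η ≤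
  -- 1/80` turns this into a multiple of `μ η³` with room to spare.
  have hα2 : α ^ 2 * q ≤ α * q := by
    have : α ^ 2 ≤ α := by nlinarith
    gcongr
  have h1 : α * fderiv ℝ (barrier f a μ) x d ≤ -(α * q) := by
    have := mul_le_mul_of_nonneg_left hslope hα0.le
    linarith
  have h2 : α * (3 / 4 * μ * κ ^ 2) ≤ α * q := by gcongr
  have h3 : α * (3 / 4 * μ * κ ^ 2) = 3 / 4 * μ * η * κ := by rw [hα]; field_simp
  have h4 : μ * η * η ≤ μ * η * κ := by gcongr
  have h5 : μ * η ^ 3 ≤ μ * η ^ 2 * (1 / 80) := by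
    rw [pow_succ η 2, ← mul_assoc]; gcongr
  rw [hm]
  have : 0 ≤ μ * η ^ 2 := by positivity
  linarith

end IsStepSetting

end Step

/-! ### Success of the termination test -/

section Step

variable {E : Type*} [NormedAddCommGroup E] [InnerProductSpace ℝ E]
variable {ι : Type*} [Fintype ι]

namespace IsStepSetting

variable {f : E → ℝ} {a : ι → E → ℝ} {μ L M η r : ℝ} {x : E}
  (h : IsStepSetting f a μ L M η r x)
include h

/-- The multipliers are the first order expansion of `μ / aᵢ` along `d`. Hence the Lagrangian
gradient at `x + d` agrees with `∇ψ(x) + ∇²ψ(x) d` up to Taylor remainders and products of `s` with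
`∇²aᵢ d`. These cost less than the increase from `48` to `60`. -/
theorem fderiv_lagrangian_add_le {d : E} (hd : IsSmallStep a η r x d)
    (hG : ∀ u, |fderiv ℝ (barrier f a μ) x u + fderiv ℝ (fderiv ℝ (barrier f a μ)) x d u| ≤
      48 * η * L * (1 + ∑ i, μ / a i x) * r * ‖u‖) (u : E) :
    fderiv ℝ (lagrangian f a fun i => μ / a i x * (1 - fderiv ℝ (a i) x d / a i x)) (x + d) u ≤
      60 * η * L * (1 + ∑ i, μ / a i x) * r * ‖u‖ := by
  have hη := h.eta_pos
  have hη' := h.eta_le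
  have hμ := h.mu_pos
  have hL := h.lip_pos
  have hr := h.radius_pos
  have hd2 : ‖d‖ ^ 2 ≤ r ^ 2 := by have := hd.norm_le; gcongr
  have hxd : x + d ∈ {x | ∀ i, 0 < a i x} := h.feasible_add hd
  have hMr : M / 2 * ‖d‖ ^ 2 * ‖u‖ ≤ L * η * r * ‖u‖ := by
    have : M / 2 * ‖d‖ ^ 2 ≤ L * η * r := by
      calc M / 2 * ‖d‖ ^ 2 ≤ M / 2 * r ^ 2 := by have := h.lip_nonneg; gcongr
        _ = (M * r) * (r / 2) := by ring
        _ ≤ (2 * L * η) * (r / 2) := mul_le_mul_of_nonneg_right h.lip_radius (by positivity)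
        _ = L * η * r := by ring
    gcongr
  rw [(hasFDerivAt_lagrangian _ (h.regular_obj.differentiableAt _ hxd)
    (fun i => (h.regular_con i).differentiableAt _ hxd)).fderiv]
  simp only [_root_.sub_apply, _root_.sum_apply, _root_.smul_apply, smul_eq_mul]
  have hG' := (abs_le.1 (hG u)).2
  rw [h.fderiv_barrier, h.hess_barrier] at hG'
  have hf := (abs_le.1 ((h.regular_obj.abs_fderiv_taylor_le (h.segment_feasible hd) u).trans
    hMr)).2
  have hterm : ∀ i, -(μ / a i x * (1 - fderiv ℝ (a i) x d / a i x) * fderiv ℝ (a i) (x + d) u) ≤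
      -(μ * (fderiv ℝ (a i) x u / a i x)) - μ * (fderiv ℝ (fderiv ℝ (a i)) x d u / a i x -
        fderiv ℝ (a i) x d * fderiv ℝ (a i) x u / a i x ^ 2) +
        3 * (L * η * r * ‖u‖) * (μ / a i x) := by
    intro i
    have ha := h.feasible i
    have hy := h.dual_pos i
    have hs := hd.abs_scaled_le hη.le i
    set s := fderiv ℝ (a i) x d / a i x with hsdef
    have hG2 := ((h.regular_con i).abs_fderiv_taylor_le (h.segment_feasible hd) u).trans hMr
    have hH : |fderiv ℝ (fderiv ℝ (a i)) x d u| ≤ L * r * ‖u‖ := by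
      refine ((h.regular_con i).abs_hess_bilin_le h.feasible d u).trans ?_
      have := hd.norm_le
      gcongr
    set R := fderiv ℝ (a i) (x + d) u - fderiv ℝ (a i) x u - fderiv ℝ (fderiv ℝ (a i)) x d u
      with hR
    have b1 : -((1 - s) * R) ≤ 2 * (L * η * r * ‖u‖) := by
      refine (neg_le_abs _).trans ?_
      rw [abs_mul]
      have h2 : |1 - s| ≤ 2 := by rw [abs_le] at hs ⊢; constructor <;> linarith
      gcongr
    have b2 : s * fderiv ℝ (fderiv ℝ (a i)) x d u ≤ L * η * r * ‖u‖ := by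
      refine (le_abs_self _).trans ?_
      rw [abs_mul]
      calc |s| * |fderiv ℝ (fderiv ℝ (a i)) x d u| ≤ η * (L * r * ‖u‖) := by gcongr
        _ = L * η * r * ‖u‖ := by ring
    have hb := mul_le_mul_of_nonneg_left (add_le_add b1 b2) hy.le
    have e : μ / a i x * (-((1 - s) * R) + s * fderiv ℝ (fderiv ℝ (a i)) x d u) =
        -(μ / a i x * (1 - s) * fderiv ℝ (a i) (x + d) u) + μ * (fderiv ℝ (a i) x u / a i x) +
        μ * (fderiv ℝ (fderiv ℝ (a i)) x d u / a i x -
        fderiv ℝ (a i) x d * fderiv ℝ (a i) x u / a i x ^ 2) := by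
      rw [hR, hsdef]; field_simp; ring
    rw [e] at hb
    linarith
  have hsum := Finset.sum_le_sum fun i (_ : i ∈ Finset.univ) => hterm i
  rw [Finset.sum_add_distrib, Finset.sum_sub_distrib, Finset.sum_neg_distrib,
    Finset.sum_neg_distrib, ← Finset.mul_sum, ← Finset.mul_sum, ← Finset.mul_sum] at hsum
  have hN := h.sum_dual_nonneg
  have hp : 0 ≤ L * η * r * ‖u‖ := by positivity
  have hp' : 0 ≤ L * η * r * ‖u‖ * ∑ i, μ / a i x := by positivity
  linarith

theorem dual_ratio {d : E} (hd : IsSmallStep a η r x d) (i : ι) :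
    |a i x / a i (x + d) - 1| ≤ 11 / 10 * η := by
  have hz := h.abs_ratio_sub_one_le hd i
  have ha := h.feasible i
  have ha' := h.feasible_add hd i
  have hη := h.eta_pos
  have hη' := h.eta_le
  have e1 : a i (x + d) / a i x - 1 = (a i (x + d) - a i x) / a i x := by field_simp
  have e2 : a i x / a i (x + d) - 1 = (a i x - a i (x + d)) / a i (x + d) := by field_simp
  rw [e1, abs_div, abs_of_pos ha, div_le_iff₀ ha, abs_le] at hz
  have h1 : 101 / 100 * η * a i x ≤ 101 / 8000 * a i x := by gcongr; linarith
  have h2 : 11 / 10 * η * (78 / 80 * a i x) ≤ 11 / 10 * η * a i (x + d) := by gcongr; linarith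
  have h3 : 0 ≤ η * a i x := by positivity
  rw [e2, abs_div, abs_of_pos ha', div_le_iff₀ ha', abs_le]
  constructor <;> linarith

/-- The Hessian of `ψ` is a part `Q` from `∇²f` and `∇²aᵢ` plus a positive rank-one part `P`. Moving
to `x + d` changes `Q` additively by `O(η L N)` and shrinks `P` by at most the factor `1 - 4η`, up
to an error of the same order. -/
theorem hess_barrier_add_ge {d : E} (hd : IsSmallStep a η r x d)
    (hH : ∀ u, -(48 * η * L * (1 + ∑ i, μ / a i x)) * ‖u‖ ^ 2 ≤
      fderiv ℝ (fderiv ℝ (barrier f a μ)) x u u) (u : E) :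
    -(60 * η * L * (1 + ∑ i, μ / a i x)) * ‖u‖ ^ 2 ≤
      fderiv ℝ (fderiv ℝ (barrier f a μ)) (x + d) u u := by
  have hη := h.eta_pos
  have hη' := h.eta_le
  have hμ := h.mu_pos
  have hL := h.lip_pos
  have hr := h.radius_pos
  have hxd : x + d ∈ {x | ∀ i, 0 < a i x} := h.feasible_add hd
  have hN := h.sum_dual_nonneg
  set N := 1 + ∑ i, μ / a i x with hNdef
  have hMd : M * ‖d‖ * ‖u‖ ^ 2 ≤ 2 * L * η * ‖u‖ ^ 2 := by
    have : M * ‖d‖ ≤ 2 * L * η :=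
      (mul_le_mul_of_nonneg_left hd.norm_le h.lip_nonneg).trans h.lip_radius
    gcongr
  have hseg1 := h.segment_feasible hd
  have hterm : ∀ i, μ * (fderiv ℝ (fderiv ℝ (a i)) (x + d) u u / a i (x + d) -
      fderiv ℝ (a i) (x + d) u * fderiv ℝ (a i) (x + d) u / a i (x + d) ^ 2) ≤
      μ * (fderiv ℝ (fderiv ℝ (a i)) x u u / a i x) -
      (1 - 4 * η) * μ * (fderiv ℝ (a i) x u / a i x) ^ 2 +
      5 * L * η * ‖u‖ ^ 2 * (μ / a i x) := by
    intro i
    have ha := h.feasible i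
    have ha' := h.feasible_add hd i
    have hy := h.dual_pos i
    have hyN : μ / a i x ≤ N := by
      have := Finset.single_le_sum (f := fun i => μ / a i x) (fun i _ => (h.dual_pos i).le)
        (Finset.mem_univ i)
      linarith
    have hρ := h.dual_ratio hd i
    set ρ := a i x / a i (x + d) with hρdef
    have hρ1 := abs_le.1 hρ
    have hHp := (h.regular_con i).abs_hess_le _ hxd u
    have hHd := ((h.regular_con i).abs_hess_sub_le x d hseg1 u).trans hMd
    have hgd := (h.regular_con i).abs_fderiv_sub_le hseg1 u
    set A := fderiv ℝ (fderiv ℝ (a i)) (x + d) u u with hA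
    set A₀ := fderiv ℝ (fderiv ℝ (a i)) x u u with hA0
    set p := fderiv ℝ (a i) x u / a i x with hp
    set ε := (fderiv ℝ (a i) (x + d) u - fderiv ℝ (a i) x u) / a i x with hε
    have b1 : ρ * A ≤ A₀ + 4 * (L * η * ‖u‖ ^ 2) := by
      have h1 : (ρ - 1) * A ≤ 11 / 10 * η * (L * ‖u‖ ^ 2) := by
        refine (le_abs_self _).trans ?_
        rw [abs_mul]
        gcongr
      have h2 := (abs_le.1 hHd).2
      have : 0 ≤ L * η * ‖u‖ ^ 2 := by positivity
      linarith
    have hεb : μ * ε ^ 2 / η ≤ L * η * ‖u‖ ^ 2 * (μ / a i x) := by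
      have h1 : |ε| ≤ L * r * ‖u‖ / a i x := by
        rw [hε, abs_div, abs_of_pos ha]
        have := hd.norm_le
        have h2 : L * ‖d‖ * ‖u‖ ≤ L * r * ‖u‖ := by gcongr
        have := hgd.trans h2
        gcongr
      have h2 : ε ^ 2 ≤ (L * r * ‖u‖ / a i x) ^ 2 := by
        rw [← sq_abs]; gcongr
      rw [div_le_iff₀ hη]
      calc μ * ε ^ 2 ≤ μ * (L * r * ‖u‖ / a i x) ^ 2 := by gcongr
        _ = (L * (μ / a i x) * r ^ 2) * (L * ‖u‖ ^ 2 / a i x) := by field_simp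
        _ ≤ (L * N * r ^ 2) * (L * ‖u‖ ^ 2 / a i x) := by gcongr
        _ = 1 / 4 * (L * η * ‖u‖ ^ 2 * (μ / a i x) * η) := by rw [h.radius_sq]; ring
        _ ≤ L * η * ‖u‖ ^ 2 * (μ / a i x) * η := by
          have : 0 ≤ L * η * ‖u‖ ^ 2 * (μ / a i x) * η := by positivity
          linarith
    -- Young's inequality with weight `η` separates the old scaled gradient `p` from its change `ε`;
    -- by `hεb` the radius rule makes even `μ ε² / η` small.
    have b2 : (1 - 4 * η) * p ^ 2 - ε ^ 2 / η ≤ (ρ * (p + ε)) ^ 2 := by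
      have h1 : (1 - η) * p ^ 2 - ε ^ 2 / η ≤ (p + ε) ^ 2 := by
        have e : (p + ε) ^ 2 - ((1 - η) * p ^ 2 - ε ^ 2 / η) = (η * p + ε) ^ 2 / η + ε ^ 2 := by
          field_simp; ring
        have : 0 ≤ (η * p + ε) ^ 2 / η + ε ^ 2 := by positivity
        linarith
      have h2 : 1 - 22 / 10 * η ≤ ρ ^ 2 := by nlinarith
      have h3 : (1 - 22 / 10 * η) * ((1 - η) * p ^ 2 - ε ^ 2 / η) ≤ ρ ^ 2 * (p + ε) ^ 2 :=
        (mul_le_mul_of_nonneg_left h1 (by linarith)).trans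
          (mul_le_mul_of_nonneg_right h2 (sq_nonneg _))
      have h4 : 0 ≤ η * (ε ^ 2 / η) := by positivity
      have h5 : 0 ≤ η * p ^ 2 := by positivity
      have h6 : 0 ≤ η * (η * p ^ 2) := by positivity
      rw [mul_pow]
      linarith
    have e : μ * (A / a i (x + d) - fderiv ℝ (a i) (x + d) u * fderiv ℝ (a i) (x + d) u /
        a i (x + d) ^ 2) = μ / a i x * (ρ * A) - μ * (ρ * (p + ε)) ^ 2 := by
      rw [hρdef, hp, hε]; field_simp; ring
    rw [e]
    have k1 := mul_le_mul_of_nonneg_left b1 hy.le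
    have k2 := mul_le_mul_of_nonneg_left b2 hμ.le
    have e3 : μ * (A₀ / a i x) = μ / a i x * A₀ := by ring
    have e4 : μ * (ε ^ 2 / η) = μ * ε ^ 2 / η := by ring
    rw [mul_sub, e4] at k2
    rw [e3]
    linarith
  have hsum := Finset.sum_le_sum fun i (_ : i ∈ Finset.univ) => hterm i
  rw [Finset.sum_add_distrib, Finset.sum_sub_distrib, ← Finset.mul_sum, ← Finset.mul_sum,
    ← Finset.mul_sum, ← Finset.mul_sum] at hsum
  rw [fderiv_fderiv_barrier_apply μ h.regular_obj h.regular_con (fun _ hx => hx) hxd]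
  have hHu := hH u
  rw [h.hess_barrier] at hHu
  have e5 : ∀ i, fderiv ℝ (a i) x u * fderiv ℝ (a i) x u / a i x ^ 2 =
    (fderiv ℝ (a i) x u / a i x) ^ 2 := fun i => by ring
  simp only [e5, Finset.sum_sub_distrib] at hHu
  have hfd := (abs_le.1 ((h.regular_obj.abs_hess_sub_le x d hseg1 u).trans hMd)).1
  have hf0 := (abs_le.1 (h.regular_obj.abs_hess_le x h.feasible u)).1
  have hQ : ∑ i, fderiv ℝ (fderiv ℝ (a i)) x u u / a i x ≤ ∑ i, L * ‖u‖ ^ 2 / a i x :=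
    Finset.sum_le_sum fun i _ => by
      have := h.feasible i
      gcongr
      exact (abs_le.1 ((h.regular_con i).abs_hess_le x h.feasible u)).2
  have hQ' : μ * ∑ i, L * ‖u‖ ^ 2 / a i x = L * ‖u‖ ^ 2 * ∑ i, μ / a i x := by
    rw [Finset.mul_sum, Finset.mul_sum]
    exact Finset.sum_congr rfl fun i _ => by ring
  have hQ2 := mul_le_mul_of_nonneg_left hQ hμ.le
  rw [hQ'] at hQ2
  set Q := fderiv ℝ (fderiv ℝ f) x u u - μ * ∑ i, fderiv ℝ (fderiv ℝ (a i)) x u u / a i x with hQd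
  set P := μ * ∑ i, (fderiv ℝ (a i) x u / a i x) ^ 2 with hP
  set W := L * N * ‖u‖ ^ 2 with hW
  have hW0 : 0 ≤ W := by positivity
  have q1 : -W ≤ Q := by rw [hW, hNdef, hQd]; linarith
  have q2 : -(48 * η * W) ≤ Q + P := by rw [hW, hQd, hP]; linarith
  -- `P` has no upper bound, so `Q + (1 - 4η) P` is written as `(1 - 4η)(Q + P) + 4η Q`, where both
  -- summands are bounded below.
  have q3 : (1 - 4 * η) * -(48 * η * W) ≤ (1 - 4 * η) * (Q + P) :=
    mul_le_mul_of_nonneg_left q2 (by linarith)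
  have q4 : 4 * η * -W ≤ 4 * η * Q := by gcongr
  have q5 : 0 ≤ η * (η * W) := by positivity
  have q6 : L * η * ‖u‖ ^ 2 * ∑ i, μ / a i x = η * W - L * η * ‖u‖ ^ 2 := by
    rw [hW, hNdef]; ring
  have q7 : 0 ≤ L * η * ‖u‖ ^ 2 := by positivity
  have q8 : 0 ≤ η * W := by positivity
  have e6 : (1 - 4 * η) * μ * ∑ i, (fderiv ℝ (a i) x u / a i x) ^ 2 = (1 - 4 * η) * P := by
    rw [hP]; ring
  rw [e6] at hsum
  have e7 : -(60 * η * L * N) * ‖u‖ ^ 2 = -(60 * η * W) := by rw [hW]; ring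
  rw [e7]
  linarith

/-- `hτ1`, `hτ2` and `hσ` express the thresholds of the test through `η`. The complementarity and
stationarity defects are of order `η²`, the curvature defect of order `η`, all with constants below
those thresholds. -/
theorem ipmStop_of_small [CompleteSpace E] {τ σ : ℝ} (hτ1 : Real.sqrt (τ ^ 2 * μ / L) = 1600 * η ^ 2)
    (hτ2 : τ * μ = 1600 * η ^ 2 * Real.sqrt (L * μ)) (hσ : 1600 * η * L ≤ σ * Real.sqrt τ)
    {d : E} (hd : IsSmallStep a η r x d)
    (hG : ∀ u, |fderiv ℝ (barrier f a μ) x u + fderiv ℝ (fderiv ℝ (barrier f a μ)) x d u| ≤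
      48 * η * L * (1 + ∑ i, μ / a i x) * r * ‖u‖)
    (hH : ∀ u, -(48 * η * L * (1 + ∑ i, μ / a i x)) * ‖u‖ ^ 2 ≤
      fderiv ℝ (fderiv ℝ (barrier f a μ)) x u u) :
    IpmStop f a μ τ L σ (x + d) fun i => μ / a i x * (1 - fderiv ℝ (a i) x d / a i x) := by
  have hη := h.eta_pos
  have hη' := h.eta_le
  have hμ := h.mu_pos
  have hL := h.lip_pos
  have hr := h.radius_pos
  have hs := fun i => hd.abs_scaled_le hη.le i
  have hN := h.sum_dual_nonneg
  have hypos : ∀ i, 0 < μ / a i x * (1 - fderiv ℝ (a i) x d / a i x) := fun i =>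
    mul_pos (h.dual_pos i) (by have := (abs_le.1 (hs i)).2; linarith)
  -- The test is scaled by the new multipliers, the estimates by the old ones; the two differ by at
  -- most a factor of two.
  have hnorm : (1 + ∑ i, μ / a i x) / 2 ≤
      1 + norm1 fun i => μ / a i x * (1 - fderiv ℝ (a i) x d / a i x) := by
    have : 1 / 2 * ∑ i, μ / a i x ≤
        norm1 fun i => μ / a i x * (1 - fderiv ℝ (a i) x d / a i x) := by
      rw [norm1, Finset.mul_sum]
      refine Finset.sum_le_sum fun i _ => ?_
      rw [abs_of_pos (hypos i), mul_comm]
      have := h.dual_pos i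
      gcongr
      have := (abs_le.1 (hs i)).2
      linarith
    linarith
  refine ⟨⟨h.feasible_add hd, hypos, fun i => ?_, ?_⟩, fun u => ?_⟩
  · rw [hτ1]
    have hq := h.abs_ratio_sub_le hd i
    have he := h.slack_error_le i
    have ha := h.feasible i
    have hi := hs i
    set s := fderiv ℝ (a i) x d / a i x with hsd
    set z := a i (x + d) / a i x - 1 with hz
    -- The first order changes of slack and multiplier cancel in the product, so only second order
    -- terms remain.
    have e : μ / a i x * (1 - s) * a i (x + d) - μ = μ * ((1 - s) * (z - s) - s ^ 2) := by
      rw [hz]; field_simp; ring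
    rw [e, abs_mul, abs_of_pos hμ]
    have b : |(1 - s) * (z - s) - s ^ 2| ≤ 800 * η ^ 2 := by
      refine (abs_sub _ _).trans ?_
      rw [abs_mul, abs_pow]
      have h1 : |1 - s| ≤ 2 := by rw [abs_le] at hi ⊢; constructor <;> linarith
      have h2 : |1 - s| * |z - s| ≤ 2 * (η ^ 2 / 8) := by
        have := hq.trans he
        gcongr
      have h3 : |s| ^ 2 ≤ η ^ 2 := by gcongr
      have := sq_nonneg η
      linarith
    calc μ * |(1 - s) * (z - s) - s ^ 2| ≤ μ * (800 * η ^ 2) := by gcongr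
      _ = 1600 * η ^ 2 * μ / 2 := by ring
  · refine norm_gradient_le (by rw [hτ2]; positivity) fun u =>
      (h.fderiv_lagrangian_add_le hd hG u).trans ?_
    refine mul_le_mul_of_nonneg_right ?_ (norm_nonneg u)
    rw [hτ2, mul_assoc (1600 * η ^ 2), ← Real.sqrt_mul (mul_pos hL hμ).le]
    set Nn := 1 + ∑ i, μ / a i x with hNn
    have hR : L * μ * (Nn / 2) ≤ L * μ *
        (norm1 (fun i => μ / a i x * (1 - fderiv ℝ (a i) x d / a i x)) + 1) := by
      gcongr
      linarith
    have h1 : L * Nn * r ≤ η * Real.sqrt (L * μ *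
        (norm1 (fun i => μ / a i x * (1 - fderiv ℝ (a i) x d / a i x)) + 1)) := by
      have e : L * Nn * r = Real.sqrt ((L * Nn * r) ^ 2) := (Real.sqrt_sq (by positivity)).symm
      have e' : η = Real.sqrt (η ^ 2) := (Real.sqrt_sq hη.le).symm
      rw [e, e', ← Real.sqrt_mul (sq_nonneg _)]
      refine Real.sqrt_le_sqrt ?_
      calc (L * Nn * r) ^ 2 = L * Nn * (L * Nn * r ^ 2) := by ring
        _ = η ^ 2 * (L * μ * (Nn / 2)) / 2 := by rw [h.radius_sq]; ring
        _ ≤ η ^ 2 * (L * μ * (Nn / 2)) := half_le_self (by positivity)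
        _ ≤ _ := mul_le_mul_of_nonneg_left hR (sq_nonneg η)
    calc 60 * η * L * Nn * r = 60 * η * (L * Nn * r) := by ring
      _ ≤ 60 * η * (η * Real.sqrt (L * μ *
        (norm1 (fun i => μ / a i x * (1 - fderiv ℝ (a i) x d / a i x)) + 1))) := by gcongr
      _ = 60 * (η ^ 2 * Real.sqrt (L * μ *
        (norm1 (fun i => μ / a i x * (1 - fderiv ℝ (a i) x d / a i x)) + 1))) := by ring
      _ ≤ 1600 * (η ^ 2 * Real.sqrt (L * μ *
        (norm1 (fun i => μ / a i x * (1 - fderiv ℝ (a i) x d / a i x)) + 1))) := by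
        gcongr; norm_num
      _ = _ := by ring
  · refine le_trans ?_ (h.hess_barrier_add_ge hd hH u)
    rw [neg_mul, neg_mul, neg_le_neg_iff]
    refine mul_le_mul_of_nonneg_right ?_ (sq_nonneg _)
    calc 60 * η * L * (1 + ∑ i, μ / a i x)
        ≤ 800 * η * L * (1 + ∑ i, μ / a i x) := by gcongr; norm_num
      _ = 1600 * η * L * ((1 + ∑ i, μ / a i x) / 2) := by ring
      _ ≤ _ := mul_le_mul hσ hnorm (by positivity) (le_trans (by positivity) hσ)

/-- One iteration from a strictly feasible point leads to a strictly feasible point, and either the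
termination test succeeds there or the barrier function decreases by `μ η³`. -/
theorem stop_or_decrease [CompleteSpace E] {τ σ ηx : ℝ} (hτ1 : Real.sqrt (τ ^ 2 * μ / L) = 1600 * η ^ 2)
    (hτ2 : τ * μ = 1600 * η ^ 2 * Real.sqrt (L * μ)) (hσ : 1600 * η * L ≤ σ * Real.sqrt τ)
    (hr : ηx * Real.sqrt (μ / (L * (1 + norm1 fun i => μ / a i x))) = r) {x' : E} {y' : ι → ℝ}
    (hit : IpmIteration f a μ L η ηx x x' y') :
    (∀ i, 0 < a i x') ∧
      (IpmStop f a μ τ L σ x' y' ∨ barrier f a μ x' ≤ barrier f a μ x - μ * η ^ 3) := by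
  obtain ⟨d, hd, rfl, rfl⟩ := hit
  rw [hr] at hd
  have hη := h.eta_pos
  have hμ := h.mu_pos
  have hrp := h.radius_pos
  set κ := scaledSlackNorm a x d with hκ
  have hκ2 : κ ^ 2 = ∑ i, (fderiv ℝ (a i) x d / a i x) ^ 2 :=
    Real.sq_sqrt (Finset.sum_nonneg fun i _ => sq_nonneg _)
  have hκ0 : 0 ≤ κ := Real.sqrt_nonneg _
  rcases le_or_gt κ η with hle | hlt
  · have hα : stepSize η a x d = 1 := if_pos hle
    have hsm : IsSmallStep a η r x d := ⟨hd.1, by rw [← hκ2]; gcongr⟩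
    simp only [hα, one_smul]
    refine ⟨h.feasible_add hsm, ?_⟩
    have hy : (fun i => μ / a i x + 1 * -(μ * fderiv ℝ (a i) x d / a i x ^ 2)) =
        fun i => μ / a i x * (1 - fderiv ℝ (a i) x d / a i x) := by
      funext i
      have := (h.feasible i).ne'
      field_simp
      ring
    rw [hy]
    rcases le_or_gt (model (barrier f a μ) x d) (-(6 * μ * η ^ 3)) with hm | hm
    · right
      have := h.barrier_add_le hsm
      linarith
    · left
      -- The radius rule converts the model threshold into `24 η L N r²`; doubling and dividing by
      -- `r` or `r²` gives the constant `48`.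
      have e : 6 * μ * η ^ 3 = 24 * η * (L * (1 + ∑ i, μ / a i x) * r ^ 2) := by
        rw [h.radius_sq]; ring
      refine h.ipmStop_of_small hτ1 hτ2 hσ hsm (fun u => ?_) (fun u => ?_)
      · refine (hd.abs_residual_le h.hess_barrier_symm hrp u).trans ?_
        refine mul_le_mul_of_nonneg_right ?_ (norm_nonneg u)
        rw [div_le_iff₀ hrp]
        linarith
      · refine le_trans ?_ (hd.hess_ge hrp u)
        refine mul_le_mul_of_nonneg_right (neg_le_neg ?_) (sq_nonneg _)
        rw [div_le_iff₀ (by positivity)]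
        linarith
  · have hα : stepSize η a x d = η / κ := if_neg (not_le.2 hlt)
    have hκp : 0 < κ := hη.trans hlt
    have hα1 : η / κ ≤ 1 := (div_le_one hκp).2 hlt.le
    have hsm : IsSmallStep a η r x ((η / κ) • d) := by
      refine ⟨?_, ?_⟩
      · rw [norm_smul, Real.norm_of_nonneg (by positivity)]
        exact (mul_le_of_le_one_left (norm_nonneg d) hα1).trans hd.1
      · simp only [map_smul, smul_eq_mul, mul_div_assoc, mul_pow]
        rw [← Finset.mul_sum, ← hκ2]
        refine le_of_eq ?_
        field_simp
    simp only [hα]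
    refine ⟨h.feasible_add hsm, Or.inr ?_⟩
    have h1 := h.barrier_add_le hsm
    have h2 := h.model_smul_le hd hκ2 hlt
    linarith

end IsStepSetting

end Step

/-! ### The prescribed parameters -/

section Parameters

theorem etaS_pos {μ τ L : ℝ} (hμ : 0 < μ) (hτ : 0 < τ) (hL : 0 < L) : 0 < etaS μ τ L := by
  unfold etaS; positivity

theorem rpow_quarter_pow_four {X : ℝ} (hX : 0 ≤ X) : (X ^ (1 / 4 : ℝ)) ^ 4 = X := by
  rw [← Real.rpow_natCast, ← Real.rpow_mul hX]
  norm_num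

/-- Here `1600² = 40⁴`, so the square root of the right side, which is `τc`, equals `1600 η²`. -/
theorem etaS_pow_four {μ τ L : ℝ} (hμ : 0 < μ) (hτ : 0 < τ) (hL : 0 < L) :
    1600 ^ 2 * etaS μ τ L ^ 4 = τ ^ 2 * μ / L := by
  rw [etaS, mul_pow, rpow_quarter_pow_four (by positivity)]
  ring

/-- A lower bound of the parameter `ηs` in terms of the reciprocal of its argument. -/
theorem one_le_mul_etaS_cube {μ τ L c Y : ℝ} (hc : 1 ≤ c) (hY : 0 < Y)
    (h : 1 ≤ c * Y * (τ ^ 2 * μ / L)) :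
    1 ≤ 64000 * c * Y ^ (3 / 4 : ℝ) * etaS μ τ L ^ 3 := by
  have hc0 : 0 < c := by linarith
  have hX : 0 ≤ τ ^ 2 * μ / L := by
    by_contra! hneg
    nlinarith [mul_pos hc0 hY]
  have e1 : etaS μ τ L ^ 3 = 1 / 64000 * (τ ^ 2 * μ / L) ^ (3 / 4 : ℝ) := by
    rw [etaS, mul_pow, ← Real.rpow_natCast ((τ ^ 2 * μ / L) ^ (1 / 4 : ℝ)), ← Real.rpow_mul hX]
    norm_num
  have h1 : 1 ≤ (c * Y * (τ ^ 2 * μ / L)) ^ (3 / 4 : ℝ) := Real.one_le_rpow h (by norm_num)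
  rw [Real.mul_rpow (by positivity) hX, Real.mul_rpow hc0.le hY.le] at h1
  have h2 : c ^ (3 / 4 : ℝ) ≤ c := by
    simpa using Real.rpow_le_rpow_of_exponent_le hc (by norm_num : (3 / 4 : ℝ) ≤ 1)
  calc 1 ≤ c ^ (3 / 4 : ℝ) * Y ^ (3 / 4 : ℝ) * (τ ^ 2 * μ / L) ^ (3 / 4 : ℝ) := h1
    _ ≤ c * Y ^ (3 / 4 : ℝ) * (τ ^ 2 * μ / L) ^ (3 / 4 : ℝ) := by gcongr
    _ = _ := by rw [e1]; ring

variable {E : Type*} [NormedAddCommGroup E] [InnerProductSpace ℝ E] [CompleteSpace E]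
variable {ι : Type*} [Fintype ι]

/-- One iteration of the trust region IPM with the prescribed parameters. -/
theorem ipmIteration_stop_or_decrease {f : E → ℝ} {a : ι → E → ℝ} {μ τ L M σ : ℝ}
    (hf : IsRegularOn f {x | ∀ i, 0 < a i x} L M)
    (ha : ∀ i, IsRegularOn (a i) {x | ∀ i, 0 < a i x} L M) (hcont : ∀ i, Continuous (a i))
    (hμ : 0 < μ) (hτ : 0 < τ) (hL : 0 < L) (hM : 0 ≤ M) (hη : τ ^ 2 * μ / L ≤ 1 / 16)
    (hML : M ^ 2 * μ ≤ 16 * L ^ 3) (hσ : 40 * (L ^ 3 * μ) ^ (1 / 4 : ℝ) ≤ σ)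
    {x x' : E} {y' : ι → ℝ} (hx : ∀ i, 0 < a i x)
    (hit : IpmIteration f a μ L (etaS μ τ L) (etaX μ τ L) x x' y') :
    (∀ i, 0 < a i x') ∧ (IpmStop f a μ τ L σ x' y' ∨
      barrier f a μ x' ≤ barrier f a μ x - μ * etaS μ τ L ^ 3) := by
  have hηpos := etaS_pos hμ hτ hL
  have hη4 := etaS_pow_four hμ hτ hL
  set η := etaS μ τ L with hηdef
  have hnorm : norm1 (fun i => μ / a i x) = ∑ i, μ / a i x :=
    Finset.sum_congr rfl fun i _ => abs_of_pos (div_pos hμ (hx i))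
  have hN : 0 ≤ ∑ i, μ / a i x := Finset.sum_nonneg fun i _ => (div_pos hμ (hx i)).le
  -- The hypothesis `1/16` is exactly what is needed, because `16 * 1600² = 80⁴`.
  have hηle : η ≤ 1 / 80 := by
    refine le_of_pow_le_pow_left₀ (n := 4) (by norm_num) (by norm_num) ?_
    norm_num
    linarith
  set r := etaX μ τ L * Real.sqrt (μ / (L * (1 + norm1 fun i => μ / a i x))) with hr
  have hrsq : L * (1 + ∑ i, μ / a i x) * r ^ 2 = η ^ 2 * μ / 4 := by
    rw [hr, mul_pow, hnorm, Real.sq_sqrt (by positivity), etaX, ← hηdef]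
    field_simp
    norm_num
  have hrpos : 0 < r := by
    rw [hr, hnorm, etaX, ← hηdef]
    positivity
  have hset : IsStepSetting f a μ L M η r x := by
    refine ⟨hf, ha, hcont, hμ, hL, hM, hηpos, hηle, hrpos, hrsq, ?_, hx⟩
    refine le_of_sq_le_sq ?_ (by positivity)
    have h1 : L * r ^ 2 ≤ η ^ 2 * μ / 4 := by
      rw [← hrsq]
      have : 0 ≤ L * r ^ 2 * ∑ i, μ / a i x := by positivity
      linarith
    have h2 : L * (M * r) ^ 2 ≤ L * (2 * L * η) ^ 2 := by
      calc L * (M * r) ^ 2 = M ^ 2 * (L * r ^ 2) := by ring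
        _ ≤ M ^ 2 * (η ^ 2 * μ / 4) := by gcongr
        _ = η ^ 2 / 4 * (M ^ 2 * μ) := by ring
        _ ≤ η ^ 2 / 4 * (16 * L ^ 3) := by gcongr
        _ = L * (2 * L * η) ^ 2 := by ring
    exact le_of_mul_le_mul_left h2 hL
  refine hset.stop_or_decrease ?_ ?_ ?_ hr.symm hit
  · rw [← hη4, show (1600 : ℝ) ^ 2 * η ^ 4 = (1600 * η ^ 2) ^ 2 by ring]
    exact Real.sqrt_sq (by positivity)
  · refine (sq_eq_sq₀ (by positivity) (by positivity)).1 ?_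
    rw [mul_pow _ (Real.sqrt _), Real.sq_sqrt (by positivity),
      show (1600 * η ^ 2) ^ 2 = 1600 ^ 2 * η ^ 4 by ring, hη4]
    field_simp
  -- The lower bound on `σ` is exactly the needed one: `1600 η L` equals `40 (L³ μ)^(1/4) √τ`, as
  -- fourth powers show.
  · refine le_trans (le_of_eq ?_) (mul_le_mul_of_nonneg_right hσ (Real.sqrt_nonneg τ))
    refine (pow_left_inj₀ (by positivity) (by positivity) (n := 4) (by norm_num)).1 ?_
    rw [mul_pow, mul_pow, mul_pow, mul_pow 40, rpow_quarter_pow_four (by positivity),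
      show Real.sqrt τ ^ 4 = (Real.sqrt τ ^ 2) ^ 2 by ring, Real.sq_sqrt hτ.le]
    have e : (1600 : ℝ) ^ 4 * η ^ 4 * L ^ 4 = 1600 ^ 2 * (1600 ^ 2 * η ^ 4) * L ^ 4 := by ring
    rw [e, hη4]
    field_simp
    norm_num

theorem exists_ipmIteration [FiniteDimensional ℝ E] (f : E → ℝ) (a : ι → E → ℝ)
    {μ τ L : ℝ} (hμ : 0 < μ) (hτ : 0 < τ) (hL : 0 < L) (x : E) :
    ∃ x' y', IpmIteration f a μ L (etaS μ τ L) (etaX μ τ L) x x' y' := by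
  have hr : 0 ≤ etaX μ τ L * Real.sqrt (μ / (L * (1 + norm1 fun i => μ / a i x))) := by
    have := etaS_pos hμ hτ hL
    unfold etaX
    positivity
  obtain ⟨d, hd⟩ := exists_isTrustRegionSolution (barrier f a μ) x hr
  exact ⟨_, _, d, hd, rfl, rfl⟩

end Parameters

/-! ### Admissible data and the two barrier problems -/

namespace Input

variable {n m : ℕ}

/-- The standing assumptions on the data of a call of the two-phase method. -/
structure IsAdmissible (D : Input n m) (L₂ c Δf Δa : ℝ) : Prop where
  constraints_pos : 0 < m
  continuous_con : ∀ i, Continuous (D.a i)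
  lip₂_pos : 0 < L₂
  con_one : ∀ i, HasLipschitzDerivOn 1 D.L₁ (D.a i) D.X1
  con_two : ∀ i, HasLipschitzDerivOn 2 L₂ (D.a i) D.X1
  obj_one : HasLipschitzDerivOn 1 D.L₁ D.f D.X2
  obj_two : HasLipschitzDerivOn 2 L₂ D.f D.X2
  obj_lip : ∀ x z, |D.f x - D.f z| ≤ D.L₀ * ‖x - z‖
  con_le : ∀ x ∈ D.X1, ∀ i, D.a i x ≤ c
  obj_gap : ∀ x ∈ D.X2, ∀ z ∈ D.X2, D.f x - D.f z ≤ Δf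
  violation_le : D.violation D.x₀ ≤ Δa
  one_le_c : 1 ≤ c
  one_le_Δa : 1 ≤ Δa
  one_le_Δf : 1 ≤ Δf
  one_le_L₁ : 1 ≤ D.L₁
  one_le_L₀ : 1 ≤ D.L₀
  εopt_pos : 0 < D.εopt
  εopt_le : D.εopt ≤ 1 / (m * logPlus (c / D.εopt))
  εinf_pos : 0 < D.εinf
  εinf_le : D.εinf ≤ D.L₀ / m
  εinf_le_one : D.εinf ≤ 1
  εopt_le_sqrt : D.εopt ≤ Real.sqrt D.εinf
  lip₂_small : L₂ ^ 2 * D.εopt ≤ 4 * D.L₁ ^ 3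
  σ_large : 40 * (D.L₁ ^ 3 * D.εopt) ^ (1 / 4 : ℝ) ≤ D.σ

theorem neg_le_violation (D : Input n m) (x : EuclideanSpace ℝ (Fin n)) (i : Fin m) :
    -(D.a i x) ≤ D.violation x :=
  (le_max_left _ _).trans (le_ciSup (f := fun i => max (-(D.a i x)) 0)
    (Set.finite_range _).bddAbove i)

theorem violation_nonneg (D : Input n m) (x : EuclideanSpace ℝ (Fin n)) : 0 ≤ D.violation x :=
  Real.iSup_nonneg fun _ => le_max_right _ _

/-- Since `t₀ ≥ εopt / 2`, points feasible for phase two lie where the constraints are assumed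
regular. -/
theorem feasible2_con {D : Input n m} {x : EuclideanSpace ℝ (Fin n)} (hx : ∀ i, 0 < D.a2 i x) :
    ∀ i, -(D.εopt / 2 + D.t₀) < D.a i x := fun i => by
  have : 0 < D.a i x + D.εopt := hx i
  have h2 := D.violation_nonneg D.x₀
  rw [t₀]
  linarith

theorem a1_inl_eq (D : Input n m) (i : Fin m) : D.a1 (.inl i) = fun z =>
    D.a i (WithLp.fstL 2 ℝ (EuclideanSpace ℝ (Fin n)) ℝ z) +
      WithLp.sndL 2 ℝ (EuclideanSpace ℝ (Fin n)) ℝ z + 0 := by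
  funext z
  simp [a1]

/-- This is what the upper bound on `t` in the phase-one problem is for: without it the iterates
could leave the set on which the constraints are regular. -/
theorem feasible1_con {D : Input n m} {z : Point1 n} (hz : ∀ j, 0 < D.a1 j z) :
    ∀ i, -(D.εopt / 2 + D.t₀) < D.a i z.fst := fun i => by
  have h1 : 0 < D.a i z.fst + z.snd := hz (.inl i)
  have h2 : 0 < D.εopt / 2 + D.t₀ - z.snd := hz (.inr 1)
  linarith

namespace IsAdmissible

variable {D : Input n m} {L₂ c Δf Δa : ℝ} (h : D.IsAdmissible L₂ c Δf Δa)
include h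

theorem one_le_m : (1 : ℝ) ≤ m := by exact_mod_cast h.constraints_pos

theorem m_logPlus_mul_le : m * logPlus (c / D.εopt) * D.εopt ≤ 1 := by
  have hl : 0 < m * logPlus (c / D.εopt) :=
    mul_pos (by have := h.one_le_m; linarith) (lt_of_lt_of_le one_pos (le_max_right _ _))
  rw [← le_div_iff₀' hl]
  exact h.εopt_le

theorem m_mul_εopt_le : m * D.εopt ≤ 1 := by
  have h1 := h.m_logPlus_mul_le
  have h2 : (1 : ℝ) ≤ logPlus (c / D.εopt) := le_max_right _ _
  have h3 := h.one_le_m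
  have h4 := h.εopt_pos
  have h5 : 0 ≤ m * D.εopt := by positivity
  nlinarith

theorem εopt_le_one : D.εopt ≤ 1 := by
  have h1 := h.m_mul_εopt_le
  have h3 := h.one_le_m
  have h4 := h.εopt_pos
  nlinarith

theorem L₁_pos : 0 < D.L₁ := one_pos.trans_le h.one_le_L₁
theorem L₀_pos : 0 < D.L₀ := one_pos.trans_le h.one_le_L₀

theorem μ1_pos : 0 < D.μ1 := by
  have := h.εopt_pos; have := h.εinf_pos; unfold μ1; positivity

theorem μ2_pos : 0 < D.μ2 := by
  have := h.εopt_pos; unfold μ2; positivity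

theorem τ1_pos : 0 < D.τ1 := by
  have := h.εopt_pos
  have := h.εinf_pos
  have := h.L₁_pos
  exact lt_min (by positivity) (by positivity)

theorem τ2_pos : 0 < D.τ2 := by
  have := h.εinf_pos
  have := h.L₀_pos
  unfold τ2; positivity

theorem μ1_le : D.μ1 ≤ D.εopt / 4 := by
  have := h.εopt_pos
  have := h.εinf_le_one
  unfold μ1
  nlinarith

theorem τ1_sq_mul_le : D.τ1 ^ 2 * D.μ1 / D.L₁ ≤ 1 / 24 := by
  have ho := h.εopt_pos
  have hi := h.εinf_pos
  have hL := h.L₁_pos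
  have h1 : D.τ1 ^ 2 ≤ D.L₁ / (2 * D.εopt * D.εinf) := by
    have : D.τ1 ≤ Real.sqrt (D.L₁ / (2 * D.εopt * D.εinf)) := min_le_right _ _
    calc D.τ1 ^ 2 ≤ Real.sqrt (D.L₁ / (2 * D.εopt * D.εinf)) ^ 2 := by
          have := h.τ1_pos.le; gcongr
      _ = _ := Real.sq_sqrt (by positivity)
  calc D.τ1 ^ 2 * D.μ1 / D.L₁ ≤ D.L₁ / (2 * D.εopt * D.εinf) * D.μ1 / D.L₁ := by
        have := h.μ1_pos; gcongr
    _ = 1 / 24 := by unfold μ1; field_simp; norm_num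

theorem τ2_sq : D.τ2 ^ 2 = D.εinf / (2 * (D.L₀ + 1)) := by
  have := h.εinf_pos
  have := h.L₀_pos
  exact Real.sq_sqrt (by positivity)

theorem τ2_sq_mul_eq : D.τ2 ^ 2 * D.μ2 / D.L₁ = D.εinf * D.εopt / (8 * (D.L₀ + 1) * D.L₁) := by
  rw [h.τ2_sq, μ2]
  have := h.L₀_pos
  have := h.L₁_pos
  field_simp
  ring

theorem τ2_sq_mul_le : D.τ2 ^ 2 * D.μ2 / D.L₁ ≤ 1 / 16 := by
  have ho := h.εopt_pos
  have hi := h.εinf_pos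
  have hL := h.one_le_L₁
  have hL0 := h.one_le_L₀
  rw [h.τ2_sq_mul_eq, div_le_div_iff₀ (by positivity) (by positivity)]
  have h1 : D.εinf * D.εopt ≤ 1 := mul_le_one₀ h.εinf_le_one ho.le h.εopt_le_one
  have h2 : 1 * 1 ≤ D.L₀ * D.L₁ := by gcongr
  linarith

theorem lip_small {μ : ℝ} (hμ : μ ≤ D.εopt / 4) : (4 * L₂) ^ 2 * μ ≤ 16 * D.L₁ ^ 3 := by
  have h1 := h.lip₂_small
  have : (4 * L₂) ^ 2 * μ ≤ (4 * L₂) ^ 2 * (D.εopt / 4) := by gcongr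
  linarith

theorem σ_large_of_le {μ : ℝ} (hμ0 : 0 < μ) (hμ : μ ≤ D.εopt / 4) :
    40 * (D.L₁ ^ 3 * μ) ^ (1 / 4 : ℝ) ≤ D.σ := by
  have := h.εopt_pos
  have := h.L₁_pos
  refine le_trans ?_ h.σ_large
  gcongr
  linarith

theorem regular_con : ∀ i, IsRegularOn (D.a i) {x | ∀ i, -(D.εopt / 2 + D.t₀) < D.a i x}
    D.L₁ (4 * L₂) := by
  have hU : IsOpen {x | ∀ i, -(D.εopt / 2 + D.t₀) < D.a i x} := by
    simp only [ofPred_forall]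
    exact isOpen_iInter_of_finite fun i => isOpen_lt continuous_const (h.continuous_con i)
  exact fun i => isRegularOn_of_hasLipschitzDerivOn hU
    ((h.con_one i).mono fun x hx j => (hx j).le) ((h.con_two i).mono fun x hx j => (hx j).le)
    h.lip₂_pos.le

theorem isOpen_feasible2 : IsOpen {x | ∀ i, 0 < D.a2 i x} := by
  simp only [ofPred_forall]
  exact isOpen_iInter_of_finite fun i => isOpen_lt continuous_const
    ((h.continuous_con i).add continuous_const)

theorem regular_obj2 : IsRegularOn D.f {x | ∀ i, 0 < D.a2 i x} D.L₁ (4 * L₂) := by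
  have hsub : {x | ∀ i, 0 < D.a2 i x} ⊆ D.X2 := fun x hx j => by
    have : 0 < D.a j x + D.εopt := hx j
    linarith
  exact isRegularOn_of_hasLipschitzDerivOn h.isOpen_feasible2 (h.obj_one.mono hsub)
    (h.obj_two.mono hsub) h.lip₂_pos.le

theorem regular_con2 (i : Fin m) : IsRegularOn (D.a2 i) {x | ∀ i, 0 < D.a2 i x} D.L₁ (4 * L₂) := by
  have := (h.regular_con i).comp_add h.L₁_pos.le (by have := h.lip₂_pos; positivity)
    (ContinuousLinearMap.id ℝ (EuclideanSpace ℝ (Fin n))) (fun z => le_rfl) 0 D.εopt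
    h.isOpen_feasible2 (fun z hz => feasible2_con hz)
  have e : D.a2 i = fun z => D.a i (ContinuousLinearMap.id ℝ (EuclideanSpace ℝ (Fin n)) z) +
      (0 : EuclideanSpace ℝ (Fin n) →L[ℝ] ℝ) z + D.εopt := by
    funext z; simp [a2]
  rw [e]
  exact this

theorem continuous_a1 (j : Fin m ⊕ Fin 2) : Continuous (D.a1 j) := by
  rcases j with i | j
  · rw [D.a1_inl_eq]
    exact (((h.continuous_con i).comp (ContinuousLinearMap.continuous _)).add
      (ContinuousLinearMap.continuous _)).add continuous_const
  · fin_cases j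
    · exact (WithLp.sndL 2 ℝ (EuclideanSpace ℝ (Fin n)) ℝ).continuous
    · exact continuous_const.sub (WithLp.sndL 2 ℝ (EuclideanSpace ℝ (Fin n)) ℝ).continuous

theorem isOpen_feasible1 : IsOpen {z | ∀ j, 0 < D.a1 j z} := by
  simp only [ofPred_forall]
  exact isOpen_iInter_of_finite fun i => isOpen_lt continuous_const (h.continuous_a1 i)

/-- An affine function is the zero function plus the linear and constant parts allowed by
`IsRegularOn.comp_add`. -/
theorem regular_affine (ℓ : Point1 n →L[ℝ] ℝ) (b : ℝ) :
    IsRegularOn (fun z => ℓ z + b) {z | ∀ j, 0 < D.a1 j z} D.L₁ (4 * L₂) := by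
  have hM : 0 ≤ 4 * L₂ := by have := h.lip₂_pos; positivity
  simpa using (isRegularOn_zero (E := Point1 n) isOpen_univ h.L₁_pos.le hM).comp_add
    h.L₁_pos.le hM (ContinuousLinearMap.id ℝ (Point1 n)) (fun z => le_rfl) ℓ b
    h.isOpen_feasible1 (fun z hz => mem_univ _)

theorem regular_obj1 : IsRegularOn (f1 (n := n)) {z | ∀ j, 0 < D.a1 j z} D.L₁ (4 * L₂) := by
  have := h.regular_affine (WithLp.sndL 2 ℝ (EuclideanSpace ℝ (Fin n)) ℝ) 0
  simp only [add_zero] at this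
  exact this

theorem regular_con1 (j : Fin m ⊕ Fin 2) :
    IsRegularOn (D.a1 j) {z | ∀ j, 0 < D.a1 j z} D.L₁ (4 * L₂) := by
  rcases j with i | j
  · rw [D.a1_inl_eq]
    exact (h.regular_con i).comp_add h.L₁_pos.le (by have := h.lip₂_pos; positivity)
      (WithLp.fstL 2 ℝ (EuclideanSpace ℝ (Fin n)) ℝ) (fun z => WithLp.norm_fst_le _ z)
      (WithLp.sndL 2 ℝ (EuclideanSpace ℝ (Fin n)) ℝ) 0 h.isOpen_feasible1
      (fun z hz => feasible1_con hz)
  · fin_cases j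
    · exact h.regular_obj1
    · have := h.regular_affine (-WithLp.sndL 2 ℝ (EuclideanSpace ℝ (Fin n)) ℝ) (D.εopt / 2 + D.t₀)
      convert this using 1
      funext z
      simp [a1]
      ring

theorem iter1 {z z' : Point1 n} {y' : Fin m ⊕ Fin 2 → ℝ} (hz : ∀ j, 0 < D.a1 j z)
    (hit : D.Iter1 z z' y') : (∀ j, 0 < D.a1 j z') ∧ (D.Stop1 z' y' ∨
      barrier f1 D.a1 D.μ1 z' ≤ barrier f1 D.a1 D.μ1 z - D.μ1 * etaS D.μ1 D.τ1 D.L₁ ^ 3) :=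
  ipmIteration_stop_or_decrease h.regular_obj1 h.regular_con1 h.continuous_a1 h.μ1_pos h.τ1_pos
    h.L₁_pos (by have := h.lip₂_pos; positivity) (h.τ1_sq_mul_le.trans (by norm_num))
    (h.lip_small h.μ1_le) (h.σ_large_of_le h.μ1_pos h.μ1_le) hz hit

theorem iter2 {x x' : EuclideanSpace ℝ (Fin n)} {y' : Fin m → ℝ} (hx : ∀ j, 0 < D.a2 j x)
    (hit : D.Iter2 x x' y') : (∀ j, 0 < D.a2 j x') ∧ (D.Stop2 x' y' ∨
      barrier D.f D.a2 D.μ2 x' ≤ barrier D.f D.a2 D.μ2 x - D.μ2 * etaS D.μ2 D.τ2 D.L₁ ^ 3) :=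
  ipmIteration_stop_or_decrease h.regular_obj2 h.regular_con2
    (fun i => (h.continuous_con i).add continuous_const) h.μ2_pos h.τ2_pos
    h.L₁_pos (by have := h.lip₂_pos; positivity) h.τ2_sq_mul_le
    (h.lip_small le_rfl) (h.σ_large_of_le h.μ2_pos le_rfl) hx hit

end IsAdmissible

end Input

/-! ### Gradients and multipliers at a point passing the test -/

theorem lagrangian_gradient_eq {E : Type*} [NormedAddCommGroup E] [InnerProductSpace ℝ E]
    [CompleteSpace E] {ι : Type*} [Fintype ι] {f : E → ℝ} {a : ι → E → ℝ} {x : E} (y : ι → ℝ)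
    (hf : DifferentiableAt ℝ f x) (ha : ∀ i, DifferentiableAt ℝ (a i) x) :
    gradient (lagrangian f a y) x = gradient f x - ∑ i, y i • gradient (a i) x := by
  simp only [gradient, (hasFDerivAt_lagrangian y hf ha).fderiv, map_sub, map_sum, map_smul]

theorem norm_gradient_le_of_lipschitz {E : Type*} [NormedAddCommGroup E] [InnerProductSpace ℝ E]
    [CompleteSpace E] {f : E → ℝ} {K : ℝ} (hK : 0 ≤ K) (h : ∀ x z, |f x - f z| ≤ K * ‖x - z‖)
    (x : E) : ‖gradient f x‖ ≤ K := by
  rw [gradient, LinearIsometryEquiv.norm_map]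
  refine norm_fderiv_le_of_lip' ℝ hK (Eventually.of_forall fun z => ?_)
  simpa using h z x

/-- Lower bounds of the sum `Y` of the dual variables of the relaxed constraints in phase one. -/
theorem dual_sum_ge {Y yt yu q : ℝ} (hq1 : 1 ≤ q) (hq2 : q ^ 2 = Y + yt + yu + 1)
    (hyt : yt ≤ 3 / 16) (hyu : 0 ≤ yu) (h : |1 - Y - yt + yu| ≤ q / 12) :
    q ≤ 12 * Y ∧ 1 / 2 ≤ Y := by
  -- Eliminating `yu` gives `q² ≤ 2Y + 3/8 + q/12`. With `Y < q/12` this contradicts `q ≥ 1`; with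
  -- `Y < 1/2` it gives `q ≤ 3/2`, and then `1 - Y - yt + yu` is too large.
  obtain ⟨h1, h2⟩ := abs_le.1 h
  constructor
  · by_contra! hcon
    nlinarith
  · by_contra! hcon
    have : q ≤ 3 / 2 := by nlinarith
    linarith

theorem norm1_eq_sum {ι : Type*} [Fintype ι] {y : ι → ℝ} (hy : ∀ i, 0 < y i) :
    norm1 y = ∑ i, y i := Finset.sum_congr rfl fun i _ => abs_of_pos (hy i)

theorem norm1_div {ι : Type*} [Fintype ι] {y : ι → ℝ} (hy : ∀ i, 0 < y i) (hY : 0 < norm1 y) :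
    norm1 (fun i => y i / norm1 y) = 1 := by
  rw [norm1_eq_sum fun i => div_pos (hy i) hY, ← Finset.sum_div, ← norm1_eq_sum hy,
    div_self hY.ne']

/-- The derivative of the Lagrangian of `min t` subject to `aᵢ(x) + t ≥ 0`, `t ≥ 0`, `b - t ≥ 0`. -/
theorem fderiv_lagrangian_relaxed {E F : Type*} [NormedAddCommGroup E] [InnerProductSpace ℝ E]
    [NormedAddCommGroup F] [InnerProductSpace ℝ F] {m : ℕ} (P : F →L[ℝ] E) (S : F →L[ℝ] ℝ)
    {f : F → ℝ} {a : Fin m → E → ℝ} {a' : Fin m ⊕ Fin 2 → F → ℝ} {b : ℝ}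
    (hf : ∀ z, f z = S z) (hi : ∀ i z, a' (.inl i) z = a i (P z) + S z)
    (h0 : ∀ z, a' (.inr 0) z = S z) (h1 : ∀ z, a' (.inr 1) z = b - S z) {z : F}
    (ha : ∀ i, DifferentiableAt ℝ (a i) (P z)) (y : Fin m ⊕ Fin 2 → ℝ) (v : F) :
    fderiv ℝ (lagrangian f a' y) z v =
      S v - (∑ i, y (.inl i) * (fderiv ℝ (a i) (P z) (P v) + S v) +
        (y (.inr 0) * S v + y (.inr 1) * -S v)) := by
  have hd : ∀ i, HasFDerivAt (a' (.inl i)) ((fderiv ℝ (a i) (P z)).comp P + S) z := fun i => by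
    rw [funext (hi i)]
    exact ((ha i).hasFDerivAt.comp z P.hasFDerivAt).fun_add S.hasFDerivAt
  have hd0 : HasFDerivAt (a' (.inr 0)) S z := by
    rw [funext h0]
    exact S.hasFDerivAt
  have hd1 : HasFDerivAt (a' (.inr 1)) (-S) z := by
    rw [funext h1]
    exact S.hasFDerivAt.const_sub b
  have hdf : HasFDerivAt f S z := by
    rw [funext hf]
    exact S.hasFDerivAt
  have hda : ∀ j, DifferentiableAt ℝ (a' j) z := by
    rintro (i | j)
    · exact (hd i).differentiableAt
    · fin_cases j
      · exact hd0.differentiableAt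
      · exact hd1.differentiableAt
  rw [(hasFDerivAt_lagrangian y hdf.differentiableAt hda).fderiv]
  simp only [Fintype.sum_sum_type, Fin.sum_univ_two, hdf.fderiv, (hd _).fderiv, hd0.fderiv,
    hd1.fderiv]
  simp only [_root_.sub_apply, _root_.add_apply, _root_.sum_apply, _root_.smul_apply,
    _root_.neg_apply, ContinuousLinearMap.comp_apply, smul_eq_mul]

/-! ### Range of the potentials and correctness of the output -/

namespace Input

variable {n m : ℕ}

theorem start_le (D : Input n m) (i : Fin m) : D.εopt / 2 ≤ D.a i D.x₀ + D.t₀ := by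
  have := D.neg_le_violation D.x₀ i
  rw [t₀]
  linarith

theorem gradient_a2 (D : Input n m) (i : Fin m) (x : EuclideanSpace ℝ (Fin n)) :
    gradient (D.a2 i) x = gradient (D.a i) x := by
  have : D.a2 i = fun x => D.a i x + D.εopt := rfl
  rw [gradient, gradient, this, fderiv_add_const]

theorem start_feasible (D : Input n m) {j : Fin m ⊕ Fin 2} (ht : D.εopt / 2 < D.t₀) :
    D.εopt / 2 ≤ D.a1 j (WithLp.toLp 2 (D.x₀, D.t₀)) := by
  rcases j with i | j
  · exact D.start_le i
  · fin_cases j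
    · exact ht.le
    · simp [a1]

namespace IsAdmissible

variable {D : Input n m} {L₂ c Δf Δa : ℝ} (h : D.IsAdmissible L₂ c Δf Δa)
include h

theorem t₀_le : D.t₀ ≤ 1 / 2 + Δa := by
  have := h.violation_le
  have := h.εopt_le_one
  rw [t₀]
  linarith

/-- One constraint contributes at most the logarithm of `B c / (εopt / 2)`, an upper bound of the
slack over a lower bound of its starting value. -/
theorem log_sub_log_le {s s' B : ℝ} (hB : 0 < B) (hs : 0 < s) (hsB : s ≤ B * c)
    (hs' : D.εopt / 2 ≤ s') :
    Real.log s - Real.log s' ≤ logPlus (c / D.εopt) + Real.log (2 * B) := by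
  have ho := h.εopt_pos
  have hc := one_pos.trans_le h.one_le_c
  have h1 : Real.log s ≤ Real.log (B * c) := Real.log_le_log hs hsB
  have h2 : Real.log (D.εopt / 2) ≤ Real.log s' := Real.log_le_log (by positivity) hs'
  have h3 : Real.log (c / D.εopt) ≤ logPlus (c / D.εopt) := le_max_left _ _
  rw [Real.log_mul hB.ne' hc.ne'] at h1
  rw [Real.log_div ho.ne' two_ne_zero] at h2
  rw [Real.log_div hc.ne' ho.ne'] at h3
  rw [Real.log_mul two_ne_zero hB.ne']
  linarith

theorem a1_le {z : Point1 n} (hz : ∀ j, 0 < D.a1 j z) (j : Fin m ⊕ Fin 2) :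
    D.a1 j z ≤ 3 * Δa * c := by
  have ht := h.t₀_le
  have ho := h.εopt_le_one
  have hc := h.one_le_c
  have ha := h.one_le_Δa
  have hz1 : 0 < D.εopt / 2 + D.t₀ - z.snd := hz (.inr 1)
  have hz0 : 0 < z.snd := hz (.inr 0)
  have hb : c + (1 + Δa) ≤ 3 * Δa * c := by nlinarith
  rcases j with i | j
  · have := h.con_le z.fst (fun i => (feasible1_con hz i).le) i
    change D.a i z.fst + z.snd ≤ _
    linarith
  · fin_cases j
    · change z.snd ≤ _
      linarith
    · change D.εopt / 2 + D.t₀ - z.snd ≤ _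
      linarith

/-- The barrier function of phase one decreases by at most `4 Δa`. -/
theorem potential1_le (ht : D.εopt / 2 < D.t₀) {z : Point1 n} (hz : ∀ j, 0 < D.a1 j z) :
    barrier f1 D.a1 D.μ1 (WithLp.toLp 2 (D.x₀, D.t₀)) - barrier f1 D.a1 D.μ1 z ≤ 4 * Δa := by
  have hΔ := h.one_le_Δa
  have hΔ0 : 0 < Δa := by linarith
  have ho := h.εopt_pos
  have hm := h.one_le_m
  have hl : (1 : ℝ) ≤ logPlus (c / D.εopt) := le_max_right _ _
  have hterm : ∀ j, Real.log (D.a1 j z) - Real.log (D.a1 j (WithLp.toLp 2 (D.x₀, D.t₀))) ≤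
      logPlus (c / D.εopt) + 6 * Δa := by
    intro j
    have h1 := h.log_sub_log_le (B := 3 * Δa) (by positivity) (hz j) (h.a1_le hz j)
      (D.start_feasible (j := j) ht)
    have h2 := Real.log_le_sub_one_of_pos (show 0 < 2 * (3 * Δa) by positivity)
    linarith
  have hsum := Finset.sum_le_sum fun j (_ : j ∈ Finset.univ) => hterm j
  rw [Finset.sum_sub_distrib, Finset.sum_const, Finset.card_univ, Fintype.card_sum,
    Fintype.card_fin, Fintype.card_fin, nsmul_eq_mul] at hsum
  push_cast at hsum
  -- The two extra constraints are absorbed by `m + 2 ≤ 3m`. After multiplication by `μ1 ≤ εopt /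
  -- 12` the logarithmic terms cost at most `1/4 + 3Δa/2`, and the objective at most `1/2 + Δa`.
  have hcard : ((m : ℝ) + 2) * (logPlus (c / D.εopt) + 6 * Δa) ≤
      3 * m * (logPlus (c / D.εopt) + 6 * Δa) := by gcongr; linarith
  have hμ : D.μ1 ≤ D.εopt / 12 := by
    have := h.εinf_le_one
    unfold μ1
    nlinarith
  have h3 := mul_le_mul_of_nonneg_left (hsum.trans hcard) h.μ1_pos.le
  have h4 : D.μ1 * (3 * m * (logPlus (c / D.εopt) + 6 * Δa)) ≤
      D.εopt / 12 * (3 * m * (logPlus (c / D.εopt) + 6 * Δa)) := by gcongr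
  have h5 := h.m_logPlus_mul_le
  have h6 : m * D.εopt * Δa ≤ 1 * Δa := by
    have := h.m_mul_εopt_le; gcongr
  have hz0 : 0 < z.snd := hz (.inr 0)
  have ht0 := h.t₀_le
  have hs : (WithLp.toLp 2 (D.x₀, D.t₀) : Point1 n).snd = D.t₀ := rfl
  simp only [barrier, f1, hs]
  linarith

/-- The barrier function of phase two decreases by at most `2 Δf`. -/
theorem potential2_le {x₁ x : EuclideanSpace ℝ (Fin n)} (hx₁ : ∀ i, -(D.εopt / 2) ≤ D.a i x₁)
    (hx : ∀ i, 0 < D.a2 i x) :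
    barrier D.f D.a2 D.μ2 x₁ - barrier D.f D.a2 D.μ2 x ≤ 2 * Δf := by
  have hΔ := h.one_le_Δf
  have ho := h.εopt_pos
  have ho1 := h.εopt_le_one
  have hc := h.one_le_c
  have hterm : ∀ i, Real.log (D.a2 i x) - Real.log (D.a2 i x₁) ≤ logPlus (c / D.εopt) + 3 := by
    intro i
    have hle := h.con_le x (fun i => (feasible2_con hx i).le) i
    have h1 := h.log_sub_log_le (B := 2) two_pos (hx i) (by rw [a2]; linarith)
      (s' := D.a2 i x₁) (by rw [a2]; linarith [hx₁ i])
    have h2 := Real.log_le_sub_one_of_pos (show (0 : ℝ) < 2 * 2 by norm_num)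
    exact h1.trans (add_le_add_right (h2.trans (by norm_num)) _)
  have hsum := Finset.sum_le_sum fun j (_ : j ∈ Finset.univ) => hterm j
  rw [Finset.sum_sub_distrib, Finset.sum_const, Finset.card_univ,
    Fintype.card_fin, nsmul_eq_mul] at hsum
  have h3 := mul_le_mul_of_nonneg_left hsum h.μ2_pos.le
  -- This is at most `(1 + 3) / 4 = 1`, which the second `Δf` pays for.
  have h4 : D.μ2 * (m * (logPlus (c / D.εopt) + 3)) =
    (m * logPlus (c / D.εopt) * D.εopt + 3 * (m * D.εopt)) / 4 := by rw [μ2]; ring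
  have h5 := h.m_logPlus_mul_le
  have h6 := h.m_mul_εopt_le
  have h7 := h.obj_gap x₁ (fun i => by linarith [hx₁ i]) x (fun i => by
    have : 0 < D.a i x + D.εopt := hx i
    linarith)
  simp only [barrier]
  linarith

theorem differentiableAt_con {x : EuclideanSpace ℝ (Fin n)}
    (hx : ∀ i, -(D.εopt / 2 + D.t₀) < D.a i x) (i : Fin m) : DifferentiableAt ℝ (D.a i) x :=
  (h.regular_con i).differentiableAt x hx

theorem gradient_lagrangian2 {x : EuclideanSpace ℝ (Fin n)} (hx : ∀ i, 0 < D.a2 i x)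
    (y : Fin m → ℝ) : gradient (lagrangian D.f D.a2 y) x =
      gradient D.f x - ∑ i, y i • gradient (D.a i) x := by
  rw [lagrangian_gradient_eq y (h.regular_obj2.differentiableAt x hx)
    (fun i => (h.regular_con2 i).differentiableAt x hx)]
  simp only [D.gradient_a2]

/-- Since `τc ≤ 1/4`, each product is at most `9/8` of `μ2 = εopt / 4`. -/
theorem dual_mul_le2 {x : EuclideanSpace ℝ (Fin n)} {y : Fin m → ℝ} (hs : D.Stop2 x y)
    (i : Fin m) : y i * (D.a i x + D.εopt) ≤ 9 / 32 * D.εopt := by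
  have h1 := (abs_le.1 (hs.1.2.2.1 i)).2
  have h2 : Real.sqrt (D.τ2 ^ 2 * D.μ2 / D.L₁) ≤ 1 / 4 := by
    rw [Real.sqrt_le_left (by norm_num)]
    exact h.τ2_sq_mul_le.trans (by norm_num)
  have h3 : Real.sqrt (D.τ2 ^ 2 * D.μ2 / D.L₁) * D.μ2 ≤ 1 / 4 * D.μ2 := by
    have := h.μ2_pos; gcongr
  have h4 : D.μ2 = D.εopt / 4 := rfl
  change y i * (D.a i x + D.εopt) - D.μ2 ≤ _ at h1
  linarith

/-- Because `εopt² ≤ εinf`, the threshold bounds `‖y‖₁ + 1` by a multiple of `(L₀ + 1) / εinf`. The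
choice of `τ2` cancels this factor, leaving `2 μ2 ≤ εopt`. -/
theorem isKKT_of_stop2 {x : EuclideanSpace ℝ (Fin n)} {y : Fin m → ℝ} (hs : D.Stop2 x y)
    (hy : norm1 y ≤ D.dualThreshold) : D.IsKKT x y := by
  have hx : ∀ i, 0 < D.a2 i x := hs.1.1
  have hyp : ∀ i, 0 < y i := hs.1.2.1
  have hf := h.regular_obj2.differentiableAt x hx
  have ha := h.differentiableAt_con (feasible2_con hx)
  have ho := h.εopt_pos
  refine ⟨hf, ha, fun i => ?_, ?_, fun i => (hyp i).le, fun i => ?_⟩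
  · have : 0 < D.a i x + D.εopt := hx i
    linarith
  · rw [lagrangian_gradient_eq y hf ha, ← h.gradient_lagrangian2 hx]
    refine hs.1.2.2.2.trans ?_
    have hi := h.εinf_pos
    have hi1 := h.εinf_le_one
    have hL0 := h.one_le_L₀
    have hN : 0 ≤ norm1 y := Finset.sum_nonneg fun i _ => abs_nonneg _
    have hsq : D.εopt ^ 2 ≤ D.εinf := by
      have := h.εopt_le_sqrt
      rw [← Real.sq_sqrt hi.le]
      gcongr
    have hy2 : norm1 y + 1 ≤ (3 * (D.L₀ + 1) + 1) / D.εinf := by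
      refine (add_le_add_left hy 1).trans ?_
      have e : D.dualThreshold + 1 = (3 * (D.εopt ^ 2 / D.εinf) + 3 * D.L₀ + D.εinf) / D.εinf := by
        rw [dualThreshold]; field_simp
      rw [e]
      have : D.εopt ^ 2 / D.εinf ≤ 1 := (div_le_one hi).2 hsq
      gcongr
      linarith
    have hroot : D.τ2 * Real.sqrt (norm1 y + 1) ≤ 2 := by
      refine abs_le_of_sq_le_sq' ?_ (by norm_num) |>.2
      rw [mul_pow, h.τ2_sq, Real.sq_sqrt (by linarith)]
      calc D.εinf / (2 * (D.L₀ + 1)) * (norm1 y + 1)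
          ≤ D.εinf / (2 * (D.L₀ + 1)) * ((3 * (D.L₀ + 1) + 1) / D.εinf) := by gcongr
        _ = (3 * (D.L₀ + 1) + 1) / (2 * (D.L₀ + 1)) := by field_simp
        _ ≤ 2 ^ 2 := by rw [div_le_iff₀ (by positivity)]; linarith
    calc D.τ2 * D.μ2 * Real.sqrt (norm1 y + 1) = D.τ2 * Real.sqrt (norm1 y + 1) * D.μ2 := by ring
      _ ≤ 2 * D.μ2 := by have := h.μ2_pos; gcongr
      _ ≤ D.εopt := by rw [μ2]; linarith
  · have h1 := h.dual_mul_le2 hs i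
    have h2 := mul_pos (hyp i) ho
    linarith

/-- Large multipliers have two effects. Dividing stationarity by `‖y‖₁` leaves `∇f / ‖y‖₁` of norm
at most `εinf / 3`. And `εinf ≤ L₀ / m` gives `‖y‖₁ > 3m`, so some `y i` exceeds `3`;
complementarity makes that slack small enough for `a i` to lie below `-εopt / 2`. -/
theorem isInfeasCert_of_stop2 {x : EuclideanSpace ℝ (Fin n)} {y : Fin m → ℝ} (hs : D.Stop2 x y)
    (hy : D.dualThreshold < norm1 y) :
    D.IsInfeasCert x D.εopt (fun i => y i / norm1 y) := by
  have hx : ∀ i, 0 < D.a2 i x := hs.1.1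
  have hyp : ∀ i, 0 < y i := hs.1.2.1
  have ho := h.εopt_pos
  have hi := h.εinf_pos
  have hi1 := h.εinf_le_one
  have hL0 := h.one_le_L₀
  have hm := h.one_le_m
  have hY3 : 3 * D.L₀ / D.εinf < norm1 y := by
    refine lt_of_le_of_lt ?_ hy
    rw [dualThreshold]
    have : 0 ≤ 3 * D.εopt ^ 2 / D.εinf ^ 2 := by positivity
    linarith
  have hYi : 3 * D.L₀ < norm1 y * D.εinf := (div_lt_iff₀ hi).1 hY3
  have hYpos : 0 < norm1 y := lt_trans (by positivity) hY3
  have hY1 : 1 ≤ norm1 y := by nlinarith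
  refine ⟨h.differentiableAt_con (feasible2_con hx), ?_, fun i => (hx i).le, ?_, norm1_div hyp hYpos,
    fun i => (div_pos (hyp i) hYpos).le, fun i => ?_⟩
  · have hbig : ∃ i, 3 < y i := by
      by_contra! hcon
      have h1 : norm1 y ≤ m * 3 := by
        rw [norm1_eq_sum hyp]
        simpa using Finset.sum_le_sum fun i (_ : i ∈ Finset.univ) => hcon i
      have h2 : D.εinf * m ≤ D.L₀ := (le_div_iff₀ (by linarith)).1 h.εinf_le
      have h3 : norm1 y * D.εinf ≤ m * 3 * D.εinf := by gcongr
      linarith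
    obtain ⟨i, hi3⟩ := hbig
    refine ⟨i, ?_⟩
    have h1 := h.dual_mul_le2 hs i
    have h2 : 0 < D.a i x + D.εopt := hx i
    have h3 : 3 * (D.a i x + D.εopt) ≤ y i * (D.a i x + D.εopt) := by gcongr
    linarith
  · have e : ∑ i, (y i / norm1 y) • gradient (D.a i) x =
        (norm1 y)⁻¹ • (gradient D.f x - gradient (lagrangian D.f D.a2 y) x) := by
      rw [h.gradient_lagrangian2 hx, sub_sub_cancel, Finset.smul_sum]
      exact Finset.sum_congr rfl fun i _ => by rw [smul_smul, div_eq_inv_mul]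
    rw [e, norm_smul, norm_inv, Real.norm_of_nonneg hYpos.le, ← div_eq_inv_mul,
      div_le_iff₀ hYpos]
    have hroot : D.τ2 * Real.sqrt (norm1 y + 1) ≤ D.εinf * norm1 y := by
      refine abs_le_of_sq_le_sq' ?_ (by positivity) |>.2
      rw [mul_pow, h.τ2_sq, Real.sq_sqrt (by linarith), mul_pow]
      have h1 : D.εinf / (2 * (D.L₀ + 1)) ≤ D.εinf / 2 := by
        gcongr; linarith
      calc D.εinf / (2 * (D.L₀ + 1)) * (norm1 y + 1) ≤ D.εinf / 2 * (2 * norm1 y) := by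
            gcongr; linarith
        _ = D.εinf * norm1 y * 1 := by ring
        _ ≤ D.εinf * norm1 y * (norm1 y * D.εinf) := by gcongr; linarith
        _ = _ := by ring
    have h4 : D.τ2 * D.μ2 * Real.sqrt (norm1 y + 1) ≤ 1 / 4 * (D.εinf * norm1 y) := by
      have hμ : D.μ2 ≤ 1 / 4 := by have := h.εopt_le_one; rw [μ2]; linarith
      calc D.τ2 * D.μ2 * Real.sqrt (norm1 y + 1) =
            D.μ2 * (D.τ2 * Real.sqrt (norm1 y + 1)) := by ring
        _ ≤ 1 / 4 * (D.εinf * norm1 y) := by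
            have := h.μ2_pos; have := h.τ2_pos; gcongr
    have h5 := norm_sub_le (gradient D.f x) (gradient (lagrangian D.f D.a2 y) x)
    have h6 := norm_gradient_le_of_lipschitz h.L₀_pos.le h.obj_lip x
    have h7 := hs.1.2.2.2
    have : 0 < D.εinf * norm1 y := by positivity
    linarith
  · have h1 := h.dual_mul_le2 hs i
    rw [mul_div_assoc', div_le_iff₀ hYpos]
    have h2 : D.εopt * (3 * D.L₀) ≤ D.εopt * (norm1 y * D.εinf) := by gcongr
    nlinarith

theorem fderiv_lagrangian1 {z : Point1 n} (hz : ∀ j, 0 < D.a1 j z) (y : Fin m ⊕ Fin 2 → ℝ)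
    (g : EuclideanSpace ℝ (Fin n)) (s : ℝ) :
    fderiv ℝ (lagrangian f1 D.a1 y) z (WithLp.toLp 2 (g, s)) =
      s - (∑ i, y (.inl i) * (fderiv ℝ (D.a i) z.fst g + s) +
        (y (.inr 0) * s + y (.inr 1) * -s)) :=
  fderiv_lagrangian_relaxed (WithLp.fstL 2 ℝ (EuclideanSpace ℝ (Fin n)) ℝ)
    (WithLp.sndL 2 ℝ (EuclideanSpace ℝ (Fin n)) ℝ) (a := D.a) (a' := D.a1)
    (b := D.εopt / 2 + D.t₀) (fun _ => rfl) (fun _ _ => rfl) (fun _ => rfl) (fun _ => rfl)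
    (h.differentiableAt_con (feasible1_con hz)) y (WithLp.toLp 2 (g, s))

/-- Stationarity is tested in two directions of `(x, t)`. Along `t` it relates the multiplier sums,
so `dual_sum_ge` bounds both `1` and the scaling factor `q` by multiples of `Y`. Along `x` it bounds
the combination of constraint gradients by `εinf q / 12`, hence by `εinf Y`. -/
theorem isInfeasCert_of_stop1 {z : Point1 n} {y : Fin m ⊕ Fin 2 → ℝ} (hs : D.Stop1 z y)
    (hinf : ∃ i, D.a i z.fst < -D.εopt / 2) :
    D.IsInfeasCert z.fst z.snd (fun i => y (.inl i) / norm1 fun j => y (.inl j)) := by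
  have hz : ∀ j, 0 < D.a1 j z := hs.1.1
  have hyp : ∀ j, 0 < y j := hs.1.2.1
  have ho := h.εopt_pos
  have ho1 := h.εopt_le_one
  have hi := h.εinf_pos
  have hi1 := h.εinf_le_one
  have ha := h.differentiableAt_con (feasible1_con hz)
  have hslack : ∀ j, y j * D.a1 j z ≤ 9 / 8 * D.μ1 := by
    intro j
    have h1 := (abs_le.1 (hs.1.2.2.1 j)).2
    have h2 : Real.sqrt (D.τ1 ^ 2 * D.μ1 / D.L₁) ≤ 1 / 4 := by
      rw [Real.sqrt_le_left (by norm_num)]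
      exact h.τ1_sq_mul_le.trans (by norm_num)
    have h3 : Real.sqrt (D.τ1 ^ 2 * D.μ1 / D.L₁) * D.μ1 ≤ 1 / 4 * D.μ1 := by
      have := h.μ1_pos; gcongr
    linarith
  set Y := norm1 fun j => y (.inl j) with hYdef
  have hYsum : Y = ∑ i, y (.inl i) := norm1_eq_sum fun i => hyp _
  have hY0 : 0 ≤ Y := Finset.sum_nonneg fun i _ => abs_nonneg _
  set yt := y (.inr 0) with hyt
  set yu := y (.inr 1) with hyu
  have hyu0 : 0 < yu := hyp _
  have hyt0 : 0 < yt := hyp _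
  have hN : norm1 y = Y + yt + yu := by
    rw [norm1_eq_sum hyp, Fintype.sum_sum_type, Fin.sum_univ_two, hYsum, add_assoc]
  set q := Real.sqrt (norm1 y + 1) with hq
  have hq2 : q ^ 2 = Y + yt + yu + 1 := by
    rw [hq, Real.sq_sqrt (by rw [hN]; positivity), hN]
  have hq0 : 0 ≤ q := Real.sqrt_nonneg _
  have hq1 : 1 ≤ q := by nlinarith
  -- A constraint violated by more than `εopt / 2` forces `t > εopt / 2`, so complementarity limits
  -- the multiplier of `t ≥ 0`.
  have hyt_le : yt ≤ 3 / 16 := by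
    obtain ⟨i, hi'⟩ := hinf
    have h1 : 0 < D.a i z.fst + z.snd := hz (.inl i)
    have h2 := hslack (.inr 0)
    change yt * z.snd ≤ _ at h2
    have h3 : yt * (D.εopt / 2) ≤ yt * z.snd := by gcongr; linarith
    have h4 : D.μ1 ≤ D.εopt / 12 := by unfold μ1; nlinarith
    nlinarith
  have hτμ : D.τ1 * D.μ1 ≤ D.εinf / 12 := by
    calc D.τ1 * D.μ1 ≤ 1 / D.εopt * D.μ1 := by
          have := h.μ1_pos; gcongr; exact min_le_left _ _
      _ = D.εinf / 12 := by unfold μ1; field_simp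
  have hgrad : ‖gradient (lagrangian f1 D.a1 y) z‖ ≤ D.εinf / 12 * q :=
    hs.1.2.2.2.trans (by gcongr)
  have hder := fun g s => h.fderiv_lagrangian1 hz y g s
  rw [← hyt, ← hyu] at hder
  have hdual : |1 - Y - yt + yu| ≤ D.εinf / 12 * q := by
    have h1 := abs_fderiv_le_norm_gradient (lagrangian f1 D.a1 y) z (WithLp.toLp 2 (0, 1))
    rw [hder] at h1
    have hn : ‖(WithLp.toLp 2 ((0 : EuclideanSpace ℝ (Fin n)), (1 : ℝ)) : Point1 n)‖ = 1 := by
      simp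
    rw [hn, mul_one] at h1
    simp only [map_zero, zero_add, mul_one, ← hYsum, mul_neg] at h1
    refine le_trans (le_of_eq ?_) (h1.trans hgrad)
    congr 1
    ring
  have hqi : D.εinf / 12 * q ≤ q / 12 := by nlinarith
  obtain ⟨hq12, hYhalf⟩ := dual_sum_ge hq1 hq2 hyt_le hyu0.le (hdual.trans hqi)
  have hYpos : 0 < Y := by linarith
  refine ⟨ha, hinf, fun i => (hz (.inl i)).le, ?_, norm1_div (fun i => hyp _) hYpos,
    fun i => (div_pos (hyp _) hYpos).le, fun i => ?_⟩
  · have e : ∑ i, (y (.inl i) / Y) • gradient (D.a i) z.fst =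
        Y⁻¹ • ∑ i, y (.inl i) • gradient (D.a i) z.fst := by
      rw [Finset.smul_sum]
      exact Finset.sum_congr rfl fun i _ => by rw [smul_smul, div_eq_inv_mul]
    rw [e, norm_smul, norm_inv, Real.norm_of_nonneg hY0, ← div_eq_inv_mul, div_le_iff₀ hYpos]
    set g := ∑ i, y (.inl i) • gradient (D.a i) z.fst with hg
    -- Testing with the gradient combination `g` itself produces `‖g‖²` on the left.
    have h1 := abs_fderiv_le_norm_gradient (lagrangian f1 D.a1 y) z (WithLp.toLp 2 (g, 0))
    rw [hder, WithLp.norm_toLp_fst] at h1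
    simp only [mul_zero, neg_zero, add_zero, zero_sub, abs_neg] at h1
    have h2 : ∑ i, y (.inl i) * fderiv ℝ (D.a i) z.fst g = ‖g‖ ^ 2 := by
      rw [← real_inner_self_eq_norm_sq]
      conv_rhs => rw [hg, sum_inner]
      exact Finset.sum_congr rfl fun i _ => by rw [real_inner_smul_left, inner_gradient]
    rw [h2, abs_of_nonneg (sq_nonneg _)] at h1
    have h3 : ‖g‖ ≤ D.εinf / 12 * q := by
      by_contra! hcon
      have h4 : ‖gradient (lagrangian f1 D.a1 y) z‖ < ‖g‖ := hgrad.trans_lt hcon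
      have h5 : 0 < ‖g‖ := (norm_nonneg _).trans_lt h4
      nlinarith
    nlinarith
  · have h1 := hslack (.inl i)
    change y (.inl i) * (D.a i z.fst + z.snd) ≤ _ at h1
    rw [mul_div_assoc', div_le_iff₀ hYpos]
    have h2 : D.μ1 = D.εinf * D.εopt / 12 := rfl
    have h3 : 0 < D.εinf * D.εopt := by positivity
    have h4 : D.εinf * D.εopt * (1 / 2) ≤ D.εinf * D.εopt * Y := by gcongr
    linarith

end IsAdmissible

end Input

/-! ### Invariant of an execution and counting -/

namespace Input

variable {n m : ℕ}

/-- The progress of one non-final iteration of phase one. -/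
noncomputable def decrease1 (D : Input n m) : ℝ := D.μ1 * etaS D.μ1 D.τ1 D.L₁ ^ 3

/-- The progress of one non-final iteration of phase two. -/
noncomputable def decrease2 (D : Input n m) : ℝ := D.μ2 * etaS D.μ2 D.τ2 D.L₁ ^ 3

/-- What holds in a state reached after `k` trust region solves. -/
def Invariant (D : Input n m) (Δa Δf : ℝ) (k : ℕ) : State n m → Prop
  | .phaseOne z => (∀ j, 0 < D.a1 j z) ∧ D.εopt / 2 < D.t₀ ∧
      k * D.decrease1 ≤ barrier f1 D.a1 D.μ1 (WithLp.toLp 2 (D.x₀, D.t₀)) - barrier f1 D.a1 D.μ1 z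
  -- `x₁` is the starting point of phase two. Phase one is charged its whole budget, so the left
  -- side may be negative.
  | .phaseTwo x => (∀ i, 0 < D.a2 i x) ∧ ∃ x₁, (∀ i, -(D.εopt / 2) ≤ D.a i x₁) ∧
      (k - (4 * Δa / D.decrease1 + 1)) * D.decrease2 ≤
        barrier D.f D.a2 D.μ2 x₁ - barrier D.f D.a2 D.μ2 x
  | .done o => D.IsCorrect o ∧ k ≤ 4 * Δa / D.decrease1 + 1 + (2 * Δf / D.decrease2 + 1)

namespace IsAdmissible

variable {D : Input n m} {L₂ c Δf Δa : ℝ} (h : D.IsAdmissible L₂ c Δf Δa)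
include h

theorem decrease1_pos : 0 < D.decrease1 :=
  mul_pos h.μ1_pos (pow_pos (etaS_pos h.μ1_pos h.τ1_pos h.L₁_pos) 3)

theorem decrease2_pos : 0 < D.decrease2 :=
  mul_pos h.μ2_pos (pow_pos (etaS_pos h.μ2_pos h.τ2_pos h.L₁_pos) 3)

theorem invariant_phaseOne_le {k : ℕ} {z : Point1 n} (hI : D.Invariant Δa Δf k (.phaseOne z)) :
    k ≤ 4 * Δa / D.decrease1 := by
  rw [le_div_iff₀ h.decrease1_pos]
  exact hI.2.2.trans (h.potential1_le hI.2.1 hI.1)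

theorem invariant_phaseTwo_le {k : ℕ} {x : EuclideanSpace ℝ (Fin n)}
    (hI : D.Invariant Δa Δf k (.phaseTwo x)) :
    k ≤ 4 * Δa / D.decrease1 + 1 + 2 * Δf / D.decrease2 := by
  obtain ⟨hx, x₁, hx₁, hk⟩ := hI
  have := (le_div_iff₀ h.decrease2_pos).2 (hk.trans (h.potential2_le hx₁ hx))
  linarith

theorem invariant_phaseTwo_start {k : ℕ} {x : EuclideanSpace ℝ (Fin n)}
    (hx : ∀ i, -(D.εopt / 2) ≤ D.a i x) (hk : k ≤ 4 * Δa / D.decrease1 + 1) :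
    D.Invariant Δa Δf k (.phaseTwo x) := by
  have ho := h.εopt_pos
  refine ⟨fun i => ?_, x, hx, ?_⟩
  · have := hx i
    rw [a2]
    linarith
  · rw [sub_self]
    exact mul_nonpos_of_nonpos_of_nonneg (by linarith) h.decrease2_pos.le

theorem invariant_init : D.Invariant Δa Δf 0 D.init := by
  have hd := h.decrease1_pos
  have hΔ := h.one_le_Δa
  have ho := h.εopt_pos
  rw [init]
  split_ifs with ht
  · refine h.invariant_phaseTwo_start (fun i => ?_) (by push_cast; positivity)
    have h1 := D.neg_le_violation D.x₀ i
    rw [t₀] at ht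
    linarith
  · have ht' : D.εopt / 2 < D.t₀ := not_le.1 ht
    refine ⟨fun j => ?_, ht', by simp⟩
    have := D.start_feasible (j := j) ht'
    linarith

/-- Only iterations that fail the test are paid for by the potential; the successful last iteration
of each phase is the extra `1`. -/
theorem invariant_step {k : ℕ} {s s' : State n m} (hI : D.Invariant Δa Δf k s)
    (hs : D.Step s s') : D.Invariant Δa Δf (k + 1) s' := by
  have hd2 : 0 ≤ 2 * Δf / D.decrease2 :=
    div_nonneg (by have := h.one_le_Δf; linarith) h.decrease2_pos.le
  cases hs with
  | one_continue z z' y' hit htest =>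
    obtain ⟨hz', hor⟩ := h.iter1 hI.1 hit
    have hdec := hor.resolve_left htest
    refine ⟨hz', hI.2.1, ?_⟩
    have h1 := hI.2.2
    have e : D.decrease1 = D.μ1 * etaS D.μ1 D.τ1 D.L₁ ^ 3 := rfl
    push_cast
    rw [← e] at hdec
    linarith
  | one_infeasible z z' y' hit htest hinf =>
    refine ⟨h.isInfeasCert_of_stop1 htest hinf, ?_⟩
    have := h.invariant_phaseOne_le hI
    push_cast
    linarith
  | one_feasible z z' y' hit htest hfeas =>
    refine h.invariant_phaseTwo_start (fun i => ?_) ?_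
    · push Not at hfeas
      linarith [hfeas i]
    · have := h.invariant_phaseOne_le hI
      push_cast
      linarith
  | two_continue x x' y' hit htest =>
    obtain ⟨hx, x₁, hx₁, hk⟩ := hI
    obtain ⟨hx', hor⟩ := h.iter2 hx hit
    have hdec := hor.resolve_left htest
    refine ⟨hx', x₁, hx₁, ?_⟩
    have e : D.decrease2 = D.μ2 * etaS D.μ2 D.τ2 D.L₁ ^ 3 := rfl
    push_cast
    rw [← e] at hdec
    linarith
  | two_infeasible x x' y' hit htest hy =>
    refine ⟨h.isInfeasCert_of_stop2 htest hy, ?_⟩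
    have := h.invariant_phaseTwo_le hI
    push_cast
    linarith
  | two_kkt x x' y' hit htest hy =>
    refine ⟨h.isKKT_of_stop2 htest (not_lt.1 hy), ?_⟩
    have := h.invariant_phaseTwo_le hI
    push_cast
    linarith

theorem invariant_of_run {k : ℕ} {s : State n m} (hr : D.Run k s) : D.Invariant Δa Δf k s := by
  induction hr with
  | start => exact h.invariant_init
  | step k s s' _ hs ih => exact h.invariant_step ih hs

theorem count_le {k : ℕ} {s : State n m} (hI : D.Invariant Δa Δf k s) :
    k ≤ 4 * Δa / D.decrease1 + 1 + (2 * Δf / D.decrease2 + 1) := by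
  have hd2 : 0 ≤ 2 * Δf / D.decrease2 :=
    div_nonneg (by have := h.one_le_Δf; linarith) h.decrease2_pos.le
  match s, hI with
  | .phaseOne z, hI => have := h.invariant_phaseOne_le hI; linarith
  | .phaseTwo x, hI => have := h.invariant_phaseTwo_le hI; linarith
  | .done o, hI => exact hI.2

/-- Trust region minimizers exist in finite dimension, so only a returned result can stop an
execution. -/
theorem correct_or_step {k : ℕ} {s : State n m} (hI : D.Invariant Δa Δf k s) :
    (∃ o, s = .done o ∧ D.IsCorrect o) ∨ ∃ s', D.Step s s' := by
  match s, hI with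
  | .phaseOne z, hI =>
    right
    obtain ⟨z', y', hit⟩ := exists_ipmIteration f1 D.a1 h.μ1_pos h.τ1_pos h.L₁_pos z
    by_cases htest : D.Stop1 z' y'
    · by_cases hinf : ∃ i, D.a i z'.fst < -D.εopt / 2
      · exact ⟨_, .one_infeasible z z' y' hit htest hinf⟩
      · exact ⟨_, .one_feasible z z' y' hit htest hinf⟩
    · exact ⟨_, .one_continue z z' y' hit htest⟩
  | .phaseTwo x, hI =>
    right
    obtain ⟨x', y', hit⟩ := exists_ipmIteration D.f D.a2 h.μ2_pos h.τ2_pos h.L₁_pos x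
    by_cases htest : D.Stop2 x' y'
    · by_cases hy : D.dualThreshold < norm1 y'
      · exact ⟨_, .two_infeasible x x' y' hit htest hy⟩
      · exact ⟨_, .two_kkt x x' y' hit htest hy⟩
    · exact ⟨_, .two_continue x x' y' hit htest⟩
  | .done o, hI => exact Or.inl ⟨o, rfl, hI.1⟩

omit h in
theorem div_mul_cube_le {Δ μ η K : ℝ} (hΔ : 0 ≤ Δ) (hμ : 0 < μ) (hη : 0 < η)
    (hK : 1 ≤ K * η ^ 3) : Δ / (μ * η ^ 3) ≤ Δ / μ * K := by
  rw [div_le_iff₀ (by positivity)]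
  have e : Δ / μ * K * (μ * η ^ 3) = Δ * (K * η ^ 3) := by field_simp
  rw [e]
  exact le_mul_of_one_le_right hΔ hK

/-- Each entry of the minimum defining `τ1` yields one of the two summands; whichever is active, the
other is only added. -/
theorem phaseOne_bound : 4 * Δa / D.decrease1 ≤ 100000000 *
    (Δa * (D.L₁ ^ (3 / 4 : ℝ) / (D.εinf ^ (7 / 4 : ℝ) * D.εopt ^ (1 / 4 : ℝ)) +
      1 / (D.εinf * D.εopt))) := by
  have ho := h.εopt_pos
  have hi := h.εinf_pos
  have hL := h.L₁_pos
  have hΔ : 0 < Δa := one_pos.trans_le h.one_le_Δa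
  have hη := etaS_pos h.μ1_pos h.τ1_pos hL
  have hA : 0 ≤ D.L₁ ^ (3 / 4 : ℝ) / (D.εinf ^ (7 / 4 : ℝ) * D.εopt ^ (1 / 4 : ℝ)) := by positivity
  have hB : 0 ≤ 1 / (D.εinf * D.εopt) := by positivity
  have hμ : 4 * Δa / D.μ1 = 48 * (Δa * (1 / (D.εinf * D.εopt))) := by
    rw [μ1]; field_simp; norm_num
  rcases min_choice (1 / D.εopt) (Real.sqrt (D.L₁ / (2 * D.εopt * D.εinf))) with hc | hc
  · have hτ : D.τ1 = 1 / D.εopt := hc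
    -- Here `τ1² μ1 / L₁ = εinf / (12 εopt L₁)`; in the other case below it is the constant `1/24`.
    have hK := one_le_mul_etaS_cube (μ := D.μ1) (τ := D.τ1) (L := D.L₁) (c := 12)
      (Y := D.L₁ * D.εopt / D.εinf) (by norm_num) (by positivity)
      (le_of_eq (by rw [hτ, μ1]; field_simp))
    refine (div_mul_cube_le (by positivity) h.μ1_pos hη hK).trans ?_
    have e : 1 / (D.εinf * D.εopt) * (D.L₁ * D.εopt / D.εinf) ^ (3 / 4 : ℝ) =
        D.L₁ ^ (3 / 4 : ℝ) / (D.εinf ^ (7 / 4 : ℝ) * D.εopt ^ (1 / 4 : ℝ)) := by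
      rw [Real.div_rpow (by positivity) hi.le, Real.mul_rpow hL.le ho.le,
        show (7 / 4 : ℝ) = 1 + 3 / 4 by norm_num, Real.rpow_add hi, Real.rpow_one]
      have e1 : D.εopt = D.εopt ^ (1 / 4 : ℝ) * D.εopt ^ (3 / 4 : ℝ) := by
        rw [← Real.rpow_add ho]; norm_num
      have h3 : D.εopt ^ (3 / 4 : ℝ) ≠ 0 := by positivity
      have h4 : D.εopt ^ (1 / 4 : ℝ) ≠ 0 := by positivity
      rw [show 1 / (D.εinf * D.εopt) = 1 / (D.εinf * (D.εopt ^ (1 / 4 : ℝ) * D.εopt ^ (3 / 4 : ℝ)))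
        by rw [← e1]]
      field_simp
    calc 4 * Δa / D.μ1 * (64000 * 12 * (D.L₁ * D.εopt / D.εinf) ^ (3 / 4 : ℝ))
        = 36864000 * (Δa * (1 / (D.εinf * D.εopt) * (D.L₁ * D.εopt / D.εinf) ^ (3 / 4 : ℝ))) := by
          rw [hμ]; ring
      _ = 36864000 * (Δa * (D.L₁ ^ (3 / 4 : ℝ) / (D.εinf ^ (7 / 4 : ℝ) * D.εopt ^ (1 / 4 : ℝ)))) := by
          rw [e]
      _ ≤ _ :=
        mul_le_mul (by norm_num) (mul_le_mul_of_nonneg_left (by linarith) hΔ.le) (by positivity)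
          (by norm_num)
  · have hτ : D.τ1 = Real.sqrt (D.L₁ / (2 * D.εopt * D.εinf)) := hc
    have hK := one_le_mul_etaS_cube (μ := D.μ1) (τ := D.τ1) (L := D.L₁) (c := 24) (Y := 1)
      (by norm_num) one_pos (le_of_eq (by
        rw [hτ, Real.sq_sqrt (by positivity), μ1]; field_simp; norm_num))
    refine (div_mul_cube_le (by positivity) h.μ1_pos hη hK).trans ?_
    rw [Real.one_rpow, hμ]
    calc 48 * (Δa * (1 / (D.εinf * D.εopt))) * (64000 * 24 * 1)
        = 73728000 * (Δa * (1 / (D.εinf * D.εopt))) := by ring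
      _ ≤ _ :=
        mul_le_mul (by norm_num) (mul_le_mul_of_nonneg_left (by linarith) hΔ.le) (by positivity)
          (by norm_num)

/-- The constant `16` makes the required product `2 L₀ / (L₀ + 1)`, which is at least `1` because
`L₀ ≥ 1`. -/
theorem phaseTwo_bound : 2 * Δf / D.decrease2 ≤ 100000000 *
    (Δf / D.εopt * (D.L₁ * D.L₀ / (D.εopt * D.εinf)) ^ (3 / 4 : ℝ)) := by
  have ho := h.εopt_pos
  have hi := h.εinf_pos
  have hL := h.L₁_pos
  have hL0 := h.L₀_pos
  have hL01 := h.one_le_L₀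
  have hΔ : 0 < Δf := one_pos.trans_le h.one_le_Δf
  have hη := etaS_pos h.μ2_pos h.τ2_pos hL
  have hK := one_le_mul_etaS_cube (μ := D.μ2) (τ := D.τ2) (L := D.L₁) (c := 16)
    (Y := D.L₁ * D.L₀ / (D.εopt * D.εinf)) (by norm_num) (by positivity) (by
      rw [h.τ2_sq_mul_eq]
      have e : 16 * (D.L₁ * D.L₀ / (D.εopt * D.εinf)) *
          (D.εinf * D.εopt / (8 * (D.L₀ + 1) * D.L₁)) = 2 * D.L₀ / (D.L₀ + 1) := by
        field_simp; norm_num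
      rw [e, le_div_iff₀ (by linarith)]
      linarith)
  refine (div_mul_cube_le (by positivity) h.μ2_pos hη hK).trans ?_
  have hμ : 2 * Δf / D.μ2 = 8 * (Δf / D.εopt) := by rw [μ2]; field_simp; norm_num
  rw [hμ]
  have : 0 ≤ Δf / D.εopt * (D.L₁ * D.L₀ / (D.εopt * D.εinf)) ^ (3 / 4 : ℝ) := by positivity
  linarith

/-- The additive constants are absorbed because `Δa / (εinf εopt) ≥ 1`. -/
theorem total_bound : 4 * Δa / D.decrease1 + 1 + (2 * Δf / D.decrease2 + 1) ≤ 1000000000 *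
    (Δa * (D.L₁ ^ (3 / 4 : ℝ) / (D.εinf ^ (7 / 4 : ℝ) * D.εopt ^ (1 / 4 : ℝ)) +
      1 / (D.εinf * D.εopt)) +
      Δf / D.εopt * (D.L₁ * D.L₀ / (D.εopt * D.εinf)) ^ (3 / 4 : ℝ)) := by
  have ho := h.εopt_pos
  have hi := h.εinf_pos
  have hL := h.L₁_pos
  have hL0 := h.L₀_pos
  have hΔf : 0 < Δf := one_pos.trans_le h.one_le_Δf
  have h1 := h.phaseOne_bound
  have h2 := h.phaseTwo_bound
  have h3 : 1 ≤ Δa * (D.L₁ ^ (3 / 4 : ℝ) / (D.εinf ^ (7 / 4 : ℝ) * D.εopt ^ (1 / 4 : ℝ)) +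
      1 / (D.εinf * D.εopt)) := by
    have h4 : 1 ≤ 1 / (D.εinf * D.εopt) :=
      one_le_one_div (by positivity) (mul_le_one₀ h.εinf_le_one ho.le h.εopt_le_one)
    have h5 : 0 ≤ D.L₁ ^ (3 / 4 : ℝ) / (D.εinf ^ (7 / 4 : ℝ) * D.εopt ^ (1 / 4 : ℝ)) := by
      positivity
    exact one_le_mul_of_one_le_of_one_le h.one_le_Δa (by linarith)
  have h6 : 0 ≤ Δf / D.εopt * (D.L₁ * D.L₀ / (D.εopt * D.εinf)) ^ (3 / 4 : ℝ) := by positivity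
  linarith

end IsAdmissible

end Input

end TwoPhaseIPM

theorem mainTheorem4 :
    ∃ C : ℝ, 0 < C ∧
      ∀ (n m : ℕ) (D : TwoPhaseIPM.Input n m) (L₂ c Δf Δa : ℝ),
        0 < m →
        -- regularity of the constraints and of the objective
        (∀ i, Continuous (D.a i)) →
        0 < L₂ →
        (∀ i, TwoPhaseIPM.HasLipschitzDerivOn 1 D.L₁ (D.a i) D.X1) →
        (∀ i, TwoPhaseIPM.HasLipschitzDerivOn 2 L₂ (D.a i) D.X1) →
        TwoPhaseIPM.HasLipschitzDerivOn 1 D.L₁ D.f D.X2 →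
        TwoPhaseIPM.HasLipschitzDerivOn 2 L₂ D.f D.X2 →
        (∀ x z, |D.f x - D.f z| ≤ D.L₀ * ‖x - z‖) →
        -- the constants `c`, `Δf`, `Δa`
        (∀ x ∈ D.X1, ∀ i, D.a i x ≤ c) →
        (∀ x ∈ D.X2, ∀ z ∈ D.X2, D.f x - D.f z ≤ Δf) →
        D.violation D.x₀ ≤ Δa →
        1 ≤ c → 1 ≤ Δa → 1 ≤ Δf → 1 ≤ D.L₁ → 1 ≤ D.L₀ →
        -- the tolerances
        0 < D.εopt → D.εopt ≤ 1 / (m * TwoPhaseIPM.logPlus (c / D.εopt)) →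
        0 < D.εinf → D.εinf ≤ D.L₀ / m → D.εinf ≤ 1 →
        D.εopt ≤ Real.sqrt D.εinf →
        -- sufficiently small barrier parameters
        L₂ ^ 2 * D.εopt ≤ 4 * D.L₁ ^ 3 →
        40 * (D.L₁ ^ 3 * D.εopt) ^ (1 / 4 : ℝ) ≤ D.σ →
        -- every execution returns a correct result within the stated number of solves
        ∀ (k : ℕ) (s : TwoPhaseIPM.State n m), D.Run k s →
          (k : ℝ) ≤ C *
            (Δa * (D.L₁ ^ (3 / 4 : ℝ) / (D.εinf ^ (7 / 4 : ℝ) * D.εopt ^ (1 / 4 : ℝ))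
                + 1 / (D.εinf * D.εopt))
              + Δf / D.εopt * (D.L₁ * D.L₀ / (D.εopt * D.εinf)) ^ (3 / 4 : ℝ)) ∧
          ((∃ o, s = .done o ∧ D.IsCorrect o) ∨ ∃ s', D.Step s s') := by
  refine ⟨1000000000, by norm_num, ?_⟩
  intro n m D L₂ c Δf Δa h1 h2 h3 h4 h5 h6 h7 h8 h9 h10 h11 h12 h13 h14 h15 h16 h17 h18 h19 h20 h21
    h22 h23 h24 k s hr
  have h : D.IsAdmissible L₂ c Δf Δa := ⟨h1, h2, h3, h4, h5, h6, h7, h8, h9, h10, h11, h12, h13,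
    h14, h15, h16, h17, h18, h19, h20, h21, h22, h23, h24⟩
  -- The count bound holds in every reachable state and every unfinished state has a successor, so
  -- together they give termination.
  have hI := h.invariant_of_run hr
  exact ⟨(h.count_le hI).trans h.total_bound, h.correct_or_step hI⟩
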